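/- **Setting.** Let $Q=\begin{pmatrix}q_1&q_2\\q_3&q_4\end{pmatrix}$ have complex entries in $L_1[0,\pi]$ with $q_4=-q_1$, let $1\le p<\infty$, $1/p+1/p'=1$, and let $q_1$ and $q_2+q_3$ lie in $L_p[0,\pi]$ (for a general $Q\in L_1$ take $p=1$, $p'=\infty$). Put $R>0$ with $\|Q\|_{L_1}:=\sum_j\|q_j\|_{L_1}\le R$, $\|q_1\|_{L_p}\le R$, $\|q_2+q_3\|_{L_p}\le R$. For a complex $2\times4$ matrix $U$ with entries $u_{kj}$, let $L_{Q,U}$ be the operator $\mathbf y\mapsto -B\mathbf y'+Q\mathbf y$, $B=\begin{pmatrix}0&1\\-1&0\end{pmatrix}$, in $L_2[0,\pi]\oplus L_2[0,\pi]$, whose domain consists of all absolutely continuous $\mathbf y=(y_1,y_2)^t$ on $[0,\pi]$ with $-B\mathbf y'+Q\mathbf y\in L_2\oplus L_2$ and $U(y_1(0),y_2(0),y_1(\pi),y_2(\pi))^t=0$. Let $J_{\alpha\beta}$ be the determinant formed by columns $\alpha,\beta$ of $U$. The operator is *regular* if $J_{14}+J_{32}\pm i(J_{42}-J_{13})\ne0$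 for both signs. Let $$E=\exp\Big(\tfrac12\int_0^\pi(q_2-q_3)\,dx\Big),\qquad U'=\begin{pmatrix}u_{11}&u_{12}&Eu_{13}&Eu_{14}\\u_{21}&u_{22}&Eu_{23}&Eu_{24}\end{pmatrix},$$ let $J'_{\alpha\beta}$ be the corresponding determinants of $U'$, $a_\pm=J'_{14}-J'_{23}\mp i(J'_{13}+J'_{24})$, $b=J'_{12}+J'_{34}$, and let $\Delta^0(\lambda)=\frac12a_+e^{i\pi\lambda}+b+\frac12a_-e^{-i\pi\lambda}$ be the characteristic determinant of the free operator $L_{0,U'}$. Let $z_0,z_1$ be the roots (with multiplicity) of $a_+z^2+2bz+a_-=0$. The operator $L_{Q,U}$ is *strongly regular* if it is regular and $z_0\ne z_1$. With any branches of the logarithms put $\kappa_0=-\frac i\pi\ln z_0$, $\kappa_1=1-\frac i\pi\ln z_1$, and $\lambda_n^0=\kappa_0+n$ for even $n$, $\lambda_n^0=\kappa_1+n$ for odd $n\in\mathbb Z$. Let $\upsilon_1,\upsilon_2$ be $\int_0^xq_1(t)\sin(2\lambda t)\,dt$, $\int_0^xq_1(t)\cos(2\lambda t)\,dt$ and let $\upsilon_3,\upsilon_4$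 be $\frac12\int_0^x(q_2+q_3)(t)\sin(2\lambda t)\,dt$, $\frac12\int_0^x(q_2+q_3)(t)\cos(2\lambda t)\,dt$; put $\Upsilon(x,\lambda)=\sum_{j=1}^4|\upsilon_j(x,\lambda)|$, $\Upsilon_{p'}(\lambda)=\sum_{j=1}^4\|\upsilon_j(\cdot,\lambda)\|_{L_{p'}[0,\pi]}$ and $$s_n(r)=\max_{|\lambda-\lambda_n^0|\le r}\big(\Upsilon(\pi,\lambda)+\Upsilon_{p'}(\lambda)\big).$$ **Theorem 4.3.** Let $L_{Q,U}$ be regular and $\alpha>0$. Then $\{\lambda_n^0\}_{n\in\mathbb Z}$ is the sequence of all eigenvalues of $L_{0,U'}$, repeated according to algebraic multiplicity, and there is a constant $M>0$ depending only on $R$, $\alpha$ and $U$ such that all eigenvalues of $L_{Q,U}$, repeated according to algebraic multiplicity, can be numbered as $\{\lambda_n\}_{n\in\mathbb Z}$ so that the following holds for every $\varepsilon>0$ for which the closed discs of radius $\varepsilon$ about distinct points $\lambda^0_n$ are disjoint and all these discs lie in the strip $|\mathrm{Im}\,\lambda|<\alpha$. First, $s_n(\varepsilon)\to0$ as $n\to\pm\infty$.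 Further: 1. If $L_{Q,U}$ is strongly regular, there are $c_1>0$ such that $|\Delta^0(\lambda)|>c_1|\lambda-\lambda_n^0|$ for all $n$ and $0<|\lambda-\lambda_n^0|<\varepsilon$, and for every such $c_1$ there is $N$ such that for all $|n|\ge N$ the equation $s_n(r)=c_1r/M$ has a smallest root $r_n$ in $[0,\varepsilon]$, and $$|\lambda_n-\lambda_n^0|\le r_n\le\frac{M}{c_1}\,s_n(\varepsilon).$$ 2. If $L_{Q,U}$ is regular but not strongly regular, there are $c_2>0$ such that $|\Delta^0(\lambda)|>c_2|\lambda-\lambda_n^0|^2$ for all $n$ and $0<|\lambda-\lambda_n^0|<\varepsilon$, and for every such $c_2$ there is $N$ such that for all $|n|\ge N$ the equation $s_n(r)=c_2r^2/M$ has a smallest root $r_n$ in $[0,\varepsilon]$, and $$|\lambda_n-\lambda_n^0|\le r_n,\qquad |\lambda_n-\lambda_n^0|^2\le r_n\le\sqrt{\frac{M}{c_2}\,s_n(\varepsilon)}.$$ -/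

import Mathlib

open Filter Topology MeasureTheory
open scoped ENNReal Real Matrix

namespace SummableDirac

/-- Lebesgue measure on the interval `[0, π]`. -/
noncomputable def muPi : Measure ℝ := volume.restrict (Set.Icc 0 π)

/-- The Hilbert space `L₂[0,π] ⊕ L₂[0,π]`. -/
abbrev H : Type := Lp (EuclideanSpace ℂ (Fin 2)) 2 muPi

/-- The matrix `B` of the differential expression `-B y' + Q y`. -/
def B : Matrix (Fin 2) (Fin 2) ℂ := !![0, 1; -1, 0]

/-- The boundary form `U(y) = A y(0) + C y(π)`, where `A` consists of the first two columns of the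
`2 × 4` coefficient matrix and `C` of the last two. -/
noncomputable def boundaryForm (U : Matrix (Fin 2) (Fin 4) ℂ) (y : ℝ → Fin 2 → ℂ) : Fin 2 → ℂ :=
  U.submatrix id ![0, 1] *ᵥ y 0 + U.submatrix id ![2, 3] *ᵥ y π

/-- `y` is absolutely continuous on `[0, π]` with derivative `d` (almost everywhere), that is,
`y ∈ W¹₁[0,π] = AC[0,π]`, `d ∈ L₁[0,π]` and `y(x) = y(0) + ∫₀ˣ d`. -/
def HasACDeriv (y d : ℝ → Fin 2 → ℂ) : Prop :=
  Integrable d muPi ∧ ∀ x ∈ Set.Icc 0 π, y x = y 0 + ∫ t in (0 : ℝ)..x, d t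

/-- `(f, g)` belongs to the graph of `L_{Q,U}`: `f` is the class of an absolutely continuous `y`
with `U(y) = 0`, and `g ∈ H` is the class of `-B y' + Q y`. -/
def InDiracGraph (Q : ℝ → Matrix (Fin 2) (Fin 2) ℂ) (U : Matrix (Fin 2) (Fin 4) ℂ)
    (f g : H) : Prop :=
  ∃ y d : ℝ → Fin 2 → ℂ, HasACDeriv y d ∧ boundaryForm U y = 0 ∧
    (∀ᵐ x ∂muPi, (f x).ofLp = y x) ∧
    ∀ᵐ x ∂muPi, (g x).ofLp = -(B *ᵥ d x) + Q x *ᵥ y x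

/-- The graph of `L_{Q,U}` as a linear subspace of `H × H`. -/
noncomputable def diracGraph (Q : ℝ → Matrix (Fin 2) (Fin 2) ℂ)
    (U : Matrix (Fin 2) (Fin 4) ℂ) : Submodule ℂ (H × H) where
  carrier := {w | InDiracGraph Q U w.1 w.2}
  zero_mem' := by
    refine ⟨0, 0, ⟨integrable_zero _ _ _, by simp⟩, by simp [boundaryForm], ?_, ?_⟩
    · filter_upwards [Lp.coeFn_zero (EuclideanSpace ℂ (Fin 2)) 2 muPi] with x hx
      simp only [Prod.fst_zero]
      rw [hx]
      simp
    · filter_upwards [Lp.coeFn_zero (EuclideanSpace ℂ (Fin 2)) 2 muPi] with x hx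
      simp only [Prod.snd_zero]
      rw [hx]
      simp
  add_mem' := by
    rintro ⟨f, g⟩ ⟨f', g'⟩ ⟨y, d, ⟨hd, hy⟩, hU, hf, hg⟩ ⟨y', d', ⟨hd', hy'⟩, hU', hf', hg'⟩
    have hi : ∀ {e : ℝ → Fin 2 → ℂ}, Integrable e muPi → ∀ x ∈ Set.Icc 0 π,
        IntervalIntegrable e volume 0 x := by
      intro e he x hx
      refine (intervalIntegrable_iff_integrableOn_Ioc_of_le hx.1).2 ?_
      exact IntegrableOn.mono_set he fun t ht => ⟨ht.1.le, ht.2.trans hx.2⟩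
    refine ⟨y + y', d + d', ⟨hd.add hd', ?_⟩, ?_, ?_, ?_⟩
    · intro x hx
      have := intervalIntegral.integral_add (hi hd x hx) (hi hd' x hx)
      simp only [Pi.add_apply, hy x hx, hy' x hx, this]
      abel
    · have h : boundaryForm U (y + y') = boundaryForm U y + boundaryForm U y' := by
        simp only [boundaryForm, Pi.add_apply, Matrix.mulVec_add]
        abel
      rw [h, hU, hU', add_zero]
    · filter_upwards [Lp.coeFn_add f f', hf, hf'] with x h h1 h2
      simp only [Prod.mk_add_mk, h, Pi.add_apply, WithLp.ofLp_add, h1, h2]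
    · filter_upwards [Lp.coeFn_add g g', hg, hg'] with x h h1 h2
      simp only [Prod.mk_add_mk, h, Pi.add_apply, WithLp.ofLp_add, h1, h2, Matrix.mulVec_add]
      abel
  smul_mem' := by
    rintro c ⟨f, g⟩ ⟨y, d, ⟨hd, hy⟩, hU, hf, hg⟩
    refine ⟨c • y, c • d, ⟨hd.smul c, ?_⟩, ?_, ?_, ?_⟩
    · intro x hx
      have := intervalIntegral.integral_smul (μ := volume) (a := 0) (b := x) c d
      simp only [Pi.smul_apply, hy x hx, smul_add, this]
    · have h : boundaryForm U (c • y) = c • boundaryForm U y := by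
        simp only [boundaryForm, Pi.smul_apply, Matrix.mulVec_smul, smul_add]
      rw [h, hU, smul_zero]
    · filter_upwards [Lp.coeFn_smul c f, hf] with x h h1
      simp only [Prod.smul_mk, h, Pi.smul_apply, WithLp.ofLp_smul, h1]
    · filter_upwards [Lp.coeFn_smul c g, hg] with x h h1
      simp only [Prod.smul_mk, h, Pi.smul_apply, WithLp.ofLp_smul, h1, Matrix.mulVec_smul,
        smul_add, smul_neg]

/-- The graph is single-valued, so that it is the graph of an operator. -/
theorem diracGraph_functional (Q : ℝ → Matrix (Fin 2) (Fin 2) ℂ) (U : Matrix (Fin 2) (Fin 4) ℂ)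
    (w : H × H) (hw : w ∈ diracGraph Q U) (h0 : w.1 = 0) : w.2 = 0 := by
  obtain ⟨f, g⟩ := w
  obtain ⟨y, d, ⟨hd, hy⟩, -, hf, hg⟩ := hw
  simp only at h0 hf hg ⊢
  subst h0
  have hpi : (0 : ℝ) ≤ π := Real.pi_pos.le
  have hcont : ContinuousOn y (Set.Icc 0 π) := by
    have h := intervalIntegral.continuousOn_primitive_interval (f := d) (μ := volume)
      (a := 0) (b := π) (by rw [Set.uIcc_of_le hpi]; exact hd)
    rw [Set.uIcc_of_le hpi] at h
    exact (continuousOn_const.add h).congr hy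
  have hy0 : ∀ᵐ x ∂muPi, y x = 0 := by
    filter_upwards [hf, Lp.coeFn_zero (EuclideanSpace ℂ (Fin 2)) 2 muPi] with x h1 h2
    rw [← h1, h2]
    simp
  have hyz : Set.EqOn y (fun _ => 0) (Set.Icc 0 π) :=
    Measure.eqOn_Icc_of_ae_eq (μ := volume) Real.pi_pos.ne hy0 hcont continuousOn_const
  have hdi : IntervalIntegrable d volume 0 π :=
    (intervalIntegrable_iff_integrableOn_Icc_of_le hpi).2 hd
  have hd0 : ∀ᵐ x ∂muPi, d x = 0 := by
    have hne : ∀ᵐ x : ℝ, x ≠ 0 ∧ x ≠ π := by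
      have h1 : ∀ᵐ x : ℝ, x ≠ 0 := Measure.ae_ne volume 0
      have h2 : ∀ᵐ x : ℝ, x ≠ π := Measure.ae_ne volume π
      filter_upwards [h1, h2] with x hx hx' using ⟨hx, hx'⟩
    refine (ae_restrict_iff' measurableSet_Icc).2 ?_
    filter_upwards [hdi.ae_hasDerivAt_integral, hne] with x hx hxne hxm
    have h1 := hx (by rwa [Set.uIcc_of_le hpi]) 0 (by simp [hpi])
    have h2 : (fun t => ∫ s in (0 : ℝ)..t, d s) =ᶠ[𝓝 x] fun _ => 0 := by
      have hm : Set.Icc 0 π ∈ 𝓝 x :=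
        Icc_mem_nhds (lt_of_le_of_ne hxm.1 (Ne.symm hxne.1)) (lt_of_le_of_ne hxm.2 hxne.2)
      filter_upwards [hm] with t ht
      have h3 := hy t ht
      rw [hyz ht, hyz (Set.left_mem_Icc.2 hpi)] at h3
      simpa using h3.symm
    exact h1.unique ((hasDerivAt_const x (0 : Fin 2 → ℂ)).congr_of_eventuallyEq h2)
  rw [Lp.eq_zero_iff_ae_eq_zero]
  filter_upwards [hg, hd0, hy0] with x h1 h2 h3
  rw [h2, h3, Matrix.mulVec_zero, Matrix.mulVec_zero, neg_zero, add_zero] at h1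
  exact (WithLp.ofLp_eq_zero 2).1 h1

/-- The Dirac operator `L_{Q,U}` as an unbounded operator in `H`; its domain is the set of all
`y ∈ AC[0,π]` with `-B y' + Q y ∈ H` and `U(y) = 0`. -/
noncomputable def diracOperator (Q : ℝ → Matrix (Fin 2) (Fin 2) ℂ)
    (U : Matrix (Fin 2) (Fin 4) ℂ) : H →ₗ.[ℂ] H :=
  (diracGraph Q U).toLinearPMap

/-- The operator does have the prescribed graph. -/
theorem mem_graph_diracOperator (Q : ℝ → Matrix (Fin 2) (Fin 2) ℂ)
    (U : Matrix (Fin 2) (Fin 4) ℂ) (f g : H) :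
    (f, g) ∈ (diracOperator Q U).graph ↔ InDiracGraph Q U f g := by
  rw [diracOperator, Submodule.toLinearPMap_graph_eq _ (diracGraph_functional Q U)]
  rfl

/-- `ker (L - μ)^k` for an unbounded operator `L`: it is zero for `k = 0`, and `f` lies in
`ker (L - μ)^(k+1)` if `f ∈ D(L)` and `L f - μ f ∈ ker (L - μ)^k`. -/
noncomputable def kerPow {V : Type*} [AddCommGroup V] [Module ℂ V] (L : V →ₗ.[ℂ] V) (μ : ℂ) :
    ℕ → Submodule ℂ V
  | 0 => ⊥
  | k + 1 => ((kerPow L μ k).comap (L.toFun - μ • L.domain.subtype)).map L.domain.subtype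

/-- The root subspace of `L` at `μ`, the span of all eigenvectors and associated vectors; its
dimension is the algebraic multiplicity of `μ`. -/
noncomputable def rootSubspace {V : Type*} [AddCommGroup V] [Module ℂ V] (L : V →ₗ.[ℂ] V)
    (μ : ℂ) : Submodule ℂ V :=
  ⨆ k, kerPow L μ k

/-- The sequence `ev`, indexed by `ℤ`, lists all eigenvalues of `L`, each of them as many times as
its (finite) algebraic multiplicity, and nothing else. -/
def IsEigenvalueNumbering {V : Type*} [AddCommGroup V] [Module ℂ V] (L : V →ₗ.[ℂ] V)
    (ev : ℤ → ℂ) : Prop :=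
  ∀ μ : ℂ, {n : ℤ | ev n = μ}.Finite ∧ FiniteDimensional ℂ (rootSubspace L μ) ∧
    Module.finrank ℂ (rootSubspace L μ) = {n : ℤ | ev n = μ}.ncard

/-- The determinant formed by two columns of the `2 × 4` boundary matrix. Columns are counted from
zero here, so that the classical `J₁₄` is `J U 0 3`. -/
def J (U : Matrix (Fin 2) (Fin 4) ℂ) (a b : Fin 4) : ℂ :=
  U 0 a * U 1 b - U 0 b * U 1 a

/-- Regular boundary conditions: `J₁₄ + J₃₂ ± i (J₄₂ - J₁₃) ≠ 0`. -/
def Regular (U : Matrix (Fin 2) (Fin 4) ℂ) : Prop :=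
  J U 0 3 + J U 2 1 + Complex.I * (J U 3 1 - J U 0 2) ≠ 0 ∧
    J U 0 3 + J U 2 1 - Complex.I * (J U 3 1 - J U 0 2) ≠ 0

/-- The coefficient `J₁₄ - J₂₃ - i (J₁₃ + J₂₄)` of `z²` in the quadratic equation of `L_{0,V}`. -/
noncomputable def coefPlus (V : Matrix (Fin 2) (Fin 4) ℂ) : ℂ :=
  J V 0 3 - J V 1 2 - Complex.I * (J V 0 2 + J V 1 3)

/-- `J₁₂ + J₃₄`, half of the coefficient of `z` in the quadratic equation of `L_{0,V}`. -/
def coefMid (V : Matrix (Fin 2) (Fin 4) ℂ) : ℂ :=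
  J V 0 1 + J V 2 3

/-- The constant term `J₁₄ - J₂₃ + i (J₁₃ + J₂₄)` of the quadratic equation of `L_{0,V}`. -/
noncomputable def coefMinus (V : Matrix (Fin 2) (Fin 4) ℂ) : ℂ :=
  J V 0 3 - J V 1 2 + Complex.I * (J V 0 2 + J V 1 3)

/-- The characteristic determinant of the free operator `L_{0,V}`. -/
noncomputable def freeDet (V : Matrix (Fin 2) (Fin 4) ℂ) (z : ℂ) : ℂ :=
  coefPlus V / 2 * Complex.exp (Complex.I * π * z) + coefMid V
    + coefMinus V / 2 * Complex.exp (-(Complex.I * π * z))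

/-- The discriminant of the quadratic equation of `L_{0,V}`. -/
noncomputable def freeDiscr (V : Matrix (Fin 2) (Fin 4) ℂ) : ℂ :=
  (2 * coefMid V) ^ 2 - 4 * coefPlus V * coefMinus V

/-- The number `E = E(π) = exp (½ ∫₀^π (q₂ - q₃))`. -/
noncomputable def E (Q : ℝ → Matrix (Fin 2) (Fin 2) ℂ) : ℂ :=
  Complex.exp (1 / 2 * ∫ t in (0 : ℝ)..π, (Q t 0 1 - Q t 1 0))

/-- The boundary matrix `U'` of the associated free operator: the last two columns of `U` are
multiplied by `E`. -/
noncomputable def assocBC (Q : ℝ → Matrix (Fin 2) (Fin 2) ℂ)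
    (U : Matrix (Fin 2) (Fin 4) ℂ) : Matrix (Fin 2) (Fin 4) ℂ :=
  Matrix.of fun i j => U i j * ![1, 1, E Q, E Q] j

/-- `L_{Q,U}` is strongly regular: it is regular, and the quadratic equation of the associated free
operator has two distinct roots. -/
def StronglyRegular (Q : ℝ → Matrix (Fin 2) (Fin 2) ℂ) (U : Matrix (Fin 2) (Fin 4) ℂ) : Prop :=
  Regular U ∧ freeDiscr (assocBC Q U) ≠ 0

/-- `κ₀ = -(i/π) ln z₀` and `κ₁ = 1 - (i/π) ln z₁`, with some branches `w₀`, `w₁` of the logarithms,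
where `z₀`, `z₁` are the roots, with multiplicity, of the quadratic equation of `L_{0,V}`. -/
def IsFreeExponents (V : Matrix (Fin 2) (Fin 4) ℂ) (κ₀ κ₁ : ℂ) : Prop :=
  ∃ w₀ w₁ : ℂ, κ₀ = -(Complex.I / π) * w₀ ∧ κ₁ = 1 - Complex.I / π * w₁ ∧
    ∀ z : ℂ, coefPlus V * z ^ 2 + 2 * coefMid V * z + coefMinus V =
      coefPlus V * (z - Complex.exp w₀) * (z - Complex.exp w₁)

/-- The eigenvalues `λ⁰ₙ = κ₀ + n` (`n` even), `λ⁰ₙ = κ₁ + n` (`n` odd) of the free operator. -/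
noncomputable def freeEigenvalue (κ₀ κ₁ : ℂ) (n : ℤ) : ℂ :=
  if Even n then κ₀ + n else κ₁ + n

/-- The functions `υ₁, υ₂, υ₃, υ₄` (numbered from zero). -/
noncomputable def upsilon (Q : ℝ → Matrix (Fin 2) (Fin 2) ℂ) (j : Fin 4) (x : ℝ) (z : ℂ) : ℂ :=
  ![∫ t in (0 : ℝ)..x, Q t 0 0 * Complex.sin (2 * z * t),
    ∫ t in (0 : ℝ)..x, Q t 0 0 * Complex.cos (2 * z * t),
    1 / 2 * ∫ t in (0 : ℝ)..x, (Q t 0 1 + Q t 1 0) * Complex.sin (2 * z * t),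
    1 / 2 * ∫ t in (0 : ℝ)..x, (Q t 0 1 + Q t 1 0) * Complex.cos (2 * z * t)] j

/-- `Υ(x, z) = ∑ⱼ |υⱼ(x, z)|`. -/
noncomputable def UpsilonAt (Q : ℝ → Matrix (Fin 2) (Fin 2) ℂ) (x : ℝ) (z : ℂ) : ℝ :=
  ∑ j : Fin 4, ‖upsilon Q j x z‖

/-- `Υ_ν(z) = ∑ⱼ ‖υⱼ(·, z)‖` with the norms of `L_ν[0,π]`. -/
noncomputable def UpsilonNorm (Q : ℝ → Matrix (Fin 2) (Fin 2) ℂ) (ν : ℝ≥0∞) (z : ℂ) : ℝ :=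
  ∑ j : Fin 4, (eLpNorm (fun x => upsilon Q j x z) ν muPi).toReal

/-- The maximum `s(r)` of `Υ(π, z) + Υ_ν(z)` over the closed disc of radius `r` centred at `z₀`. -/
noncomputable def discMax (Q : ℝ → Matrix (Fin 2) (Fin 2) ℂ) (ν : ℝ≥0∞) (z₀ : ℂ) (r : ℝ) : ℝ :=
  sSup ((fun z => UpsilonAt Q π z + UpsilonNorm Q ν z) '' Metric.closedBall z₀ r)

/-- The assumptions on the potential: its entries are summable on `[0,π]` with `‖Q‖_{L₁} ≤ R`,
the functions `q₁` and `q₂ + q₃` lie in the ball of radius `R` of `L_p[0,π]`, and `q₄ = -q₁`. -/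
structure Admissible (p : ℝ≥0∞) (R : ℝ) (Q : ℝ → Matrix (Fin 2) (Fin 2) ℂ) : Prop where
  integrable : ∀ i j, Integrable (fun x => Q x i j) muPi
  norm_le : ∑ i, ∑ j, ∫ x, ‖Q x i j‖ ∂muPi ≤ R
  diag_le : eLpNorm (fun x => Q x 0 0) p muPi ≤ ENNReal.ofReal R
  offdiag_le : eLpNorm (fun x => Q x 0 1 + Q x 1 0) p muPi ≤ ENNReal.ofReal R
  trace_zero : ∀ᵐ x ∂muPi, Q x 1 1 = -Q x 0 0

/-- `|Δ⁰(z)| > c |z - z₀|^m` in the punctured disc `0 < |z - z₀| < ε` for every centre `z₀ = ev n`,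
where `Δ⁰` is the characteristic determinant of `L_{0,V}`. -/
def DetLowerBound (V : Matrix (Fin 2) (Fin 4) ℂ) (ev : ℤ → ℂ) (ε : ℝ) (m : ℕ) (c : ℝ) : Prop :=
  ∀ n : ℤ, ∀ z : ℂ, 0 < ‖z - ev n‖ → ‖z - ev n‖ < ε → c * ‖z - ev n‖ ^ m < ‖freeDet V z‖

end SummableDirac

open SummableDirac

/-! Everything is read off two entire functions: the characteristic determinant Δ of `L_{Q,U}`
(`charDet`) and the free determinant Δ⁰ of `L_{0,U'}` (`freeDet`). The eigenvalues, with algebraic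
multiplicities, are the zeros of Δ with their orders, and the theorem says how far these zeros lie
from those of Δ⁰.

Multiplicities (`rank_rootSubspace`). Let Y(μ) be the fundamental system and T the operator solving
(ℓ - μ)y = f with y(0) = 0. Then Y(μ + w) = ∑ wⁿ Tⁿ Y(μ), and root vectors at μ are finite sums ∑ Tⁿ
Y(μ)aₙ all of whose shifts satisfy the boundary conditions. These conditions say that the matrix of
Taylor series of U(Y) at μ annihilates the sequence (aₙ) when the variable acts as the backward
shift. The kernel of this action has dimension equal to the order of the determinant
(`rank_ker_matAct`), by column reduction.

Closeness of the determinants (`Admissible.norm_charDet_sub_le`, `norm_charDet_sub_le_of_large_im`).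
Diagonalizing B and removing the diagonal by a gauge factor turns the system into ξ' = a e^{-2izx}
η, η' = b e^{2izx} ξ, where a and b are combinations of q₁ and q₂ + q₃. The factor E that the gauge
produces at π is what changes U into U'. The primitives of the oscillating coefficients are
combinations of the υⱼ. One integration by parts, Grönwall's inequality, and Hölder's inequality
between L_p and L_{p'} give |Δ - Δ⁰| ≤ M (Υ(π, ·) + Υ_{p'}) in a strip. For large |Im z| the
difference is small compared with exp(π |Im z|).

The free determinant is 2-periodic and, up to a nonvanishing factor, a product of two functions
e^{iπz} - e^{iπκ}. Periodicity and compactness yield the lower bounds for |Δ⁰| near and away from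
its zeros.

Rouché's theorem is applied three times. On a large circle and on circles of a fixed radius δ about
the λ⁰ₙ it provides the numbering (`exists_equiv_zeroIndex`). On the circle of radius rₙ it gives
the localization, because there |Δ - Δ⁰| ≤ M sₙ(rₙ) = c rₙ^m < |Δ⁰|. If rₙ = 0, then Υ_{p'} vanishes
at λ⁰ₙ, which forces q₁ = q₂ + q₃ = 0 almost everywhere, so that Δ = Δ⁰. -/

namespace SummableDirac

/-! ### Calculus of absolutely continuous functions on [0, π]. -/

section Prim

set_option linter.unusedSectionVars false

variable {E F : Type*} [NormedAddCommGroup E] [NormedSpace ℝ E]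
  [NormedAddCommGroup F] [NormedSpace ℝ F]

/-- `f` is absolutely continuous on `[0, π]` with derivative `d`. -/
structure IsPrim (f d : ℝ → E) : Prop where
  integrable : Integrable d muPi
  eq : ∀ x ∈ Set.Icc 0 π, f x = f 0 + ∫ t in (0 : ℝ)..x, d t

theorem intervalIntegrable_of_muPi {d : ℝ → E} (hd : Integrable d muPi) {x y : ℝ}
    (hx : x ∈ Set.Icc 0 π) (hy : y ∈ Set.Icc 0 π) : IntervalIntegrable d volume x y := by
  rw [intervalIntegrable_iff]
  refine IntegrableOn.mono_set hd ?_
  intro t ht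
  have h := Set.uIoc_subset_uIcc ht
  exact (Set.uIcc_subset_Icc hx hy) h

theorem zero_mem_Icc_pi : (0 : ℝ) ∈ Set.Icc 0 π := ⟨le_rfl, Real.pi_pos.le⟩

theorem pi_mem_Icc_pi : π ∈ Set.Icc 0 π := ⟨Real.pi_pos.le, le_rfl⟩

theorem ae_muPi_iff {P : ℝ → Prop} : (∀ᵐ x ∂muPi, P x) ↔ ∀ᵐ x, x ∈ Set.Icc 0 π → P x :=
  ae_restrict_iff' measurableSet_Icc

theorem integral_muPi (f : ℝ → E) : ∫ x, f x ∂muPi = ∫ x in (0 : ℝ)..π, f x := by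
  rw [intervalIntegral.integral_of_le Real.pi_pos.le, muPi, integral_Icc_eq_integral_Ioc]

/-- Almost everywhere equal functions have the same primitive. -/
theorem integral_congr_muPi {f g : ℝ → E} (h : ∀ᵐ x ∂muPi, f x = g x) {x : ℝ}
    (hx : x ∈ Set.Icc 0 π) : ∫ t in (0 : ℝ)..x, f t = ∫ t in (0 : ℝ)..x, g t := by
  refine intervalIntegral.integral_congr_ae ?_
  filter_upwards [ae_muPi_iff.1 h] with t ht htx
  rw [Set.uIoc_of_le hx.1] at htx
  exact ht ⟨htx.1.le, htx.2.trans hx.2⟩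

theorem norm_integral_le_muPi {f : ℝ → E} {g : ℝ → ℝ} (hg : Integrable g muPi)
    (h : ∀ᵐ x ∂muPi, ‖f x‖ ≤ g x) {x : ℝ} (hx : x ∈ Set.Icc 0 π) :
    ‖∫ t in (0 : ℝ)..x, f t‖ ≤ ∫ t in (0 : ℝ)..x, g t := by
  refine intervalIntegral.norm_integral_le_of_norm_le hx.1 ?_
    (intervalIntegrable_of_muPi hg zero_mem_Icc_pi hx)
  filter_upwards [ae_muPi_iff.1 h] with t ht htx
  exact ht ⟨htx.1.le, htx.2.trans hx.2⟩

theorem integral_le_muPi {g : ℝ → ℝ} (hg : Integrable g muPi) (h : ∀ᵐ x ∂muPi, 0 ≤ g x) {x : ℝ}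
    (hx : x ∈ Set.Icc 0 π) : ∫ t in (0 : ℝ)..x, g t ≤ ∫ t, g t ∂muPi := by
  rw [intervalIntegral.integral_of_le hx.1]
  refine integral_mono_measure ?_ h hg
  have hs : Set.Ioc 0 x ⊆ Set.Icc 0 π := fun t ht => ⟨ht.1.le, ht.2.trans hx.2⟩
  exact Measure.restrict_mono hs le_rfl

theorem isPrim_integral {d : ℝ → E} (hd : Integrable d muPi) (c : E) :
    IsPrim (fun x => c + ∫ t in (0 : ℝ)..x, d t) d :=
  ⟨hd, fun x _ => by simp⟩

theorem IsPrim.continuousOn {f d : ℝ → E} (h : IsPrim f d) : ContinuousOn f (Set.Icc 0 π) := by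
  have h1 := intervalIntegral.continuousOn_primitive_interval (f := d) (μ := volume)
    (a := 0) (b := π) (by rw [Set.uIcc_of_le Real.pi_pos.le]; exact h.integrable)
  rw [Set.uIcc_of_le Real.pi_pos.le] at h1
  exact (continuousOn_const.add h1).congr h.eq

theorem IsPrim.sub_eq {f d : ℝ → E} (h : IsPrim f d) {x y : ℝ} (hx : x ∈ Set.Icc 0 π)
    (hy : y ∈ Set.Icc 0 π) : f y - f x = ∫ t in x..y, d t := by
  rw [h.eq x hx, h.eq y hy, add_sub_add_left_eq_sub]
  exact intervalIntegral.integral_interval_sub_left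
    (intervalIntegrable_of_muPi h.integrable zero_mem_Icc_pi hy)
    (intervalIntegrable_of_muPi h.integrable zero_mem_Icc_pi hx)

/-- The sum of increments of `f` is squeezed between 0 and `C` times that of `g`. It serves twice:
with `g` the primitive of `‖d‖` for a primitive of `d`, and with `f` a Lipschitz image of `g` in the
chain rule. -/
theorem _root_.AbsolutelyContinuousOnInterval.of_dist_le {X Y : Type*} [PseudoMetricSpace X]
    [PseudoMetricSpace Y] {g : ℝ → X} {f : ℝ → Y} {a b C : ℝ}
    (hg : AbsolutelyContinuousOnInterval g a b)
    (h : ∀ x ∈ Set.uIcc a b, ∀ y ∈ Set.uIcc a b, dist (f x) (f y) ≤ C * dist (g x) (g y)) :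
    AbsolutelyContinuousOnInterval f a b := by
  unfold AbsolutelyContinuousOnInterval at hg ⊢
  refine squeeze_zero' (Eventually.of_forall fun _ => Finset.sum_nonneg fun _ _ => dist_nonneg) ?_
    (by simpa using hg.const_mul C)
  rw [eventually_inf_principal]
  filter_upwards with ⟨n, I⟩ hI
  rw [Finset.mul_sum]
  exact Finset.sum_le_sum fun i hi => h _ (hI.1 i hi).1 _ (hI.1 i hi).2

theorem IsPrim.absolutelyContinuous {f d : ℝ → E} (h : IsPrim f d) :
    AbsolutelyContinuousOnInterval f 0 π := by
  have h1 := (intervalIntegrable_of_muPi h.integrable.norm zero_mem_Icc_pi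
    pi_mem_Icc_pi).absolutelyContinuousOnInterval_intervalIntegral (c := 0) (by simp)
  refine h1.of_dist_le (C := 1) fun x hx y hy => ?_
  rw [Set.uIcc_of_le Real.pi_pos.le] at hx hy
  have h2 := (isPrim_integral h.integrable.norm 0).sub_eq hy hx
  simp only [zero_add] at h2
  rw [one_mul, dist_eq_norm, dist_eq_norm, h.sub_eq hy hx, h2]
  exact intervalIntegral.norm_integral_le_abs_integral_norm

theorem ae_mem_Ioo : ∀ᵐ x ∂muPi, x ∈ Set.Ioo 0 π := by
  rw [ae_muPi_iff]
  filter_upwards [Measure.ae_ne volume (0 : ℝ), Measure.ae_ne volume π] with x hx hx' hm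
  exact ⟨lt_of_le_of_ne hm.1 (Ne.symm hx), lt_of_le_of_ne hm.2 hx'⟩

theorem IsPrim.ae_hasDerivAt [CompleteSpace E] {f d : ℝ → E} (h : IsPrim f d) :
    ∀ᵐ x ∂muPi, HasDerivAt f (d x) x := by
  have hdi := intervalIntegrable_of_muPi h.integrable zero_mem_Icc_pi pi_mem_Icc_pi
  have h1 := ae_muPi_iff.2 (hdi.ae_hasDerivAt_integral.mono fun x hx hm =>
    hx (by rwa [Set.uIcc_of_le Real.pi_pos.le]) 0 (by simp))
  filter_upwards [h1, ae_mem_Ioo] with x hx hxm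
  refine (hx.const_add (f 0)).congr_of_eventuallyEq ?_
  filter_upwards [Icc_mem_nhds hxm.1 hxm.2] with t ht using h.eq t ht

/-- The difference of `f` and the primitive of `d` is absolutely continuous with derivative zero
almost everywhere, hence constant. -/
theorem isPrim_of_ae_hasDerivAt [CompleteSpace E] {f d : ℝ → E} (hd : Integrable d muPi)
    (hf : AbsolutelyContinuousOnInterval f 0 π) (h : ∀ᵐ x ∂muPi, HasDerivAt f (d x) x) :
    IsPrim f d := by
  have hp := isPrim_integral hd 0
  obtain ⟨C, hC⟩ := (hf.fun_sub hp.absolutelyContinuous).const_of_ae_hasDerivAt_zero (by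
    rw [Set.uIcc_of_le Real.pi_pos.le, ← ae_muPi_iff]
    filter_upwards [h, hp.ae_hasDerivAt] with x h1 h2
    simpa using h1.fun_sub h2)
  rw [Set.uIcc_of_le Real.pi_pos.le] at hC
  refine ⟨hd, fun x hx => ?_⟩
  have h1 := hC x hx
  have h2 := hC 0 zero_mem_Icc_pi
  simp only [zero_add, intervalIntegral.integral_same, sub_zero] at h1 h2
  rw [h2, ← h1]
  abel

/-- The chain rule for absolutely continuous functions. -/
theorem IsPrim.comp [FiniteDimensional ℝ E] [CompleteSpace F] {f d : ℝ → E}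
    (h : IsPrim f d) {G : E → F} (hG : ContDiff ℝ 1 G) :
    IsPrim (fun x => G (f x)) (fun x => fderiv ℝ G (f x) (d x)) := by
  have : CompleteSpace E := FiniteDimensional.complete ℝ E
  have : ProperSpace E := FiniteDimensional.proper_real E
  -- The range of `f` is compact, so `G` need only be Lipschitz on a ball containing it. This makes
  -- `G ∘ f` absolutely continuous, and the derivative is then computed almost everywhere.
  obtain ⟨r, hr⟩ := (isCompact_Icc.image_of_continuousOn h.continuousOn).isBounded.subset_closedBall 0
  obtain ⟨K, hK⟩ := (hG.contDiffOn (s := Metric.closedBall 0 r)).exists_lipschitzOnWith one_ne_zero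
    (convex_closedBall _ _) (isCompact_closedBall _ _)
  have hmem : ∀ x ∈ Set.Icc 0 π, f x ∈ Metric.closedBall 0 r := fun x hx => hr ⟨x, hx, rfl⟩
  have hcf : Continuous (fderiv ℝ G) := hG.continuous_fderiv one_ne_zero
  have hcd : ContinuousOn (fun x => fderiv ℝ G (f x)) (Set.Icc 0 π) :=
    hcf.comp_continuousOn h.continuousOn
  obtain ⟨C, hC⟩ := (isCompact_Icc.image_of_continuousOn hcd).isBounded.exists_norm_le
  refine isPrim_of_ae_hasDerivAt ?_ ?_ ?_
  · refine (h.integrable.norm.const_mul C).mono' ?_ ?_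
    · exact (ContinuousLinearMap.id ℝ (E →L[ℝ] F)).aestronglyMeasurable_comp₂ (ContinuousOn.aestronglyMeasurable_of_isCompact hcd
        isCompact_Icc measurableSet_Icc) h.integrable.aestronglyMeasurable
    · filter_upwards [ae_mem_Ioo] with x hx
      refine (ContinuousLinearMap.le_opNorm _ _).trans ?_
      gcongr
      exact hC _ ⟨x, Set.Ioo_subset_Icc_self hx, rfl⟩
  · refine h.absolutelyContinuous.of_dist_le (C := K) fun x hx y hy => ?_
    rw [Set.uIcc_of_le Real.pi_pos.le] at hx hy
    exact hK.dist_le_mul _ (hmem x hx) _ (hmem y hy)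
  · filter_upwards [h.ae_hasDerivAt] with x hx
    exact ((hG.differentiable one_ne_zero _).hasFDerivAt).comp_hasDerivAt x hx

theorem IsPrim.congr {f d g e : ℝ → E} (h : IsPrim f d) (hfg : ∀ x ∈ Set.Icc 0 π, g x = f x)
    (hde : ∀ᵐ x ∂muPi, d x = e x) : IsPrim g e := by
  refine ⟨h.integrable.congr hde, fun x hx => ?_⟩
  rw [hfg x hx, hfg 0 zero_mem_Icc_pi, ← integral_congr_muPi hde hx, h.eq x hx]

theorem IsPrim.prodMk {f d : ℝ → E} {g e : ℝ → F} [CompleteSpace E] [CompleteSpace F]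
    (hf : IsPrim f d) (hg : IsPrim g e) : IsPrim (fun x => (f x, g x)) (fun x => (d x, e x)) := by
  refine ⟨hf.integrable.prodMk hg.integrable, fun x hx => ?_⟩
  have h1 := intervalIntegrable_of_muPi hf.integrable zero_mem_Icc_pi hx
  have h2 := intervalIntegrable_of_muPi hg.integrable zero_mem_Icc_pi hx
  rw [intervalIntegral.integral_of_le hx.1, integral_pair h1.1 h2.1,
    ← intervalIntegral.integral_of_le hx.1, ← intervalIntegral.integral_of_le hx.1, Prod.mk_add_mk,
    ← hf.eq x hx, ← hg.eq x hx]

theorem IsPrim.add {f d g e : ℝ → E} (hf : IsPrim f d) (hg : IsPrim g e) :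
    IsPrim (fun x => f x + g x) (fun x => d x + e x) := by
  refine ⟨hf.integrable.add hg.integrable, fun x hx => ?_⟩
  rw [hf.eq x hx, hg.eq x hx, intervalIntegral.integral_add
    (intervalIntegrable_of_muPi hf.integrable zero_mem_Icc_pi hx)
    (intervalIntegrable_of_muPi hg.integrable zero_mem_Icc_pi hx)]
  abel

theorem IsPrim.const_mul {f d : ℝ → ℂ} (hf : IsPrim f d) (c : ℂ) :
    IsPrim (fun x => c * f x) (fun x => c * d x) := by
  refine ⟨hf.integrable.const_mul c, fun x hx => ?_⟩
  rw [hf.eq x hx, intervalIntegral.integral_const_mul, mul_add]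

/-- The chain rule for multiplication on the pair `(f, g)`. This is the form in which integration by
parts is used. -/
theorem IsPrim.mul {f d g e : ℝ → ℂ} (hf : IsPrim f d) (hg : IsPrim g e) :
    IsPrim (fun x => f x * g x) (fun x => d x * g x + f x * e x) := by
  have h := (hf.prodMk hg).comp (G := fun p : ℂ × ℂ => p.1 * p.2) (by fun_prop)
  refine h.congr (fun _ _ => rfl) (Eventually.of_forall fun x => ?_)
  have h2 : HasFDerivAt (fun p : ℂ × ℂ => p.1 * p.2) _ (f x, g x) :=
    (hasFDerivAt_fst (𝕜 := ℝ) (p := (f x, g x))).mul' (hasFDerivAt_snd (𝕜 := ℝ) (p := (f x, g x)))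
  rw [h2.fderiv]
  simp
  ring

theorem IsPrim.cexp {f d : ℝ → ℂ} (hf : IsPrim f d) :
    IsPrim (fun x => Complex.exp (f x)) (fun x => Complex.exp (f x) * d x) := by
  have h := hf.comp (G := Complex.exp) Complex.contDiff_exp
  refine h.congr (fun _ _ => rfl) (Eventually.of_forall fun x => ?_)
  rw [((Complex.hasDerivAt_exp (f x)).hasFDerivAt.restrictScalars ℝ).fderiv]
  simp [mul_comm]

theorem isPrim_cexp_mul (c : ℂ) :
    IsPrim (fun x : ℝ => Complex.exp (c * x)) (fun x => c * Complex.exp (c * x)) := by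
  have h : IsPrim (fun x : ℝ => c * (x : ℂ)) (fun _ => c) := by
    refine ⟨?_, fun x _ => by simp [mul_comm]⟩
    have : IsFiniteMeasure muPi := by unfold muPi; infer_instance
    exact integrable_const c
  refine h.cexp.congr (fun _ _ => rfl) (Eventually.of_forall fun x => mul_comm _ _)

theorem IsPrim.mul_real {f d g e : ℝ → ℝ} (hf : IsPrim f d) (hg : IsPrim g e) :
    IsPrim (fun x => f x * g x) (fun x => d x * g x + f x * e x) := by
  have h := (hf.prodMk hg).comp (G := fun p : ℝ × ℝ => p.1 * p.2) (by fun_prop)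
  refine h.congr (fun _ _ => rfl) (Eventually.of_forall fun x => ?_)
  have h2 : HasFDerivAt (fun p : ℝ × ℝ => p.1 * p.2) _ (f x, g x) :=
    (hasFDerivAt_fst (𝕜 := ℝ) (p := (f x, g x))).mul' (hasFDerivAt_snd (𝕜 := ℝ) (p := (f x, g x)))
  rw [h2.fderiv]
  simp
  ring

theorem IsPrim.exp_real {f d : ℝ → ℝ} (hf : IsPrim f d) :
    IsPrim (fun x => Real.exp (f x)) (fun x => Real.exp (f x) * d x) := by
  have h := hf.comp (G := Real.exp) Real.contDiff_exp
  refine h.congr (fun _ _ => rfl) (Eventually.of_forall fun x => ?_)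
  rw [(Real.hasDerivAt_exp (f x)).hasFDerivAt.fderiv]
  simp [mul_comm]

theorem integrable_mul_of_continuousOn {f d : ℝ → ℂ} (hd : Integrable d muPi)
    (hf : ContinuousOn f (Set.Icc 0 π)) : Integrable (fun x => d x * f x) muPi :=
  IntegrableOn.mul_continuousOn (by exact hd) hf isCompact_Icc

theorem integrable_mul_of_continuousOn_real {f d : ℝ → ℝ} (hd : Integrable d muPi)
    (hf : ContinuousOn f (Set.Icc 0 π)) : Integrable (fun x => d x * f x) muPi :=
  IntegrableOn.mul_continuousOn (by exact hd) hf isCompact_Icc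

/-- Grönwall's inequality with a summable coefficient. -/
theorem gronwall_of_integrable {f k : ℝ → ℝ} {C : ℝ} (hk : Integrable k muPi)
    (hk0 : ∀ᵐ x ∂muPi, 0 ≤ k x) (hf : ContinuousOn f (Set.Icc 0 π))
    (h : ∀ x ∈ Set.Icc 0 π, f x ≤ C + ∫ t in (0 : ℝ)..x, k t * f t) :
    ∀ x ∈ Set.Icc 0 π, f x ≤ C * Real.exp (∫ t in (0 : ℝ)..x, k t) := by
  intro x hx
  -- With F(x) = C + ∫₀ˣ k f, the function F exp(-∫k) has derivative k (f - F) exp(-∫k) ≤ 0, so it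
  -- stays below its initial value C.
  have hF := isPrim_integral (integrable_mul_of_continuousOn_real hk hf) C
  have hK := isPrim_integral hk.neg 0
  have hH := hF.mul_real hK.exp_real
  have h1 := hH.eq x hx
  have h2 : ∫ t in (0 : ℝ)..x, (k t * f t * Real.exp (0 + ∫ s in (0 : ℝ)..t, (-k) s) +
      (C + ∫ s in (0 : ℝ)..t, k s * f s) * (Real.exp (0 + ∫ s in (0 : ℝ)..t, (-k) s) * (-k) t))
      ≤ 0 := by
    rw [← neg_nonneg, ← intervalIntegral.integral_neg]
    refine intervalIntegral.integral_nonneg_of_ae_restrict hx.1 ?_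
    have : ∀ᵐ t ∂muPi, k t * f t * Real.exp (0 + ∫ s in (0 : ℝ)..t, (-k) s) +
      (C + ∫ s in (0 : ℝ)..t, k s * f s) * (Real.exp (0 + ∫ s in (0 : ℝ)..t, (-k) s) * (-k) t)
        ≤ 0 := by
      filter_upwards [hk0, ae_mem_Ioo] with t ht htm
      have h3 := h t (Set.Ioo_subset_Icc_self htm)
      have h4 := mul_nonneg (mul_nonneg ht (Real.exp_pos (0 + ∫ s in (0 : ℝ)..t, (-k) s)).le)
        (sub_nonneg.2 h3)
      simp only [Pi.neg_apply] at h4 ⊢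
      linarith
    filter_upwards [ae_restrict_of_ae_restrict_of_subset (Set.Icc_subset_Icc_right hx.2) this]
      with t ht using neg_nonneg.2 ht
  simp only [intervalIntegral.integral_same, add_zero, zero_add, Real.exp_zero, mul_one] at h1 h2
  have h5 : (C + ∫ t in (0 : ℝ)..x, k t * f t) * Real.exp (-∫ t in (0 : ℝ)..x, k t) ≤ C := by
    have : ∫ t in (0 : ℝ)..x, (-k) t = -∫ t in (0 : ℝ)..x, k t := by
      simp [intervalIntegral.integral_neg]
    rw [this] at h1
    linarith
  rw [Real.exp_neg, ← div_eq_mul_inv, div_le_iff₀ (Real.exp_pos _)] at h5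
  exact (h x hx).trans h5

end Prim


/-! ### Volterra operators with summable matrix kernels. -/

/-- Continuous `ℂ²`-valued functions on `[0, π]`. -/
abbrev CPi : Type := C(Set.Icc (0 : ℝ) π, Fin 2 → ℂ)

/-- Extension of a function on `[0, π]` to the line by constants. -/
noncomputable def ext (y : CPi) : ℝ → Fin 2 → ℂ := Set.IccExtend Real.pi_pos.le y

theorem ext_of_mem (y : CPi) {x : ℝ} (hx : x ∈ Set.Icc 0 π) : ext y x = y ⟨x, hx⟩ :=
  Set.IccExtend_of_mem _ _ hx

theorem continuous_ext (y : CPi) : Continuous (ext y) := y.continuous.Icc_extend'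

theorem norm_ext_le (y : CPi) (x : ℝ) : ‖ext y x‖ ≤ ‖y‖ := y.norm_coe_le_norm _

@[simp] theorem ext_add (y z : CPi) : ext (y + z) = ext y + ext z := rfl

@[simp] theorem ext_smul (c : ℂ) (y : CPi) : ext (c • y) = c • ext y := rfl

/-- The sum of the absolute values of the entries. -/
noncomputable def entrySum (A : Matrix (Fin 2) (Fin 2) ℂ) : ℝ := ∑ i, ∑ j, ‖A i j‖

theorem entrySum_nonneg (A : Matrix (Fin 2) (Fin 2) ℂ) : 0 ≤ entrySum A :=
  Finset.sum_nonneg fun _ _ => Finset.sum_nonneg fun _ _ => norm_nonneg _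

theorem norm_mulVec_le (A : Matrix (Fin 2) (Fin 2) ℂ) (v : Fin 2 → ℂ) :
    ‖A *ᵥ v‖ ≤ entrySum A * ‖v‖ := by
  refine (pi_norm_le_iff_of_nonneg (mul_nonneg (entrySum_nonneg A) (norm_nonneg v))).2 fun i => ?_
  calc ‖(A *ᵥ v) i‖ ≤ ∑ j, ‖A i j * v j‖ := norm_sum_le Finset.univ fun j => A i j * v j
    _ ≤ ∑ j, ‖A i j‖ * ‖v‖ := by
        refine Finset.sum_le_sum fun j _ => ?_
        rw [norm_mul]
        gcongr
        exact norm_le_pi_norm v j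
    _ = (∑ j, ‖A i j‖) * ‖v‖ := by rw [Finset.sum_mul]
    _ ≤ entrySum A * ‖v‖ := by
        gcongr
        exact Finset.single_le_sum (f := fun i => ∑ j, ‖A i j‖)
          (fun _ _ => Finset.sum_nonneg fun _ _ => norm_nonneg _) (Finset.mem_univ i)

/-- All entries of the matrix function are summable on `[0, π]`. -/
def EntryIntegrable (A : ℝ → Matrix (Fin 2) (Fin 2) ℂ) : Prop :=
  ∀ i j, Integrable (fun x => A x i j) muPi

theorem EntryIntegrable.entrySum {A : ℝ → Matrix (Fin 2) (Fin 2) ℂ} (hA : EntryIntegrable A) :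
    Integrable (fun x => entrySum (A x)) muPi :=
  integrable_finsetSum _ fun i _ => integrable_finsetSum _ fun j _ => (hA i j).norm

theorem integrable_pi {f : ℝ → Fin 2 → ℂ} (h : ∀ i, Integrable (fun x => f x i) muPi) :
    Integrable f muPi :=
  Integrable.of_eval h

theorem EntryIntegrable.mulVec {A : ℝ → Matrix (Fin 2) (Fin 2) ℂ} (hA : EntryIntegrable A)
    {f : ℝ → Fin 2 → ℂ} (hf : ContinuousOn f (Set.Icc 0 π)) :
    Integrable (fun x => A x *ᵥ f x) muPi := by
  refine integrable_pi fun i => ?_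
  simp only [Matrix.mulVec, dotProduct]
  refine integrable_finsetSum _ fun j _ => integrable_mul_of_continuousOn (hA i j) ?_
  exact (continuous_apply j).comp_continuousOn hf

/-- The function `x ↦ ∫₀ˣ A y`. -/
noncomputable def volterraFun {A : ℝ → Matrix (Fin 2) (Fin 2) ℂ} (hA : EntryIntegrable A)
    (y : CPi) : CPi where
  toFun x := ∫ t in (0 : ℝ)..x, A t *ᵥ ext y t
  continuous_toFun := by
    have h := (isPrim_integral (hA.mulVec (continuous_ext y).continuousOn) 0).continuousOn
    simp only [zero_add] at h
    exact continuousOn_iff_continuous_domRestrict.1 h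

theorem norm_integral_mulVec_le {A : ℝ → Matrix (Fin 2) (Fin 2) ℂ} (hA : EntryIntegrable A)
    (f : ℝ → Fin 2 → ℂ) {g : ℝ → ℝ} (hg : ContinuousOn g (Set.Icc 0 π))
    (hfg : ∀ x ∈ Set.Icc 0 π, ‖f x‖ ≤ g x) {x : ℝ} (hx : x ∈ Set.Icc 0 π) :
    ‖∫ t in (0 : ℝ)..x, A t *ᵥ f t‖ ≤ ∫ t in (0 : ℝ)..x, entrySum (A t) * g t := by
  refine norm_integral_le_muPi (integrable_mul_of_continuousOn_real hA.entrySum hg) ?_ hx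
  filter_upwards [ae_mem_Ioo] with t ht
  refine (norm_mulVec_le _ _).trans ?_
  gcongr
  · exact entrySum_nonneg _
  · exact hfg t (Set.Ioo_subset_Icc_self ht)

/-- The Volterra operator `(K y)(x) = ∫₀ˣ A y`. -/
noncomputable def volterra {A : ℝ → Matrix (Fin 2) (Fin 2) ℂ} (hA : EntryIntegrable A) :
    CPi →L[ℂ] CPi :=
  LinearMap.mkContinuous
    { toFun := volterraFun hA
      map_add' := by
        intro y z
        ext1 x
        simp only [volterraFun, ContinuousMap.coe_mk, ContinuousMap.add_apply, ext_add,
          Pi.add_apply, Matrix.mulVec_add]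
        exact intervalIntegral.integral_add
          (intervalIntegrable_of_muPi (hA.mulVec (continuous_ext y).continuousOn)
            zero_mem_Icc_pi x.2)
          (intervalIntegrable_of_muPi (hA.mulVec (continuous_ext z).continuousOn)
            zero_mem_Icc_pi x.2)
      map_smul' := by
        intro c y
        ext1 x
        simp only [volterraFun, ContinuousMap.coe_mk, ContinuousMap.smul_apply, ext_smul,
          Pi.smul_apply, Matrix.mulVec_smul, RingHom.id_apply]
        exact intervalIntegral.integral_smul _ _ }
    (∫ x, entrySum (A x) ∂muPi) (by
      intro y
      refine (ContinuousMap.norm_le _ (mul_nonneg (integral_nonneg fun x => entrySum_nonneg _)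
        (norm_nonneg y))).2 fun x => ?_
      refine (norm_integral_mulVec_le hA (ext y) (g := fun _ => ‖y‖) continuousOn_const
        (fun t _ => norm_ext_le y t) x.2).trans ?_
      rw [intervalIntegral.integral_mul_const]
      gcongr
      exact integral_le_muPi hA.entrySum (Eventually.of_forall fun t => entrySum_nonneg _) x.2)

theorem volterra_apply {A : ℝ → Matrix (Fin 2) (Fin 2) ℂ} (hA : EntryIntegrable A) (y : CPi)
    (x : Set.Icc (0 : ℝ) π) : volterra hA y x = ∫ t in (0 : ℝ)..x, A t *ᵥ ext y t := rfl

/-- With ω(x) = ∫₀ˣ `entrySum (A t)`, the induction step is the identity (ω^{n+1}/(n+1)!)' = ω'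
ωⁿ/n!. The factorial makes some power of the operator a contraction. -/
theorem norm_volterra_pow_le {A : ℝ → Matrix (Fin 2) (Fin 2) ℂ} (hA : EntryIntegrable A)
    (y : CPi) (n : ℕ) (x : Set.Icc (0 : ℝ) π) :
    ‖(volterra hA ^ n) y x‖ ≤ ‖y‖ * ((∫ t in (0 : ℝ)..x, entrySum (A t)) ^ n / n.factorial) := by
  induction n generalizing x with
  | zero => simpa using y.norm_coe_le_norm x
  | succ n ih =>
    have hP := isPrim_integral hA.entrySum 0
    simp only [zero_add] at hP
    have hc : ContinuousOn (fun x => ‖y‖ * ((∫ t in (0 : ℝ)..x, entrySum (A t)) ^ n /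
        n.factorial)) (Set.Icc 0 π) :=
      continuousOn_const.mul ((hP.continuousOn.pow n).div_const _)
    rw [pow_succ', mul_apply_eq_comp, volterra_apply]
    refine (norm_integral_mulVec_le hA _ hc (fun t ht => ?_) x.2).trans ?_
    · rw [ext_of_mem _ ht]
      exact ih ⟨t, ht⟩
    · have h1 := hP.comp (G := fun s : ℝ => ‖y‖ * (s ^ (n + 1) / (n + 1).factorial))
        (by fun_prop)
      have h2 := h1.eq x x.2
      simp only [intervalIntegral.integral_same, ne_eq, Nat.add_eq_zero_iff, one_ne_zero,
        and_false, not_false_eq_true, zero_pow, zero_div, mul_zero, zero_add] at h2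
      rw [h2]
      refine le_of_eq (intervalIntegral.integral_congr fun t _ => ?_)
      have h3 : HasDerivAt (fun s : ℝ => ‖y‖ * (s ^ (n + 1) / (n + 1).factorial))
          (‖y‖ * ((n + 1 : ℕ) * (∫ t in (0 : ℝ)..t, entrySum (A t)) ^ n / (n + 1).factorial))
          (∫ t in (0 : ℝ)..t, entrySum (A t)) := by
        simpa using ((hasDerivAt_pow (n + 1) _).div_const ((n + 1).factorial : ℝ)).const_mul ‖y‖
      simp only [h3.hasFDerivAt.fderiv, ContinuousLinearMap.toSpanSingleton_apply, smul_eq_mul]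
      rw [Nat.factorial_succ]
      push_cast
      have : ((n : ℝ) + 1) ≠ 0 := by positivity
      field_simp

/-- 1 - Tⁿ is invertible and is the product of the commuting factors 1 - T and 1 + T + … + T^{n-1};
commuting factors of a unit are units. -/
theorem isUnit_one_sub_of_norm_pow_lt {X : Type*} [NormedAddCommGroup X] [NormedSpace ℂ X]
    [CompleteSpace X] {T : X →L[ℂ] X} {n : ℕ} (h : ‖T ^ n‖ < 1) : IsUnit (1 - T) := by
  have hu := isUnit_one_sub_of_norm_lt_one h
  rw [← mul_neg_geom_sum] at hu
  refine ((Commute.isUnit_mul_iff ?_).1 hu).1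
  exact (mul_neg_geom_sum T n).trans (geom_sum_mul_neg T n).symm

/-- For `G` the inverse of `1 - K`, a perturbation `w • S` becomes 1 - w T with T = G S. The Neumann
series in w of the last factor is the Taylor expansion in the spectral parameter. -/
theorem one_sub_add_smul {X : Type*} [NormedAddCommGroup X] [NormedSpace ℂ X]
    {K G S : X →L[ℂ] X} (h : (1 - K) * G = 1) (w : ℂ) :
    1 - (K + w • S) = (1 - K) * (1 - w • (G * S)) := by
  rw [mul_sub, mul_one, mul_smul_comm, ← mul_assoc, h, one_mul]
  abel

/-- `1 - K` is invertible for every Volterra operator `K`. -/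
theorem isUnit_one_sub_volterra {A : ℝ → Matrix (Fin 2) (Fin 2) ℂ} (hA : EntryIntegrable A) :
    IsUnit (1 - volterra hA) := by
  set c := ∫ x, entrySum (A x) ∂muPi
  have hc : 0 ≤ c := integral_nonneg fun x => entrySum_nonneg _
  have hlim := FloorSemiring.tendsto_pow_div_factorial_atTop c
  obtain ⟨n, hn⟩ := (hlim.eventually (gt_mem_nhds (show (0 : ℝ) < 1 / 2 by norm_num))).exists
  have hnorm : ‖volterra hA ^ n‖ ≤ 1 / 2 := by
    refine ContinuousLinearMap.opNorm_le_bound _ (by norm_num) fun y => ?_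
    refine (ContinuousMap.norm_le _ (by positivity)).2 fun x => ?_
    refine (norm_volterra_pow_le hA y n x).trans ?_
    rw [mul_comm]
    refine mul_le_mul_of_nonneg_right (le_trans ?_ hn.le) (norm_nonneg y)
    gcongr
    · exact intervalIntegral.integral_nonneg x.2.1 fun t _ => entrySum_nonneg _
    · exact integral_le_muPi hA.entrySum (Eventually.of_forall fun t => entrySum_nonneg _) x.2
  exact isUnit_one_sub_of_norm_pow_lt (hnorm.trans_lt (by norm_num : (1 / 2 : ℝ) < 1))

/-- The coefficient matrix of `y' = B (λ - Q) y`, which is equivalent to `-B y' + Q y = λ y`. -/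
noncomputable def coefA (Q : ℝ → Matrix (Fin 2) (Fin 2) ℂ) (z : ℂ) (t : ℝ) :
    Matrix (Fin 2) (Fin 2) ℂ :=
  B * (z • (1 : Matrix (Fin 2) (Fin 2) ℂ) - Q t)

theorem coefA_eq (Q : ℝ → Matrix (Fin 2) (Fin 2) ℂ) (z : ℂ) (t : ℝ) :
    coefA Q z t = !![-Q t 1 0, z - Q t 1 1; Q t 0 0 - z, Q t 0 1] := by
  ext i j
  fin_cases i <;> fin_cases j <;> simp [coefA, B, Matrix.mul_apply]

instance : IsFiniteMeasure muPi := by unfold muPi; infer_instance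

theorem entryIntegrable_coefA {Q : ℝ → Matrix (Fin 2) (Fin 2) ℂ} (hQ : EntryIntegrable Q)
    (z : ℂ) : EntryIntegrable (coefA Q z) := by
  intro i j
  simp only [coefA_eq]
  fin_cases i <;> fin_cases j
  · exact (hQ 1 0).neg
  · exact (integrable_const z).sub (hQ 1 1)
  · exact (hQ 0 0).sub (integrable_const z)
  · exact hQ 0 1

theorem entryIntegrable_B : EntryIntegrable fun _ => B := fun _ _ => integrable_const _

/-- The Neumann series of `(1 - w T)⁻¹` for small `w`. -/
theorem eventually_hasSum_neumann {X : Type*} [NormedAddCommGroup X] [NormedSpace ℂ X]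
    [CompleteSpace X] (T : X →L[ℂ] X) :
    ∀ᶠ w in 𝓝 (0 : ℂ), ∃ S : X →L[ℂ] X, (1 - w • T) * S = 1 ∧
      ∀ x, HasSum (fun n => w ^ n • (T ^ n) x) (S x) := by
  have h0 : Tendsto (fun w : ℂ => ‖w • T‖) (𝓝 0) (𝓝 0) := by
    have : Continuous fun w : ℂ => ‖w • T‖ := by fun_prop
    simpa using this.tendsto 0
  filter_upwards [h0.eventually (gt_mem_nhds one_pos)] with w hw
  refine ⟨∑' n, (w • T) ^ n, mul_neg_geom_series _ hw, fun x => ?_⟩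
  have hS : HasSum (fun n => (w • T) ^ n) (∑' n, (w • T) ^ n) :=
    (summable_geometric_of_norm_lt_one hw).hasSum
  have h6 := (ContinuousLinearMap.apply ℂ X x).hasSum hS
  convert! h6 using 2 with n
  simp [smul_pow]

/-! ### The Cauchy problem and its dependence on the spectral parameter. -/

section Resolvent

variable {Q : ℝ → Matrix (Fin 2) (Fin 2) ℂ} (hQ : EntryIntegrable Q)

/-- The Volterra operator of the Dirac system with spectral parameter `z`. -/
noncomputable def opK (z : ℂ) : CPi →L[ℂ] CPi := volterra (entryIntegrable_coefA hQ z)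

/-- The operator `y ↦ ∫₀ˣ B y`. -/
noncomputable def opB : CPi →L[ℂ] CPi := volterra entryIntegrable_B

/-- The coefficient matrix B(z - Q) is affine in z with slope B. -/
theorem opK_add (z w : ℂ) : opK hQ (z + w) = opK hQ z + w • opB := by
  ext1 y
  ext1 x
  simp only [opK, opB, add_apply, smul_apply,
    ContinuousMap.add_apply, ContinuousMap.smul_apply, volterra_apply]
  rw [← intervalIntegral.integral_smul, ← intervalIntegral.integral_add]
  · refine intervalIntegral.integral_congr fun t _ => ?_
    simp only [coefA, Matrix.sub_mulVec, add_smul, mul_sub, mul_add, Matrix.add_mulVec,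
      Matrix.mul_smul, mul_one, Matrix.smul_mulVec]
    abel
  · exact intervalIntegrable_of_muPi ((entryIntegrable_coefA hQ z).mulVec
      (continuous_ext y).continuousOn) zero_mem_Icc_pi x.2
  · exact intervalIntegrable_of_muPi ((entryIntegrable_B.mulVec
      (continuous_ext y).continuousOn).smul w) zero_mem_Icc_pi x.2

/-- `(1 - K)⁻¹`. -/
noncomputable def opG (z : ℂ) : CPi →L[ℂ] CPi := Ring.inverse (1 - opK hQ z)

theorem opG_mul (z : ℂ) : opG hQ z * (1 - opK hQ z) = 1 :=
  Ring.inverse_mul_cancel _ (isUnit_one_sub_volterra _)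

theorem mul_opG (z : ℂ) : (1 - opK hQ z) * opG hQ z = 1 :=
  Ring.mul_inverse_cancel _ (isUnit_one_sub_volterra _)

/-- The operator giving the solution of `(ℓ - z) y = f` with `y(0) = 0`. -/
noncomputable def opT (z : ℂ) : CPi →L[ℂ] CPi := opG hQ z * opB

/-- The solution of `(ℓ - z) y = 0` with `y(0) = a`. -/
noncomputable def solY (z : ℂ) : (Fin 2 → ℂ) →ₗ[ℂ] CPi where
  toFun a := opG hQ z (ContinuousMap.const _ a)
  map_add' a b := by
    rw [← map_add]
    rfl
  map_smul' c a := by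
    rw [RingHom.id_apply, ← map_smul]
    rfl

theorem solY_eq (z : ℂ) (a : Fin 2 → ℂ) :
    solY hQ z a = ContinuousMap.const _ a + opK hQ z (solY hQ z a) := by
  have h := congrArg (fun S : CPi →L[ℂ] CPi => S (ContinuousMap.const _ a)) (mul_opG hQ z)
  simp only [mul_apply_eq_comp, sub_apply,
    one_apply_eq_self] at h
  exact eq_add_of_sub_eq h

theorem opT_eq (z : ℂ) (f : CPi) : opT hQ z f = opB f + opK hQ z (opT hQ z f) := by
  have h := congrArg (fun S : CPi →L[ℂ] CPi => S (opB f)) (mul_opG hQ z)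
  simp only [mul_apply_eq_comp, sub_apply,
    one_apply_eq_self] at h
  exact eq_add_of_sub_eq h

/-- Uniqueness for the inhomogeneous Cauchy problem: the left inverse `opG` is applied to (1 - K)y =
a + ∫Bf. -/
theorem eq_solY_add_opT {z : ℂ} {y f : CPi} {a : Fin 2 → ℂ}
    (h : y = ContinuousMap.const _ a + opK hQ z y + opB f) : y = solY hQ z a + opT hQ z f := by
  have h1 : (1 - opK hQ z) y = ContinuousMap.const _ a + opB f := by
    rw [sub_apply, one_apply_eq_self, sub_eq_iff_eq_add]
    conv_lhs => rw [h]
    abel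
  have h2 := congrArg (fun S : CPi →L[ℂ] CPi => S y) (opG_mul hQ z)
  simp only [mul_apply_eq_comp, one_apply_eq_self, h1, map_add] at h2
  exact h2.symm

theorem volterra_zero {A : ℝ → Matrix (Fin 2) (Fin 2) ℂ} (hA : EntryIntegrable A) (y : CPi) :
    volterra hA y ⟨0, zero_mem_Icc_pi⟩ = 0 := by
  simp [volterra_apply]

theorem solY_zero (z : ℂ) (a : Fin 2 → ℂ) : solY hQ z a ⟨0, zero_mem_Icc_pi⟩ = a := by
  rw [solY_eq]
  simp [opK, volterra_zero]

theorem opT_zero (z : ℂ) (f : CPi) : opT hQ z f ⟨0, zero_mem_Icc_pi⟩ = 0 := by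
  rw [opT_eq]
  simp [opK, opB, volterra_zero]

/-- Power series expansion of the solution with respect to the spectral parameter. -/
theorem hasSum_solY (z : ℂ) (a : Fin 2 → ℂ) :
    ∀ᶠ w in 𝓝 (0 : ℂ), HasSum (fun n => w ^ n • (opT hQ z ^ n) (solY hQ z a))
      (solY hQ (z + w) a) := by
  filter_upwards [eventually_hasSum_neumann (opT hQ z)] with w ⟨S, h1, hS⟩
  have h2 : 1 - opK hQ (z + w) = (1 - opK hQ z) * (1 - w • opT hQ z) := by
    rw [opK_add]
    exact one_sub_add_smul (mul_opG hQ z) w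
  -- The product on the right is a right inverse of `1 - opK hQ (z + w)`, and `opG hQ (z + w)` is a
  -- left inverse of it, so they agree.
  have h3 : opG hQ (z + w) = S * opG hQ z := by
    have h4 : (1 - opK hQ (z + w)) * (S * opG hQ z) = 1 := by
      rw [h2, mul_assoc, ← mul_assoc (1 - w • opT hQ z), h1, one_mul, mul_opG]
    have h5 := congrArg (opG hQ (z + w) * ·) h4
    simp only [← mul_assoc, opG_mul, one_mul, mul_one] at h5
    exact h5.symm
  have h7 : solY hQ (z + w) a = S (solY hQ z a) := by
    change opG hQ (z + w) _ = _
    rw [h3]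
    rfl
  rw [h7]
  exact hS _

/-- Differentiating ∫₀ˣ B f = 0 gives B f = 0 almost everywhere; B is invertible and f is
continuous. The resulting injectivity of `opT` makes the terms of a chain independent. -/
theorem opB_injective : Function.Injective opB := by
  rw [injective_iff_map_eq_zero]
  intro f hf
  have hP := isPrim_integral (entryIntegrable_B.mulVec (continuous_ext f).continuousOn) 0
  have h0 : ∀ᵐ x ∂muPi, B *ᵥ ext f x = 0 := by
    filter_upwards [hP.ae_hasDerivAt, ae_mem_Ioo] with x hx hxm
    refine hx.unique ((hasDerivAt_const x (0 : Fin 2 → ℂ)).congr_of_eventuallyEq ?_)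
    filter_upwards [Icc_mem_nhds hxm.1 hxm.2] with t ht
    have := congrArg (fun g : CPi => g ⟨t, ht⟩) hf
    simp only [opB, volterra_apply, ContinuousMap.zero_apply] at this
    rw [this, zero_add]
  have h1 : ∀ᵐ x ∂muPi, ext f x = 0 := by
    filter_upwards [h0] with x hx
    have e0 := congrFun hx 0
    have e1 := congrFun hx 1
    simp [B, Matrix.mulVec, dotProduct] at e0 e1
    ext i
    fin_cases i <;> simp [e0, e1]
  have h2 := Measure.eqOn_Icc_of_ae_eq (μ := volume) Real.pi_pos.ne h1
    (continuous_ext f).continuousOn continuousOn_const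
  ext1 x
  have := h2 x.2
  rwa [ext_of_mem f x.2] at this

theorem opT_injective (z : ℂ) : Function.Injective (opT hQ z) := by
  rw [injective_iff_map_eq_zero]
  intro f hf
  have h := opT_eq hQ z f
  rw [hf, map_zero, add_zero] at h
  exact (injective_iff_map_eq_zero _).1 opB_injective f h.symm

end Resolvent


/-! ### Matrices of power series acting on finite sequences through the backward shift. -/

section LocalAlgebra

/-- The map `e` restricts to a surjection from ker(g ∘ e) onto ker g whose kernel is ker e. Ranks
are cardinals, so no finiteness has to be known in advance. -/
theorem rank_ker_comp {V W Z : Type} [AddCommGroup V] [Module ℂ V] [AddCommGroup W] [Module ℂ W]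
    [AddCommGroup Z] [Module ℂ Z] {e : V →ₗ[ℂ] W} (he : Function.Surjective e) (g : W →ₗ[ℂ] Z) :
    Module.rank ℂ (LinearMap.ker (g ∘ₗ e)) =
      Module.rank ℂ (LinearMap.ker g) + Module.rank ℂ (LinearMap.ker e) := by
  let f : LinearMap.ker (g ∘ₗ e) →ₗ[ℂ] LinearMap.ker g :=
    (e.domRestrict _).codRestrict _ fun x => x.2
  have hf : Function.Surjective f := by
    rintro ⟨w, hw⟩
    obtain ⟨v, rfl⟩ := he w
    exact ⟨⟨v, hw⟩, rfl⟩
  rw [LinearMap.rank_eq_of_surjective hf]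
  congr 1
  refine LinearEquiv.rank_eq
    { toFun := fun x => ⟨x.1.1, congrArg Subtype.val (LinearMap.mem_ker.1 x.2)⟩
      map_add' := fun _ _ => rfl
      map_smul' := fun _ _ => rfl
      invFun := fun x => ⟨⟨x.1, ?_⟩, ?_⟩
      left_inv := fun _ => rfl
      right_inv := fun _ => rfl }
  · rw [LinearMap.mem_ker, LinearMap.comp_apply, LinearMap.mem_ker.1 x.2, map_zero]
  · exact Subtype.ext (LinearMap.mem_ker.1 x.2)

/-- The action of the power series `∑ cₙ Sⁿ` on finitely supported sequences, where `S` is the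
backward shift. -/
noncomputable def act (c : ℕ → ℂ) : (ℕ →₀ ℂ) →ₗ[ℂ] (ℕ → ℂ) :=
  Finsupp.linearCombination ℂ fun n l => if l ≤ n then c (n - l) else 0

theorem act_single (c : ℕ → ℂ) (n : ℕ) (x : ℂ) (l : ℕ) :
    act c (Finsupp.single n x) l = if l ≤ n then x * c (n - l) else 0 := by
  simp [act, Finsupp.linearCombination_single]

theorem act_apply (c : ℕ → ℂ) (a : ℕ →₀ ℂ) (l : ℕ) :
    act c a l = ∑ n ∈ a.support, if l ≤ n then a n * c (n - l) else 0 := by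
  simp [act, Finsupp.linearCombination_apply, Finsupp.sum, Finset.sum_apply]

/-- The backward shift on finitely supported sequences. -/
noncomputable def bshift : (ℕ →₀ ℂ) →ₗ[ℂ] (ℕ →₀ ℂ) :=
  Finsupp.lcomapDomain (fun n => n + 1) (add_left_injective 1)

theorem bshift_apply (a : ℕ →₀ ℂ) (n : ℕ) : bshift a n = a (n + 1) := rfl

theorem bshift_surjective : Function.Surjective bshift := by
  intro a
  refine ⟨a.mapDomain (fun n => n + 1), ?_⟩
  ext n
  rw [bshift_apply]
  exact Finsupp.mapDomain_apply (add_left_injective 1) a n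

theorem act_add_smul (c c' : ℕ → ℂ) (s : ℂ) (a : ℕ →₀ ℂ) :
    act (fun n => c n + s * c' n) a = act c a + s • act c' a := by
  ext l
  simp only [act_apply, Pi.add_apply, Pi.smul_apply, smul_eq_mul, Finset.mul_sum,
    ← Finset.sum_add_distrib]
  refine Finset.sum_congr rfl fun n _ => ?_
  split_ifs <;> ring

/-- The variable acts as the backward shift, so a series without constant term acts as the shift
followed by the quotient of the series by the variable. -/
theorem act_of_zero {c : ℕ → ℂ} (h0 : c 0 = 0) (a : ℕ →₀ ℂ) :
    act c a = act (fun n => c (n + 1)) (bshift a) := by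
  have : act c = act (fun n => c (n + 1)) ∘ₗ bshift := by
    refine Finsupp.lhom_ext fun n x => ?_
    ext l
    rw [LinearMap.comp_apply]
    cases n with
    | zero =>
      have : bshift (Finsupp.single 0 x) = 0 := by
        ext m
        simp [bshift_apply]
      rw [this, map_zero, act_single]
      split_ifs with h
      · simp [h0]
      · rfl
    | succ n =>
      have : bshift (Finsupp.single (n + 1) x) = Finsupp.single n x := by
        ext m
        simp [bshift_apply, Finsupp.single_apply]
      rw [this, act_single, act_single]
      rcases lt_trichotomy l (n + 1) with h | h | h
      · rw [if_pos h.le, if_pos (Nat.lt_succ_iff.1 h), Nat.succ_sub (Nat.lt_succ_iff.1 h)]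
      · subst h
        simp [h0]
      · rw [if_neg (by omega), if_neg (by omega)]
  rw [this]
  rfl

/-- In the component at the last possibly nonzero index `J`, only the constant term of the series
meets a nonzero entry of `a`. -/
theorem act_top (c : ℕ → ℂ) {a : ℕ →₀ ℂ} {J : ℕ} (h : ∀ n, J < n → a n = 0) :
    act c a J = a J * c 0 := by
  rw [act_apply, Finset.sum_eq_single J]
  · simp
  · intro n _ hn
    split_ifs with hJ
    · rw [h n (lt_of_le_of_ne hJ hn.symm), zero_mul]
    · rfl
  · intro hJ
    simp [Finsupp.notMem_support_iff.1 hJ]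

/-- The action of a `2 × 2` matrix of power series on pairs of finitely supported sequences. -/
noncomputable def matAct (c : Fin 2 → Fin 2 → ℕ → ℂ) :
    (ℕ →₀ ℂ) × (ℕ →₀ ℂ) →ₗ[ℂ] (ℕ → ℂ) × (ℕ → ℂ) :=
  ((act (c 0 0)).coprod (act (c 0 1))).prod ((act (c 1 0)).coprod (act (c 1 1)))

theorem matAct_apply (c : Fin 2 → Fin 2 → ℕ → ℂ) (a : (ℕ →₀ ℂ) × (ℕ →₀ ℂ)) :
    matAct c a = (act (c 0 0) a.1 + act (c 0 1) a.2, act (c 1 0) a.1 + act (c 1 1) a.2) := rfl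

/-- At the highest index of a pair in the kernel only the matrix of constant terms acts. That matrix
is invertible, so Cramer's rule kills the highest entries, and the index descends. -/
theorem ker_matAct_of_det_ne_zero {c : Fin 2 → Fin 2 → ℕ → ℂ}
    (h : c 0 0 0 * c 1 1 0 - c 0 1 0 * c 1 0 0 ≠ 0) : LinearMap.ker (matAct c) = ⊥ := by
  rw [LinearMap.ker_eq_bot']
  rintro ⟨a, b⟩ hab
  have key : ∀ N : ℕ, (∀ n, N ≤ n → a n = 0 ∧ b n = 0) → a = 0 ∧ b = 0 := by
    intro N
    induction N with
    | zero =>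
      exact fun h => ⟨Finsupp.ext fun n => (h n n.zero_le).1, Finsupp.ext fun n => (h n n.zero_le).2⟩
    | succ N ih =>
      intro hN
      refine ih fun n hn => ?_
      rcases hn.eq_or_lt with rfl | hn
      · rw [matAct_apply, Prod.mk_eq_zero] at hab
        have e0 := congrFun hab.1 N
        have e1 := congrFun hab.2 N
        simp only [Pi.add_apply, Pi.zero_apply] at e0 e1
        rw [act_top _ (fun n hn => (hN n hn).1), act_top _ (fun n hn => (hN n hn).2)] at e0 e1
        constructor
        · refine (mul_eq_zero.1 (?_ : a N * (c 0 0 0 * c 1 1 0 - c 0 1 0 * c 1 0 0) = 0)).resolve_right h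
          linear_combination c 1 1 0 * e0 - c 0 1 0 * e1
        · refine (mul_eq_zero.1 (?_ : b N * (c 0 0 0 * c 1 1 0 - c 0 1 0 * c 1 0 0) = 0)).resolve_right h
          linear_combination c 0 0 0 * e1 - c 1 0 0 * e0
      · exact hN n hn
  obtain ⟨N, hN⟩ := (a.support ∪ b.support).exists_nat_subset_range
  refine Prod.ext_iff.2 (key N fun n hn => ?_)
  have : n ∉ a.support ∪ b.support := fun h => by
    have := Finset.mem_range.1 (hN h)
    omega
  simpa using this

theorem rank_ker_matAct_swap (c : Fin 2 → Fin 2 → ℕ → ℂ) :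
    Module.rank ℂ (LinearMap.ker (matAct c)) =
      Module.rank ℂ (LinearMap.ker (matAct fun i j => c i (1 - j))) := by
  have h : matAct c = matAct (fun i j => c i (1 - j)) ∘ₗ
      (LinearEquiv.prodComm ℂ (ℕ →₀ ℂ) (ℕ →₀ ℂ)).toLinearMap := by
    ext1 <;> ext1 n <;> ext1 <;> simp [matAct_apply]
  rw [h, rank_ker_comp (LinearEquiv.surjective _), LinearEquiv.ker, rank_bot, add_zero]

/-- Adding `s` times the second column to the first makes the first vanish at the base point, after
which it is divided by the variable. On sequences this is the factor (a, b) ↦ (shift a, b - s a),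
which is surjective with one-dimensional kernel. -/
theorem rank_ker_matAct_reduce {c d : Fin 2 → Fin 2 → ℕ → ℂ} {s : ℂ}
    (h0 : ∀ i, c i 0 0 + s * c i 1 0 = 0) (hd0 : ∀ i n, d i 0 n = c i 0 (n + 1) + s * c i 1 (n + 1))
    (hd1 : ∀ i, d i 1 = c i 1) :
    Module.rank ℂ (LinearMap.ker (matAct c)) = Module.rank ℂ (LinearMap.ker (matAct d)) + 1 := by
  let e : (ℕ →₀ ℂ) × (ℕ →₀ ℂ) →ₗ[ℂ] (ℕ →₀ ℂ) × (ℕ →₀ ℂ) :=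
    (bshift ∘ₗ LinearMap.fst ℂ _ _).prod (LinearMap.snd ℂ _ _ - s • LinearMap.fst ℂ _ _)
  have he : ∀ a, e a = (bshift a.1, a.2 - s • a.1) := fun a => rfl
  have hs : Function.Surjective e := by
    rintro ⟨x, y⟩
    obtain ⟨a, rfl⟩ := bshift_surjective x
    exact ⟨(a, y + s • a), by simp [he]⟩
  have hcomp : matAct c = matAct d ∘ₗ e := by
    refine LinearMap.ext fun a => ?_
    have key : ∀ i, act (c i 0) a.1 + act (c i 1) a.2 =
        act (d i 0) (bshift a.1) + act (d i 1) (a.2 - s • a.1) := by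
      intro i
      have h1 := act_add_smul (c i 0) (c i 1) s a.1
      rw [act_of_zero (h0 i)] at h1
      have h2 : d i 0 = fun n => c i 0 (n + 1) + s * c i 1 (n + 1) := funext (hd0 i)
      rw [h2, h1, hd1, map_sub, map_smul]
      abel
    rw [LinearMap.comp_apply, matAct_apply, matAct_apply, he, key 0, key 1]
  have hker : LinearMap.ker e = Submodule.span ℂ {(Finsupp.single 0 1, s • Finsupp.single 0 1)} := by
    ext ⟨a, b⟩
    rw [LinearMap.mem_ker, he, Submodule.mem_span_singleton, Prod.mk_eq_zero]
    constructor
    · rintro ⟨h1, h2⟩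
      have ha : a = a 0 • Finsupp.single 0 1 := by
        ext n
        cases n with
        | zero => simp
        | succ n =>
          have := congrArg (fun f : ℕ →₀ ℂ => f n) h1
          simp only [bshift_apply, Finsupp.coe_zero, Pi.zero_apply] at this
          simp [this]
      refine ⟨a 0, ?_⟩
      rw [Prod.smul_mk, ← ha, smul_comm, ← ha, ← sub_eq_zero.1 h2]
    · rintro ⟨t, ht⟩
      simp only [Prod.smul_mk, Prod.mk.injEq] at ht
      obtain ⟨rfl, rfl⟩ := ht
      constructor
      · ext n
        simp [bshift_apply]
      · rw [smul_comm, sub_self]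
  rw [hcomp, rank_ker_comp hs, hker, ← Module.finrank_eq_rank ℂ (Submodule.span ℂ _),
    finrank_span_singleton, Nat.cast_one]
  simp [Prod.mk_eq_zero]

open FormalMultilinearSeries in
/-- The kernel of the action of a matrix of convergent power series with determinant of order `m`
has dimension `m`. -/
theorem rank_ker_matAct {μ : ℂ} (m : ℕ) (f : Fin 2 → Fin 2 → ℂ → ℂ)
    (p : Fin 2 → Fin 2 → FormalMultilinearSeries ℂ ℂ ℂ)
    (hp : ∀ i j, HasFPowerSeriesAt (f i j) (p i j) μ)
    (hm : analyticOrderAt (fun z => f 0 0 z * f 1 1 z - f 0 1 z * f 1 0 z) μ = m) :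
    Module.rank ℂ (LinearMap.ker (matAct fun i j => (p i j).coeff)) = m := by
  induction m generalizing f p with
  | zero =>
    rw [ker_matAct_of_det_ne_zero]
    · simp
    · have han : AnalyticAt ℂ (fun z => f 0 0 z * f 1 1 z - f 0 1 z * f 1 0 z) μ :=
        (((hp 0 0).analyticAt.fun_mul (hp 1 1).analyticAt).fun_sub
          ((hp 0 1).analyticAt.fun_mul (hp 1 0).analyticAt))
      have := han.analyticOrderAt_eq_zero.1 (by simpa using hm)
      have hc : ∀ i j, (p i j).coeff 0 = f i j μ := fun i j => (hp i j).coeff_zero _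
      simpa [hc] using this
  | succ m ih =>
    have hc : ∀ i j, (p i j).coeff 0 = f i j μ := fun i j => (hp i j).coeff_zero _
    -- The case in which the columns at μ satisfy f₀ + s f₁ = 0. Column reduction lowers the order
    -- of the determinant and the dimension of the kernel by one each.
    have main : ∀ (f : Fin 2 → Fin 2 → ℂ → ℂ)
        (p : Fin 2 → Fin 2 → FormalMultilinearSeries ℂ ℂ ℂ)
        (_ : ∀ i j, HasFPowerSeriesAt (f i j) (p i j) μ)
        (_ : analyticOrderAt (fun z => f 0 0 z * f 1 1 z - f 0 1 z * f 1 0 z) μ = (m + 1 : ℕ))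
        (s : ℂ) (_ : ∀ i, f i 0 μ + s * f i 1 μ = 0),
        Module.rank ℂ (LinearMap.ker (matAct fun i j => (p i j).coeff)) = (m + 1 : ℕ) := by
      intro f p hp hm s hs
      have hcf : ∀ i j, (p i j).coeff 0 = f i j μ := fun i j => (hp i j).coeff_zero _
      have hg : ∀ i, HasFPowerSeriesAt (fun z => f i 0 z + s * f i 1 z) (p i 0 + s • p i 1) μ :=
        fun i => (hp i 0).add ((hp i 1).const_smul (c := s))
      have hh := fun i => (hg i).has_fpower_series_dslope_fslope
      let f' : Fin 2 → Fin 2 → ℂ → ℂ := fun i =>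
        ![dslope (fun z => f i 0 z + s * f i 1 z) μ, f i 1]
      let p' : Fin 2 → Fin 2 → FormalMultilinearSeries ℂ ℂ ℂ := fun i =>
        ![(p i 0 + s • p i 1).fslope, p i 1]
      have hp' : ∀ i j, HasFPowerSeriesAt (f' i j) (p' i j) μ := by
        intro i j
        fin_cases j
        · exact hh i
        · exact hp i 1
      have hdet : ∀ z, f 0 0 z * f 1 1 z - f 0 1 z * f 1 0 z =
          (z - μ) * (f' 0 0 z * f' 1 1 z - f' 0 1 z * f' 1 0 z) := by
        intro z
        have e : ∀ i, (z - μ) * f' i 0 z = f i 0 z + s * f i 1 z := by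
          intro i
          have := sub_smul_dslope (fun z => f i 0 z + s * f i 1 z) μ z
          simp only [hs i, sub_zero, smul_eq_mul] at this
          exact this
        have e0 := e 0
        have e1 := e 1
        have e2 : f' 1 1 z = f 1 1 z := rfl
        have e3 : f' 0 1 z = f 0 1 z := rfl
        rw [e2, e3]
        linear_combination -f 1 1 z * e0 + f 0 1 z * e1
      have hm' : analyticOrderAt (fun z => f' 0 0 z * f' 1 1 z - f' 0 1 z * f' 1 0 z) μ = m := by
        have han : AnalyticAt ℂ (fun z => f' 0 0 z * f' 1 1 z - f' 0 1 z * f' 1 0 z) μ :=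
          (((hp' 0 0).analyticAt.fun_mul (hp' 1 1).analyticAt).fun_sub
            ((hp' 0 1).analyticAt.fun_mul (hp' 1 0).analyticAt))
        have hid : AnalyticAt ℂ (fun z : ℂ => z - μ) μ := by fun_prop
        have h1 : analyticOrderAt (fun z : ℂ => z - μ) μ = 1 := by
          have := hid.analyticOrderAt_eq_natCast (n := 1)
          exact_mod_cast this.2 ⟨fun _ => 1, analyticAt_const, one_ne_zero, by simp⟩
        have h2 := analyticOrderAt_mul hid han
        have h3 : (fun z : ℂ => z - μ) * (fun z => f' 0 0 z * f' 1 1 z - f' 0 1 z * f' 1 0 z) =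
            fun z => f 0 0 z * f 1 1 z - f 0 1 z * f 1 0 z := by
          ext z
          exact (hdet z).symm
        rw [h3, hm, h1, Nat.cast_add, Nat.cast_one, add_comm] at h2
        exact (ENat.add_right_injective_of_ne_top ENat.one_ne_top h2).symm
      have hr := rank_ker_matAct_reduce (c := fun i j => (p i j).coeff)
        (d := fun i j => (p' i j).coeff) (s := s) (fun i => by simp only [hcf, hs i])
        (fun i n => by
          change ((p i 0 + s • p i 1).fslope).coeff n = _
          rw [coeff_fslope]
          rfl)
        (fun i => rfl)
      rw [hr, ih f' p' hp' hm']
      norm_cast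
    have hdet0 : f 0 0 μ * f 1 1 μ - f 0 1 μ * f 1 0 μ = 0 := by
      by_contra hne
      have han : AnalyticAt ℂ (fun z => f 0 0 z * f 1 1 z - f 0 1 z * f 1 0 z) μ :=
        (((hp 0 0).analyticAt.fun_mul (hp 1 1).analyticAt).fun_sub
          ((hp 0 1).analyticAt.fun_mul (hp 1 0).analyticAt))
      rw [han.analyticOrderAt_eq_zero.2 hne] at hm
      exact absurd hm.symm (by norm_cast)
    -- The determinant vanishes at μ, so either the second column is zero there (the columns are
    -- swapped and s = 0), or the first is a multiple of the second.
    by_cases hcol : ∀ i, f i 1 μ = 0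
    · rw [rank_ker_matAct_swap]
      refine main (fun i j => f i (1 - j)) (fun i j => p i (1 - j)) (fun i j => hp i (1 - j)) ?_ 0 ?_
      · rw [← hm]
        have : (fun z => f 0 (1 - 0) z * f 1 (1 - 1) z - f 0 (1 - 1) z * f 1 (1 - 0) z) =
            -(fun z => f 0 0 z * f 1 1 z - f 0 1 z * f 1 0 z) := by
          ext z
          simp
        rw [this, analyticOrderAt_neg]
      · intro i
        simp [hcol i]
    · push Not at hcol
      obtain ⟨k, hk⟩ := hcol
      refine main f p hp hm (-(f k 0 μ / f k 1 μ)) fun i => ?_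
      field_simp
      fin_cases k <;> fin_cases i <;> simp at hk ⊢ <;> first | linear_combination hdet0 | linear_combination -hdet0

end LocalAlgebra


/-! ### Root subspaces and the order of zeros of the characteristic determinant. -/

section RootSubspace

theorem memLp_ext (y : CPi) :
    MemLp (fun x => (WithLp.toLp 2 (ext y x) : EuclideanSpace ℂ (Fin 2))) 2 muPi := by
  have hc : Continuous fun x => (WithLp.toLp 2 (ext y x) : EuclideanSpace ℂ (Fin 2)) :=
    (PiLp.continuous_toLp 2 _).comp (continuous_ext y)
  obtain ⟨C, hC⟩ := (isCompact_Icc (a := (0 : ℝ)) (b := π)).exists_bound_of_continuousOn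
    hc.continuousOn
  refine MemLp.of_bound hc.aestronglyMeasurable C ?_
  filter_upwards [ae_mem_Ioo] with x hx using hC x (Set.Ioo_subset_Icc_self hx)

/-- The class in `H` of a continuous function. -/
noncomputable def toH : CPi →ₗ[ℂ] H where
  toFun y := (memLp_ext y).toLp _
  map_add' _ _ := rfl
  map_smul' _ _ := rfl

theorem toH_ae (y : CPi) : ∀ᵐ x ∂muPi, (toH y x).ofLp = ext y x := by
  filter_upwards [(memLp_ext y).coeFn_toLp] with x hx
  change ((memLp_ext y).toLp _ x).ofLp = _
  rw [hx]

theorem ext_ae_injective {y z : CPi} (h : ∀ᵐ x ∂muPi, ext y x = ext z x) : y = z := by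
  have h2 := Measure.eqOn_Icc_of_ae_eq (μ := volume) Real.pi_pos.ne h
    (continuous_ext y).continuousOn (continuous_ext z).continuousOn
  ext1 x
  have := h2 x.2
  rwa [ext_of_mem y x.2, ext_of_mem z x.2] at this

theorem toH_injective : Function.Injective toH := by
  intro y z h
  refine ext_ae_injective ?_
  filter_upwards [toH_ae y, toH_ae z] with x hy hz
  rw [← hy, ← hz, h]

/-- The boundary form on continuous functions. -/
noncomputable def bdry (U : Matrix (Fin 2) (Fin 4) ℂ) : CPi →ₗ[ℂ] (Fin 2 → ℂ) where
  toFun y := boundaryForm U (ext y)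
  map_add' y z := by
    simp only [boundaryForm, ext_add, Pi.add_apply, Matrix.mulVec_add]
    abel
  map_smul' c y := by
    simp only [boundaryForm, ext_smul, Pi.smul_apply, Matrix.mulVec_smul, smul_add,
      RingHom.id_apply]

theorem continuous_bdry (U : Matrix (Fin 2) (Fin 4) ℂ) : Continuous (bdry U) := by
  have h : ∀ x ∈ Set.Icc 0 π, Continuous fun y : CPi => ext y x := by
    intro x hx
    simp only [ext_of_mem _ hx]
    exact continuous_eval_const _
  exact (Continuous.matrix_mulVec continuous_const (h 0 zero_mem_Icc_pi)).add
    (Continuous.matrix_mulVec continuous_const (h π pi_mem_Icc_pi))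

variable {Q : ℝ → Matrix (Fin 2) (Fin 2) ℂ} (hQ : EntryIntegrable Q)

theorem B_mulVec_B (v : Fin 2 → ℂ) : B *ᵥ (B *ᵥ v) = -v := by
  ext i
  fin_cases i <;> simp [B, Matrix.mulVec, dotProduct]

theorem coefA_mulVec (z : ℂ) (t : ℝ) (v : Fin 2 → ℂ) :
    coefA Q z t *ᵥ v = B *ᵥ (z • v - Q t *ᵥ v) := by
  rw [coefA, ← Matrix.mulVec_mulVec, Matrix.sub_mulVec, Matrix.smul_mulVec, Matrix.one_mulVec]

/-- The relation is (ℓ - μ)f = z. Since B² = -1, it is the Cauchy problem y' = B(μ - Q)y + Bz; its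
solutions are parametrized by a = y(0), and only the boundary condition remains. -/
theorem inDiracGraph_iff (U : Matrix (Fin 2) (Fin 4) ℂ) (μ : ℂ) (f : H) (z : CPi) :
    InDiracGraph Q U f (toH z + μ • f) ↔
      ∃ a, f = toH (solY hQ μ a + opT hQ μ z) ∧ bdry U (solY hQ μ a + opT hQ μ z) = 0 := by
  have hg : ∀ᵐ x ∂muPi, ((toH z + μ • f) x).ofLp = ext z x + μ • (f x).ofLp := by
    filter_upwards [Lp.coeFn_add (toH z) (μ • f), Lp.coeFn_smul μ f, toH_ae z] with x h1 h2 h3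
    simp only [h1, Pi.add_apply, WithLp.ofLp_add, h2, h3, Pi.smul_apply, WithLp.ofLp_smul]
  constructor
  · rintro ⟨y, d, ⟨hd, hy⟩, hU, hf, hfg⟩
    have hP : IsPrim y d := ⟨hd, hy⟩
    let y' : CPi := ⟨(Set.Icc 0 π).domRestrict y,
      continuousOn_iff_continuous_domRestrict.1 hP.continuousOn⟩
    have hy' : ∀ x ∈ Set.Icc 0 π, ext y' x = y x := fun x hx => ext_of_mem y' hx
    have hd' : ∀ᵐ x ∂muPi, d x = coefA Q μ x *ᵥ ext y' x + B *ᵥ ext z x := by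
      filter_upwards [hg, hf, hfg, ae_mem_Ioo] with x h1 h2 h3 hx
      rw [h1, h2] at h3
      rw [hy' x (Set.Ioo_subset_Icc_self hx), coefA_mulVec, ← Matrix.mulVec_add,
        show μ • y x - Q x *ᵥ y x + ext z x = -(B *ᵥ d x) by
          rw [eq_sub_of_add_eq h3.symm]; abel, Matrix.mulVec_neg, B_mulVec_B, neg_neg]
    have hsol : y' = ContinuousMap.const _ (y 0) + opK hQ μ y' + opB z := by
      ext1 x
      simp only [ContinuousMap.add_apply, ContinuousMap.const_apply, opK, opB, volterra_apply]
      rw [add_assoc, ← intervalIntegral.integral_add, ← integral_congr_muPi hd' x.2]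
      · exact hy x x.2
      · exact intervalIntegrable_of_muPi ((entryIntegrable_coefA hQ μ).mulVec
          (continuous_ext y').continuousOn) zero_mem_Icc_pi x.2
      · exact intervalIntegrable_of_muPi (entryIntegrable_B.mulVec
          (continuous_ext z).continuousOn) zero_mem_Icc_pi x.2
    refine ⟨y 0, ?_, ?_⟩
    · rw [← eq_solY_add_opT hQ hsol]
      refine Lp.ext ?_
      filter_upwards [hf, toH_ae y', ae_mem_Ioo] with x h1 h2 hx
      refine WithLp.ofLp_injective 2 ?_
      rw [h1, h2, hy' x (Set.Ioo_subset_Icc_self hx)]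
    · rw [← eq_solY_add_opT hQ hsol]
      change boundaryForm U (ext y') = 0
      rw [← hU, boundaryForm, boundaryForm, hy' 0 zero_mem_Icc_pi, hy' π pi_mem_Icc_pi]
  · rintro ⟨a, rfl, hU⟩
    set y := solY hQ μ a + opT hQ μ z with hy
    have hsol : y = ContinuousMap.const _ a + (opK hQ μ y + opB z) := by
      rw [hy, map_add]
      conv_lhs => rw [solY_eq, opT_eq]
      abel
    have hKi := (entryIntegrable_coefA hQ μ).mulVec (continuous_ext y).continuousOn
    have hBi := entryIntegrable_B.mulVec (continuous_ext z).continuousOn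
    refine ⟨ext y, fun x => coefA Q μ x *ᵥ ext y x + B *ᵥ ext z x, ⟨hKi.add hBi, ?_⟩, hU,
      toH_ae y, ?_⟩
    · intro x hx
      have h0 : ext y 0 = a := by
        rw [ext_of_mem y zero_mem_Icc_pi, hsol]
        simp [opK, opB, volterra_zero]
      have h1 := congrArg (fun g : CPi => g ⟨x, hx⟩) hsol
      simp only [ContinuousMap.add_apply, ContinuousMap.const_apply, opK, opB,
        volterra_apply] at h1
      rw [h0, ext_of_mem y hx, h1, intervalIntegral.integral_add
        (intervalIntegrable_of_muPi hKi zero_mem_Icc_pi hx)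
        (intervalIntegrable_of_muPi hBi zero_mem_Icc_pi hx)]
    · filter_upwards [hg, toH_ae y] with x h1 h2
      rw [h1, h2, Matrix.mulVec_add, coefA_mulVec, B_mulVec_B, B_mulVec_B]
      abel

theorem mem_kerPow_succ (U : Matrix (Fin 2) (Fin 4) ℂ) (μ : ℂ) (k : ℕ) (f : H) :
    f ∈ kerPow (diracOperator Q U) μ (k + 1) ↔
      ∃ g ∈ kerPow (diracOperator Q U) μ k, InDiracGraph Q U f (g + μ • f) := by
  simp only [kerPow, Submodule.mem_map, Submodule.mem_comap]
  constructor
  · rintro ⟨x, hx, rfl⟩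
    refine ⟨_, hx, ?_⟩
    rw [← mem_graph_diracOperator, LinearPMap.mem_graph_iff]
    exact ⟨x, rfl, by simp⟩
  · rintro ⟨g, hg, hfg⟩
    rw [← mem_graph_diracOperator, LinearPMap.mem_graph_iff] at hfg
    obtain ⟨x, hx, hxg⟩ := hfg
    refine ⟨x, ?_, hx⟩
    have : ((diracOperator Q U).toFun - μ • (diracOperator Q U).domain.subtype) x = g := by
      change (diracOperator Q U) x - μ • (x : H) = g
      have hx' : (x : H) = f := hx
      rw [hxg, hx']
      exact add_sub_cancel_right _ _
    rwa [this]

/-- The sum of the chain `∑ Tⁿ Y aₙ`. -/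
noncomputable def chainSum (μ : ℂ) : (ℕ →₀ ℂ) × (ℕ →₀ ℂ) →ₗ[ℂ] CPi :=
  (Finsupp.linearCombination ℂ fun n => (opT hQ μ ^ n) (solY hQ μ ![1, 0])).coprod
    (Finsupp.linearCombination ℂ fun n => (opT hQ μ ^ n) (solY hQ μ ![0, 1]))

/-- The boundary values of the terms of a chain. -/
noncomputable def chainCoef (U : Matrix (Fin 2) (Fin 4) ℂ) (μ : ℂ) (i j : Fin 2) (n : ℕ) : ℂ :=
  bdry U ((opT hQ μ ^ n) (solY hQ μ (![![1, 0], ![0, 1]] j))) i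

/-- Horner's step for ∑ aₙ Tⁿ v: the zeroth term is split off and one T is factored out of the rest.
-/
theorem linearCombination_eq_zero_add {M : Type*} [AddCommGroup M] [Module ℂ M] (T : M →ₗ[ℂ] M)
    (v : ℕ → M) (hv : ∀ n, v (n + 1) = T (v n)) (a : ℕ →₀ ℂ) :
    Finsupp.linearCombination ℂ v a =
      a 0 • v 0 + T (Finsupp.linearCombination ℂ v (bshift a)) := by
  have h : Finsupp.linearCombination ℂ v = (LinearMap.toSpanSingleton ℂ M (v 0)) ∘ₗ
      Finsupp.lapply 0 + T ∘ₗ Finsupp.linearCombination ℂ v ∘ₗ bshift := by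
    refine Finsupp.lhom_ext fun n x => ?_
    cases n with
    | zero =>
      have : bshift (Finsupp.single 0 x) = 0 := by
        ext m
        simp [bshift_apply]
      simp [this]
    | succ n =>
      have : bshift (Finsupp.single (n + 1) x) = Finsupp.single n x := by
        ext m
        simp [bshift_apply, Finsupp.single_apply]
      simp [this, hv]
  conv_lhs => rw [h]
  simp

theorem chainSum_eq (μ : ℂ) (a : (ℕ →₀ ℂ) × (ℕ →₀ ℂ)) :
    chainSum hQ μ a = solY hQ μ ![a.1 0, a.2 0] +
      opT hQ μ (chainSum hQ μ (bshift a.1, bshift a.2)) := by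
  have h := fun v : Fin 2 → ℂ => linearCombination_eq_zero_add (opT hQ μ).toLinearMap
    (fun n => (opT hQ μ ^ n) (solY hQ μ v)) (fun n => by rw [pow_succ']; rfl)
  have h1 : (![a.1 0, a.2 0] : Fin 2 → ℂ) = a.1 0 • ![1, 0] + a.2 0 • ![0, 1] := by
    ext i
    fin_cases i <;> simp
  simp only [chainSum, LinearMap.coprod_apply]
  rw [h ![1, 0] a.1, h ![0, 1] a.2, h1]
  simp only [map_add, map_smul, pow_zero, one_apply_eq_self, ContinuousLinearMap.coe_coe]
  abel

/-- Values of `opT` vanish at 0, so evaluation at 0 recovers the zeroth coefficients. Once these are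
zero, injectivity of `opT` allows passing to the shifted sequence. -/
theorem chainSum_injective (μ : ℂ) : Function.Injective (chainSum hQ μ) := by
  rw [injective_iff_map_eq_zero]
  have key : ∀ n : ℕ, ∀ a : (ℕ →₀ ℂ) × (ℕ →₀ ℂ), chainSum hQ μ a = 0 → a.1 n = 0 ∧ a.2 n = 0 := by
    intro n
    induction n with
    | zero =>
      intro a ha
      have h := congrArg (fun g : CPi => g ⟨0, zero_mem_Icc_pi⟩) (chainSum_eq hQ μ a)
      simp only [ha, ContinuousMap.zero_apply, ContinuousMap.add_apply, solY_zero, opT_zero,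
        add_zero] at h
      exact ⟨(congrFun h 0).symm, (congrFun h 1).symm⟩
    | succ n ih =>
      intro a ha
      have h0 : solY hQ μ ![a.1 0, a.2 0] = 0 := by
        have h := congrArg (fun g : CPi => g ⟨0, zero_mem_Icc_pi⟩) (chainSum_eq hQ μ a)
        simp only [ha, ContinuousMap.zero_apply, ContinuousMap.add_apply, solY_zero, opT_zero,
          add_zero] at h
        rw [← h]
        exact map_zero _
      have h1 := chainSum_eq hQ μ a
      rw [ha, h0, zero_add] at h1
      exact ih _ ((injective_iff_map_eq_zero _).1 (opT_injective hQ μ) _ h1.symm)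
  exact fun a ha => Prod.ext_iff.2 ⟨Finsupp.ext fun n => (key n a ha).1,
    Finsupp.ext fun n => (key n a ha).2⟩

theorem act_zero_index (c : ℕ → ℂ) (a : ℕ →₀ ℂ) : act c a 0 = Finsupp.linearCombination ℂ c a := by
  simp [act_apply, Finsupp.linearCombination_apply, Finsupp.sum]

theorem act_succ_index (c : ℕ → ℂ) (a : ℕ →₀ ℂ) (l : ℕ) :
    act c a (l + 1) = act c (bshift a) l := by
  have h : LinearMap.proj (l + 1) ∘ₗ act c = LinearMap.proj l ∘ₗ act c ∘ₗ bshift := by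
    refine Finsupp.lhom_ext fun n x => ?_
    simp only [LinearMap.comp_apply, LinearMap.proj_apply]
    cases n with
    | zero =>
      have : bshift (Finsupp.single 0 x) = 0 := by
        ext m
        simp [bshift_apply]
      simp [this, act_single]
    | succ n =>
      have : bshift (Finsupp.single (n + 1) x) = Finsupp.single n x := by
        ext m
        simp [bshift_apply, Finsupp.single_apply]
      simp [this, act_single]
  exact congrArg (fun g : (ℕ →₀ ℂ) →ₗ[ℂ] ℂ => g a) h

/-- Component 0 of the action is the boundary form of the chain, and the later components are those
of the shifted chain. Hence the kernel consists of the chains all of whose shifts satisfy the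
boundary conditions. -/
theorem matAct_eq_zero_iff (U : Matrix (Fin 2) (Fin 4) ℂ) (μ : ℂ) (a : (ℕ →₀ ℂ) × (ℕ →₀ ℂ)) :
    matAct (chainCoef hQ U μ) a = 0 ↔ bdry U (chainSum hQ μ a) = 0 ∧
      matAct (chainCoef hQ U μ) (bshift a.1, bshift a.2) = 0 := by
  have h0 : ∀ i, act (chainCoef hQ U μ i 0) a.1 0 + act (chainCoef hQ U μ i 1) a.2 0 =
      bdry U (chainSum hQ μ a) i := by
    intro i
    rw [act_zero_index, act_zero_index]
    simp only [chainSum, LinearMap.coprod_apply, map_add, Pi.add_apply]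
    have : ∀ (j : Fin 2) (b : ℕ →₀ ℂ), Finsupp.linearCombination ℂ (chainCoef hQ U μ i j) b =
        bdry U (Finsupp.linearCombination ℂ (fun n => (opT hQ μ ^ n)
          (solY hQ μ (![![1, 0], ![0, 1]] j))) b) i := by
      intro j b
      have := Finsupp.apply_linearCombination ℂ (LinearMap.proj i ∘ₗ bdry U)
        (fun n => (opT hQ μ ^ n) (solY hQ μ (![![1, 0], ![0, 1]] j))) b
      exact this.symm
    rw [this 0, this 1]
    rfl
  simp only [matAct_apply, Prod.mk_eq_zero]
  constructor
  · rintro ⟨e0, e1⟩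
    refine ⟨?_, ?_, ?_⟩
    · ext i
      rw [← h0]
      fin_cases i
      · exact congrFun e0 0
      · exact congrFun e1 0
    · ext l
      have := congrFun e0 (l + 1)
      simpa only [Pi.add_apply, Pi.zero_apply, act_succ_index] using this
    · ext l
      have := congrFun e1 (l + 1)
      simpa only [Pi.add_apply, Pi.zero_apply, act_succ_index] using this
  · rintro ⟨hb, e0, e1⟩
    constructor
    · ext l
      cases l with
      | zero => rw [Pi.add_apply, h0, hb]; rfl
      | succ l => simpa only [Pi.add_apply, Pi.zero_apply, act_succ_index] using congrFun e0 l
    · ext l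
      cases l with
      | zero => rw [Pi.add_apply, h0, hb]; rfl
      | succ l => simpa only [Pi.add_apply, Pi.zero_apply, act_succ_index] using congrFun e1 l

/-- Prepend a value to a finitely supported sequence. -/
noncomputable def consSeq (x : ℂ) (a : ℕ →₀ ℂ) : ℕ →₀ ℂ :=
  Finsupp.single 0 x + a.mapDomain (fun n => n + 1)

theorem consSeq_zero (x : ℂ) (a : ℕ →₀ ℂ) : consSeq x a 0 = x := by
  rw [consSeq, Finsupp.add_apply, Finsupp.single_eq_same, Finsupp.mapDomain_of_notMem_range, add_zero]
  simp

theorem consSeq_succ (x : ℂ) (a : ℕ →₀ ℂ) (n : ℕ) : consSeq x a (n + 1) = a n := by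
  rw [consSeq, Finsupp.add_apply, Finsupp.single_eq_of_ne (by simp), zero_add]
  exact Finsupp.mapDomain_apply (add_left_injective 1) a n

theorem bshift_consSeq (x : ℂ) (a : ℕ →₀ ℂ) : bshift (consSeq x a) = a := by
  ext n
  rw [bshift_apply, consSeq_succ]

/-- Applying ℓ - μ to Y a₀ + T x leaves x: it removes the zeroth term of a chain and shifts the
others. Solving (L - μ)f = g prepends one term, so the power k bounds the length of the chain. -/
theorem mem_kerPow_iff (U : Matrix (Fin 2) (Fin 4) ℂ) (μ : ℂ) (k : ℕ) (f : H) :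
    f ∈ kerPow (diracOperator Q U) μ k ↔
      ∃ a : (ℕ →₀ ℂ) × (ℕ →₀ ℂ), (∀ n, k ≤ n → a.1 n = 0 ∧ a.2 n = 0) ∧
        matAct (chainCoef hQ U μ) a = 0 ∧ f = toH (chainSum hQ μ a) := by
  induction k generalizing f with
  | zero =>
    rw [kerPow, Submodule.mem_bot]
    constructor
    · rintro rfl
      exact ⟨0, fun n _ => ⟨rfl, rfl⟩, map_zero _, by simp⟩
    · rintro ⟨a, ha, -, rfl⟩
      have : a = 0 := Prod.ext_iff.2 ⟨Finsupp.ext fun n => (ha n n.zero_le).1,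
        Finsupp.ext fun n => (ha n n.zero_le).2⟩
      simp [this]
  | succ k ih =>
    rw [mem_kerPow_succ]
    constructor
    · rintro ⟨g, hg, hfg⟩
      obtain ⟨a, ha, hm, rfl⟩ := (ih g).1 hg
      obtain ⟨v, hv, hb⟩ := (inDiracGraph_iff hQ U μ f _).1 hfg
      have hc : chainSum hQ μ (consSeq (v 0) a.1, consSeq (v 1) a.2) =
          solY hQ μ v + opT hQ μ (chainSum hQ μ a) := by
        rw [chainSum_eq]
        simp only [consSeq_zero, bshift_consSeq]
        congr 2
        ext i
        fin_cases i <;> rfl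
      refine ⟨(consSeq (v 0) a.1, consSeq (v 1) a.2), ?_, ?_, ?_⟩
      · intro n hn
        obtain ⟨n, rfl⟩ := Nat.exists_eq_succ_of_ne_zero (by omega : n ≠ 0)
        simp only [Nat.succ_eq_add_one, consSeq_succ]
        exact ha n (by omega)
      · rw [matAct_eq_zero_iff, hc]
        simp only [bshift_consSeq]
        exact ⟨hb, hm⟩
      · rw [hc, hv]
    · rintro ⟨a, ha, hm, rfl⟩
      rw [matAct_eq_zero_iff] at hm
      refine ⟨toH (chainSum hQ μ (bshift a.1, bshift a.2)), (ih _).2 ⟨_, ?_, hm.2, rfl⟩, ?_⟩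
      · exact fun n hn => ha (n + 1) (by omega)
      · refine (inDiracGraph_iff hQ U μ _ _).2 ⟨![a.1 0, a.2 0], ?_, ?_⟩
        · rw [← chainSum_eq]
        · rw [← chainSum_eq]
          exact hm.1

theorem rootSubspace_eq_map (U : Matrix (Fin 2) (Fin 4) ℂ) (μ : ℂ) :
    rootSubspace (diracOperator Q U) μ =
      (LinearMap.ker (matAct (chainCoef hQ U μ))).map (toH ∘ₗ chainSum hQ μ) := by
  refine le_antisymm (iSup_le fun k f hf => ?_) ?_
  · obtain ⟨a, -, hm, rfl⟩ := (mem_kerPow_iff hQ U μ k f).1 hf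
    exact ⟨a, hm, rfl⟩
  · rintro _ ⟨a, hm, rfl⟩
    obtain ⟨N, hN⟩ := (a.1.support ∪ a.2.support).exists_nat_subset_range
    refine Submodule.mem_iSup_of_mem N ((mem_kerPow_iff hQ U μ N _).2 ⟨a, fun n hn => ?_, hm, rfl⟩)
    have : n ∉ a.1.support ∪ a.2.support := fun h => by
      have := Finset.mem_range.1 (hN h)
      omega
    simpa using this

/-- The matrix of boundary values of the fundamental system. -/
noncomputable def charMat (U : Matrix (Fin 2) (Fin 4) ℂ) (i j : Fin 2) (z : ℂ) : ℂ :=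
  bdry U (solY hQ z (![![1, 0], ![0, 1]] j)) i

/-- The characteristic determinant of `L_{Q,U}`. -/
noncomputable def charDet (U : Matrix (Fin 2) (Fin 4) ℂ) (z : ℂ) : ℂ :=
  charMat hQ U 0 0 z * charMat hQ U 1 1 z - charMat hQ U 0 1 z * charMat hQ U 1 0 z

/-- The boundary form is linear and continuous, so it may be applied termwise to the expansion of
the solution. This identifies the algebraic coefficients `chainCoef` with Taylor coefficients. -/
theorem hasFPowerSeriesAt_charMat (U : Matrix (Fin 2) (Fin 4) ℂ) (μ : ℂ) (i j : Fin 2) :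
    HasFPowerSeriesAt (charMat hQ U i j)
      (FormalMultilinearSeries.ofScalars ℂ (chainCoef hQ U μ i j)) μ := by
  rw [hasFPowerSeriesAt_iff]
  filter_upwards [hasSum_solY hQ μ (![![1, 0], ![0, 1]] j)] with w hw
  have h1 := hw.map (LinearMap.proj (R := ℂ) (φ := fun _ : Fin 2 => ℂ) i ∘ₗ bdry U)
    ((continuous_apply i).comp (continuous_bdry U))
  convert! h1 using 2 with n
  rw [FormalMultilinearSeries.coeff_ofScalars, Function.comp_apply, map_smul]
  rfl

theorem analyticAt_charDet (U : Matrix (Fin 2) (Fin 4) ℂ) (μ : ℂ) :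
    AnalyticAt ℂ (charDet hQ U) μ :=
  have h := fun i j => (hasFPowerSeriesAt_charMat hQ U μ i j).analyticAt
  ((h 0 0).fun_mul (h 1 1)).fun_sub ((h 0 1).fun_mul (h 1 0))

/-- The algebraic multiplicity of an eigenvalue is its order as a zero of the characteristic
determinant. -/
theorem rank_rootSubspace (U : Matrix (Fin 2) (Fin 4) ℂ) {μ : ℂ} {m : ℕ}
    (hm : analyticOrderAt (charDet hQ U) μ = m) :
    Module.rank ℂ (rootSubspace (diracOperator Q U) μ) = m := by
  have h := rank_ker_matAct m (charMat hQ U) _ (hasFPowerSeriesAt_charMat hQ U μ) hm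
  have h2 : (fun i j => (FormalMultilinearSeries.ofScalars ℂ (chainCoef hQ U μ i j)).coeff) =
      chainCoef hQ U μ := by
    ext i j n
    exact FormalMultilinearSeries.coeff_ofScalars
  rw [h2] at h
  rw [rootSubspace_eq_map hQ, ← h]
  have hinj : Function.Injective (toH ∘ₗ chainSum hQ μ) :=
    toH_injective.comp (chainSum_injective hQ μ)
  have := (Submodule.equivMapOfInjective _ hinj
    (LinearMap.ker (matAct (chainCoef hQ U μ)))).lift_rank_eq
  simpa only [Cardinal.lift_id] using this.symm

end RootSubspace


/-! ### A priori estimates for the diagonalized system. -/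

section DiracSystem

/-- The Dirac system in the coordinates in which the free system is trivial. -/
structure DiracSys (a b : ℝ → ℂ) (z : ℂ) (ξ η : ℝ → ℂ) : Prop where
  fst : IsPrim ξ fun x => a x * Complex.exp (-(2 * Complex.I * z) * x) * η x
  snd : IsPrim η fun x => b x * Complex.exp (2 * Complex.I * z * x) * ξ x

variable {a b : ℝ → ℂ} {z : ℂ} {ξ η : ℝ → ℂ}

/-- This symmetry gives every estimate of η from one of ξ, and the upper half-plane from the lower
one. -/
theorem DiracSys.swap (h : DiracSys a b z ξ η) : DiracSys b a (-z) η ξ :=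
  ⟨h.snd.congr (fun _ _ => rfl) (Eventually.of_forall fun x => by
    rw [show -(2 * Complex.I * -z) * (x : ℂ) = 2 * Complex.I * z * x by ring]),
   h.fst.congr (fun _ _ => rfl) (Eventually.of_forall fun x => by
    rw [show 2 * Complex.I * -z * (x : ℂ) = -(2 * Complex.I * z) * x by ring])⟩

theorem norm_exp_two_I (z : ℂ) (x : ℝ) :
    ‖Complex.exp (2 * Complex.I * z * x)‖ = Real.exp (-(2 * z.im * x)) := by
  rw [Complex.norm_exp]
  simp

theorem norm_exp_neg_two_I (z : ℂ) (x : ℝ) :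
    ‖Complex.exp (-(2 * Complex.I * z) * x)‖ = Real.exp (2 * z.im * x) := by
  rw [Complex.norm_exp]
  simp

theorem norm_exp_le_of_abs_im_le {z : ℂ} {h : ℝ} (hz : |z.im| ≤ h) {x : ℝ}
    (hx : x ∈ Set.Icc 0 π) : ‖Complex.exp (2 * Complex.I * z * x)‖ ≤ Real.exp (2 * h * π) ∧
      ‖Complex.exp (-(2 * Complex.I * z) * x)‖ ≤ Real.exp (2 * h * π) := by
  rw [norm_exp_two_I, norm_exp_neg_two_I]
  have h1 := abs_le.1 hz
  have h2 : |z.im * x| ≤ h * π := by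
    rw [abs_mul, abs_of_nonneg hx.1]
    exact mul_le_mul hz hx.2 hx.1 ((abs_nonneg _).trans hz)
  have h3 := abs_le.1 h2
  constructor <;> apply Real.exp_le_exp.2 <;> linarith

theorem continuous_cexp_mul (c : ℂ) : Continuous fun x : ℝ => Complex.exp (c * x) := by fun_prop

/-- Grönwall's inequality for ‖ξ‖ + ‖η‖; in the strip each exponential costs at most exp(2rπ). -/
theorem DiracSys.bound (h : DiracSys a b z ξ η) (ha : Integrable a muPi) (hb : Integrable b muPi)
    {r : ℝ} (hz : |z.im| ≤ r) {x : ℝ} (hx : x ∈ Set.Icc 0 π) :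
    ‖ξ x‖ + ‖η x‖ ≤ (‖ξ 0‖ + ‖η 0‖) *
      Real.exp (Real.exp (2 * r * π) * ∫ t, (‖a t‖ + ‖b t‖) ∂muPi) := by
  have hk : Integrable (fun t => Real.exp (2 * r * π) * (‖a t‖ + ‖b t‖)) muPi :=
    (ha.norm.add hb.norm).const_mul _
  have hk0 : ∀ t, 0 ≤ Real.exp (2 * r * π) * (‖a t‖ + ‖b t‖) := fun t => by positivity
  have hc : ContinuousOn (fun x => ‖ξ x‖ + ‖η x‖) (Set.Icc 0 π) :=
    h.fst.continuousOn.norm.add h.snd.continuousOn.norm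
  have hg := gronwall_of_integrable (C := ‖ξ 0‖ + ‖η 0‖) hk (Eventually.of_forall hk0) hc
    (fun y hy => ?_) x hx
  · refine hg.trans ?_
    gcongr
    refine (integral_le_muPi hk (Eventually.of_forall hk0) hx).trans ?_
    rw [integral_const_mul]
  · have e1 : Integrable (fun t => Real.exp (2 * r * π) * ‖a t‖ * ‖η t‖) muPi :=
      integrable_mul_of_continuousOn_real (ha.norm.const_mul _) h.snd.continuousOn.norm
    have e2 : Integrable (fun t => Real.exp (2 * r * π) * ‖b t‖ * ‖ξ t‖) muPi :=
      integrable_mul_of_continuousOn_real (hb.norm.const_mul _) h.fst.continuousOn.norm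
    have b1 : ‖ξ y‖ ≤ ‖ξ 0‖ + ∫ t in (0 : ℝ)..y, Real.exp (2 * r * π) * ‖a t‖ * ‖η t‖ := by
      rw [h.fst.eq y hy]
      refine (norm_add_le _ _).trans (add_le_add_right (norm_integral_le_muPi e1 ?_ hy) _)
      filter_upwards [ae_mem_Ioo] with t ht
      have := (norm_exp_le_of_abs_im_le hz (Set.Ioo_subset_Icc_self ht)).2
      rw [norm_mul, norm_mul, mul_comm (Real.exp _)]
      gcongr
    have b2 : ‖η y‖ ≤ ‖η 0‖ + ∫ t in (0 : ℝ)..y, Real.exp (2 * r * π) * ‖b t‖ * ‖ξ t‖ := by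
      rw [h.snd.eq y hy]
      refine (norm_add_le _ _).trans (add_le_add_right (norm_integral_le_muPi e2 ?_ hy) _)
      filter_upwards [ae_mem_Ioo] with t ht
      have := (norm_exp_le_of_abs_im_le hz (Set.Ioo_subset_Icc_self ht)).1
      rw [norm_mul, norm_mul, mul_comm (Real.exp _)]
      gcongr
    have b3 : (∫ t in (0 : ℝ)..y, Real.exp (2 * r * π) * ‖a t‖ * ‖η t‖) +
        ∫ t in (0 : ℝ)..y, Real.exp (2 * r * π) * ‖b t‖ * ‖ξ t‖ ≤
        ∫ t in (0 : ℝ)..y, Real.exp (2 * r * π) * (‖a t‖ + ‖b t‖) * (‖ξ t‖ + ‖η t‖) := by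
      rw [← intervalIntegral.integral_add (intervalIntegrable_of_muPi e1 zero_mem_Icc_pi hy)
        (intervalIntegrable_of_muPi e2 zero_mem_Icc_pi hy)]
      refine intervalIntegral.integral_mono_on hy.1
        (intervalIntegrable_of_muPi (e1.add e2) zero_mem_Icc_pi hy)
        (intervalIntegrable_of_muPi (integrable_mul_of_continuousOn_real hk hc)
          zero_mem_Icc_pi hy) fun t _ => ?_
      have : 0 ≤ Real.exp (2 * r * π) * (‖a t‖ * ‖ξ t‖ + ‖b t‖ * ‖η t‖) := by positivity
      linarith
    linarith

theorem IsPrim.const_of_ae_zero {f d : ℝ → ℂ} (h : IsPrim f d) (hd : ∀ᵐ x ∂muPi, d x = 0) :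
    f π = f 0 := by
  rw [h.eq π pi_mem_Icc_pi, integral_congr_muPi (g := fun _ => 0) hd pi_mem_Icc_pi]
  simp

/-- The determinant of two solutions is constant. -/
theorem DiracSys.wronskian {ξ' η' : ℝ → ℂ} (h : DiracSys a b z ξ η) (h' : DiracSys a b z ξ' η') :
    ξ π * η' π - ξ' π * η π = ξ 0 * η' 0 - ξ' 0 * η 0 := by
  have hP := (h.fst.mul h'.snd).add ((h'.fst.mul h.snd).const_mul (-1))
  have := hP.const_of_ae_zero (Eventually.of_forall fun x => by ring)
  linear_combination this

/-- Estimate of a solution in terms of the primitives of the oscillating coefficients. -/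
theorem DiracSys.strip (h : DiracSys a b z ξ η) (ha : Integrable a muPi) (hb : Integrable b muPi)
    {r : ℝ} (hz : |z.im| ≤ r) {n : ℝ → ℝ} (hn : ContinuousOn n (Set.Icc 0 π))
    (hna : ∀ x ∈ Set.Icc 0 π,
      ‖∫ t in (0 : ℝ)..x, a t * Complex.exp (-(2 * Complex.I * z) * t)‖ ≤ n x) :
    ‖ξ π - ξ 0‖ ≤ (‖ξ 0‖ + ‖η 0‖) *
      Real.exp (Real.exp (2 * r * π) * ∫ t, (‖a t‖ + ‖b t‖) ∂muPi) *
      (n π + Real.exp (2 * r * π) * ∫ t, ‖b t‖ * n t ∂muPi) := by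
  set m := (‖ξ 0‖ + ‖η 0‖) * Real.exp (Real.exp (2 * r * π) * ∫ t, (‖a t‖ + ‖b t‖) ∂muPi)
  have hm0 : 0 ≤ m := by positivity
  have hm : ∀ x ∈ Set.Icc 0 π, ‖ξ x‖ + ‖η x‖ ≤ m := fun x hx => h.bound ha hb hz hx
  have hai : Integrable (fun t => a t * Complex.exp (-(2 * Complex.I * z) * t)) muPi :=
    integrable_mul_of_continuousOn ha (continuous_cexp_mul _).continuousOn
  -- With N the primitive of the oscillating coefficient, ∫ N'η = N(π)η(π) - ∫ Nη'. The increment of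
  -- ξ is thus controlled by the small quantity N instead of the L₁ norm of a.
  have hN := isPrim_integral hai 0
  have hNη := (hN.mul h.snd).eq π pi_mem_Icc_pi
  simp only [zero_add, intervalIntegral.integral_same, zero_mul] at hNη
  have i1 : IntervalIntegrable (fun t => a t * Complex.exp (-(2 * Complex.I * z) * t) * η t)
      volume 0 π := intervalIntegrable_of_muPi h.fst.integrable zero_mem_Icc_pi pi_mem_Icc_pi
  have hNc : ContinuousOn (fun x => ∫ t in (0 : ℝ)..x, a t *
      Complex.exp (-(2 * Complex.I * z) * t)) (Set.Icc 0 π) := by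
    simpa using hN.continuousOn
  have i2m : Integrable (fun x => (∫ t in (0 : ℝ)..x, a t *
      Complex.exp (-(2 * Complex.I * z) * t)) * (b x * Complex.exp (2 * Complex.I * z * x) * ξ x))
      muPi := by
    refine (integrable_mul_of_continuousOn h.snd.integrable hNc).congr
      (Eventually.of_forall fun x => mul_comm _ _)
  rw [intervalIntegral.integral_add i1
    (intervalIntegrable_of_muPi i2m zero_mem_Icc_pi pi_mem_Icc_pi)] at hNη
  have hξ := h.fst.eq π pi_mem_Icc_pi
  have key : ξ π - ξ 0 = (∫ t in (0 : ℝ)..π, a t * Complex.exp (-(2 * Complex.I * z) * t)) * η π -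
      ∫ x in (0 : ℝ)..π, (∫ t in (0 : ℝ)..x, a t * Complex.exp (-(2 * Complex.I * z) * t)) *
        (b x * Complex.exp (2 * Complex.I * z * x) * ξ x) := by
    rw [hξ, hNη]
    ring
  have hbn : Integrable (fun t => ‖b t‖ * n t) muPi :=
    integrable_mul_of_continuousOn_real hb.norm hn
  rw [key]
  refine (norm_sub_le _ _).trans ?_
  rw [mul_add]
  refine add_le_add ?_ ?_
  · rw [norm_mul, mul_comm]
    have h1 : ‖η π‖ ≤ m := (le_add_of_nonneg_left (norm_nonneg _)).trans (hm π pi_mem_Icc_pi)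
    exact mul_le_mul h1 (hna π pi_mem_Icc_pi) (norm_nonneg _) hm0
  · refine (norm_integral_le_muPi (hbn.const_mul (m * Real.exp (2 * r * π))) ?_
      pi_mem_Icc_pi).trans ?_
    · filter_upwards [ae_mem_Ioo] with x hx
      have hx' := Set.Ioo_subset_Icc_self hx
      rw [norm_mul, norm_mul, norm_mul]
      have h1 : ‖ξ x‖ ≤ m := (le_add_of_nonneg_right (norm_nonneg _)).trans (hm x hx')
      have h2 := (norm_exp_le_of_abs_im_le hz hx').1
      have h3 := hna x hx'
      calc _ ≤ n x * (‖b x‖ * Real.exp (2 * r * π) * m) := by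
            gcongr
            exact (norm_nonneg _).trans h3
        _ = _ := by ring
    · rw [intervalIntegral.integral_const_mul, ← integral_muPi, mul_assoc]

/-- The majorant of the off-diagonal component for a large imaginary part. -/
noncomputable def decayMajorant (b : ℝ → ℂ) (τ x : ℝ) : ℝ :=
  Real.exp (-(2 * τ * x)) + ∫ t in (0 : ℝ)..x, Real.exp (-(2 * τ * (x - t))) * ‖b t‖

/-- The bound of the perturbation for a large imaginary part. -/
noncomputable def decayBound (a b : ℝ → ℂ) (τ : ℝ) : ℝ :=
  (∫ x, ‖a x‖ * decayMajorant b τ x ∂muPi) + decayMajorant b τ π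

theorem integrable_exp_mul_norm (hb : Integrable b muPi) (τ x : ℝ) :
    Integrable (fun t => Real.exp (-(2 * τ * (x - t))) * ‖b t‖) muPi := by
  refine (integrable_mul_of_continuousOn_real (f := fun t => Real.exp (-(2 * τ * (x - t))))
    hb.norm (by fun_prop)).congr (Eventually.of_forall fun t => mul_comm _ _)

theorem continuousOn_decayMajorant (hb : Integrable b muPi) (τ : ℝ) :
    ContinuousOn (decayMajorant b τ) (Set.Icc 0 π) := by
  have h := (isPrim_integral (integrable_exp_mul_norm hb τ 0) 0).continuousOn
  have h2 : ContinuousOn (fun x => Real.exp (-(2 * τ * x)) + Real.exp (-(2 * τ * x)) *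
      (0 + ∫ t in (0 : ℝ)..x, Real.exp (-(2 * τ * (0 - t))) * ‖b t‖)) (Set.Icc 0 π) :=
    (by fun_prop : Continuous fun x : ℝ => Real.exp (-(2 * τ * x))).continuousOn.add
      ((by fun_prop : Continuous fun x : ℝ => Real.exp (-(2 * τ * x))).continuousOn.mul h)
  refine h2.congr fun x _ => ?_
  simp only [decayMajorant, zero_add]
  rw [← intervalIntegral.integral_const_mul]
  congr 1
  refine intervalIntegral.integral_congr fun t _ => ?_
  rw [← mul_assoc, ← Real.exp_add]
  ring_nf

theorem decayMajorant_nonneg (b : ℝ → ℂ) (τ : ℝ) {x : ℝ} (hx : 0 ≤ x) :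
    0 ≤ decayMajorant b τ x :=
  add_nonneg (Real.exp_pos _).le
    (intervalIntegral.integral_nonneg hx fun _ _ => mul_nonneg (Real.exp_pos _).le (norm_nonneg _))

theorem decayMajorant_le (hb : Integrable b muPi) {τ : ℝ} (hτ : 0 ≤ τ) {x : ℝ}
    (hx : x ∈ Set.Icc 0 π) : decayMajorant b τ x ≤ 1 + ∫ t, ‖b t‖ ∂muPi := by
  refine add_le_add (Real.exp_le_one_iff.2 ?_) (le_trans ?_ (integral_le_muPi hb.norm
    (Eventually.of_forall fun t => norm_nonneg _) hx))
  · have := mul_nonneg hτ hx.1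
    linarith
  · refine intervalIntegral.integral_mono_on hx.1
      (intervalIntegrable_of_muPi (integrable_exp_mul_norm hb τ x) zero_mem_Icc_pi hx)
      (intervalIntegrable_of_muPi hb.norm zero_mem_Icc_pi hx) fun t ht => ?_
    refine mul_le_of_le_one_left (norm_nonneg _) (Real.exp_le_one_iff.2 ?_)
    have := mul_nonneg hτ (sub_nonneg.2 ht.2)
    linarith

theorem tendsto_exp_neg_mul {c : ℝ} (hc : 0 < c) :
    Tendsto (fun τ : ℝ => Real.exp (-(2 * τ * c))) atTop (𝓝 0) := by
  refine Real.tendsto_exp_atBot.comp ?_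
  have : Tendsto (fun τ : ℝ => τ * (2 * c)) atTop atTop :=
    tendsto_id.atTop_mul_const (by positivity)
  refine (tendsto_neg_atTop_atBot.comp this).congr fun τ => ?_
  simp
  ring

/-- Dominated convergence: the kernel exp(-2τ(x - t)) is at most 1 and tends to 0 for t < x. At x =
0 the majorant equals 1, so x > 0 is needed. -/
theorem tendsto_decayMajorant (hb : Integrable b muPi) {x : ℝ} (hx : x ∈ Set.Icc 0 π)
    (hx0 : 0 < x) : Tendsto (fun τ => decayMajorant b τ x) atTop (𝓝 0) := by
  have h1 := tendsto_exp_neg_mul hx0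
  have h2 : Tendsto (fun τ => ∫ t in (0 : ℝ)..x, Real.exp (-(2 * τ * (x - t))) * ‖b t‖) atTop
      (𝓝 (∫ t in (0 : ℝ)..x, (0 : ℝ))) := by
    refine intervalIntegral.tendsto_integral_filter_of_dominated_convergence (fun t => ‖b t‖)
      (Eventually.of_forall fun τ => ?_) ?_
      (intervalIntegrable_of_muPi hb.norm zero_mem_Icc_pi hx) ?_
    · exact (intervalIntegrable_iff.1 (intervalIntegrable_of_muPi (integrable_exp_mul_norm hb τ x)
        zero_mem_Icc_pi hx)).aestronglyMeasurable
    · filter_upwards [eventually_ge_atTop (0 : ℝ)] with τ hτ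
      refine Eventually.of_forall fun t ht => ?_
      rw [Set.uIoc_of_le hx.1] at ht
      rw [norm_mul, norm_norm, Real.norm_eq_abs, Real.abs_exp]
      refine mul_le_of_le_one_left (norm_nonneg _) (Real.exp_le_one_iff.2 ?_)
      have := mul_nonneg hτ (sub_nonneg.2 ht.2)
      linarith
    · filter_upwards [Measure.ae_ne volume x] with t htx ht
      rw [Set.uIoc_of_le hx.1] at ht
      have hpos : 0 < x - t := sub_pos.2 (lt_of_le_of_ne ht.2 htx)
      simpa using (tendsto_exp_neg_mul hpos).mul_const ‖b t‖
  simpa [decayMajorant] using h1.add h2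

/-- The majorant is uniformly bounded and tends to 0 off the null set {0}, so dominated convergence
applies once more. -/
theorem tendsto_decayBound (ha : Integrable a muPi) (hb : Integrable b muPi) :
    Tendsto (decayBound a b) atTop (𝓝 0) := by
  have h1 := tendsto_decayMajorant hb pi_mem_Icc_pi Real.pi_pos
  have h2 : Tendsto (fun τ => ∫ x, ‖a x‖ * decayMajorant b τ x ∂muPi) atTop
      (𝓝 (∫ x, (0 : ℝ) ∂muPi)) := by
    refine tendsto_integral_filter_of_dominated_convergence
      (fun x => ‖a x‖ * (1 + ∫ t, ‖b t‖ ∂muPi)) (Eventually.of_forall fun τ => ?_) ?_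
      (ha.norm.mul_const _) ?_
    · exact (integrable_mul_of_continuousOn_real ha.norm
        (continuousOn_decayMajorant hb τ)).aestronglyMeasurable
    · filter_upwards [eventually_ge_atTop (0 : ℝ)] with τ hτ
      filter_upwards [ae_mem_Ioo] with x hx
      have hx' := Set.Ioo_subset_Icc_self hx
      rw [norm_mul, norm_norm, Real.norm_of_nonneg (decayMajorant_nonneg b τ hx'.1)]
      gcongr
      exact decayMajorant_le hb hτ hx'
    · filter_upwards [ae_mem_Ioo] with x hx
      simpa using (tendsto_decayMajorant hb (Set.Ioo_subset_Icc_self hx) hx.1).const_mul ‖a x‖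
  simpa [decayBound, Function.comp_def] using! h2.add h1

/-- Estimate of a solution for a large imaginary part. -/
theorem DiracSys.halfPlane (h : DiracSys a b z ξ η) (ha : Integrable a muPi)
    (hb : Integrable b muPi) (hz : z.im ≤ 0) (h0 : ‖ξ 0‖ + ‖η 0‖ ≤ 1) :
    ‖ξ π - ξ 0‖ ≤ 2 * Real.exp (∫ t, (‖a t‖ + ‖b t‖) ∂muPi) * decayBound a b (-z.im) ∧
      ‖Complex.exp (-(2 * Complex.I * z) * π) * (η π - η 0)‖ ≤
        2 * Real.exp (∫ t, (‖a t‖ + ‖b t‖) ∂muPi) * decayBound a b (-z.im) := by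
  set τ := -z.im with hτdef
  have hτ : 0 ≤ τ := by linarith
  set m := Real.exp (∫ t, (‖a t‖ + ‖b t‖) ∂muPi) with hmdef
  have hm1 : 1 ≤ m := Real.one_le_exp (integral_nonneg fun t => by positivity)
  have hexp : ∀ x : ℝ, ‖Complex.exp (-(2 * Complex.I * z) * x)‖ = Real.exp (-(2 * τ * x)) := by
    intro x
    rw [norm_exp_neg_two_I, hτdef]
    ring_nf
  have hcβ : ContinuousOn (fun x : ℝ => ‖Complex.exp (-(2 * Complex.I * z) * x) * η x‖)
      (Set.Icc 0 π) := ((continuous_cexp_mul _).continuousOn.mul h.snd.continuousOn).norm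
  -- Multiplying η by exp(-2izx), of modulus exp(-2τx), combines with the growing coefficient
  -- exp(2izt) into the decaying kernel exp(-2τ(x - t)).
  have hsecond : ∀ x ∈ Set.Icc 0 π,
      ‖Complex.exp (-(2 * Complex.I * z) * x) * (η x - η 0)‖ ≤
        ∫ t in (0 : ℝ)..x, Real.exp (-(2 * τ * (x - t))) * ‖b t‖ * ‖ξ t‖ := by
    intro x hx
    have e : η x - η 0 = ∫ t in (0 : ℝ)..x, b t * Complex.exp (2 * Complex.I * z * t) * ξ t := by
      rw [h.snd.eq x hx]
      ring
    rw [e, ← intervalIntegral.integral_const_mul]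
    refine norm_integral_le_muPi (integrable_mul_of_continuousOn_real
      (integrable_exp_mul_norm hb τ x) h.fst.continuousOn.norm) ?_ hx
    refine Eventually.of_forall fun t => le_of_eq ?_
    rw [norm_mul, norm_mul, norm_mul, hexp, norm_exp_two_I,
      show -(2 * τ * (x - t)) = -(2 * τ * x) + -(2 * z.im * t) by rw [hτdef]; ring, Real.exp_add]
    ring
  have hab : Integrable (fun t => ‖a t‖ + ‖b t‖) muPi := ha.norm.add hb.norm
  -- Grönwall's inequality for ξ together with the weighted η. All kernels are at most 1 here, so
  -- the bound m does not depend on τ.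
  have hbd : ∀ x ∈ Set.Icc 0 π, ‖ξ x‖ + ‖Complex.exp (-(2 * Complex.I * z) * x) * η x‖ ≤ m := by
    intro x hx
    have hc : ContinuousOn (fun x : ℝ => ‖ξ x‖ + ‖Complex.exp (-(2 * Complex.I * z) * x) * η x‖)
      (Set.Icc 0 π) := h.fst.continuousOn.norm.add hcβ
    have hg := gronwall_of_integrable (C := 1) hab
      (Eventually.of_forall fun t => add_nonneg (norm_nonneg _) (norm_nonneg _)) hc
      (fun y hy => ?_) x hx
    · refine hg.trans ?_
      rw [one_mul]
      exact Real.exp_le_exp.2 (integral_le_muPi hab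
        (Eventually.of_forall fun t => add_nonneg (norm_nonneg _) (norm_nonneg _)) hx)
    · have e1 : Integrable (fun t : ℝ => ‖a t‖ * ‖Complex.exp (-(2 * Complex.I * z) * t) * η t‖)
        muPi := integrable_mul_of_continuousOn_real ha.norm hcβ
      have e2 : Integrable (fun t => ‖b t‖ * ‖ξ t‖) muPi :=
        integrable_mul_of_continuousOn_real hb.norm h.fst.continuousOn.norm
      have b1 : ‖ξ y‖ ≤ ‖ξ 0‖ +
          ∫ t in (0 : ℝ)..y, ‖a t‖ * ‖Complex.exp (-(2 * Complex.I * z) * t) * η t‖ := by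
        rw [h.fst.eq y hy]
        refine (norm_add_le _ _).trans (add_le_add_right (norm_integral_le_muPi e1 ?_ hy) _)
        refine Eventually.of_forall fun t => le_of_eq ?_
        rw [mul_assoc, norm_mul]
      have b2 : ‖Complex.exp (-(2 * Complex.I * z) * y) * η y‖ ≤
          ‖η 0‖ + ∫ t in (0 : ℝ)..y, ‖b t‖ * ‖ξ t‖ := by
        rw [show Complex.exp (-(2 * Complex.I * z) * y) * η y =
          Complex.exp (-(2 * Complex.I * z) * y) * η 0 +
          Complex.exp (-(2 * Complex.I * z) * y) * (η y - η 0) by ring]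
        refine (norm_add_le _ _).trans (add_le_add ?_ ((hsecond y hy).trans ?_))
        · rw [norm_mul, hexp]
          refine mul_le_of_le_one_left (norm_nonneg _) (Real.exp_le_one_iff.2 ?_)
          have := mul_nonneg hτ hy.1
          linarith
        · refine intervalIntegral.integral_mono_on hy.1
            (intervalIntegrable_of_muPi (integrable_mul_of_continuousOn_real
              (integrable_exp_mul_norm hb τ y) h.fst.continuousOn.norm) zero_mem_Icc_pi hy)
            (intervalIntegrable_of_muPi e2 zero_mem_Icc_pi hy) fun t ht => ?_
          rw [mul_assoc]
          refine mul_le_of_le_one_left (by positivity) (Real.exp_le_one_iff.2 ?_)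
          have := mul_nonneg hτ (sub_nonneg.2 ht.2)
          linarith
      have b3 : (∫ t in (0 : ℝ)..y, ‖a t‖ * ‖Complex.exp (-(2 * Complex.I * z) * t) * η t‖) +
          ∫ t in (0 : ℝ)..y, ‖b t‖ * ‖ξ t‖ ≤ ∫ t in (0 : ℝ)..y, (‖a t‖ + ‖b t‖) *
            (‖ξ t‖ + ‖Complex.exp (-(2 * Complex.I * z) * t) * η t‖) := by
        rw [← intervalIntegral.integral_add (intervalIntegrable_of_muPi e1 zero_mem_Icc_pi hy)
          (intervalIntegrable_of_muPi e2 zero_mem_Icc_pi hy)]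
        refine intervalIntegral.integral_mono_on hy.1
          (intervalIntegrable_of_muPi (e1.add e2) zero_mem_Icc_pi hy)
          (intervalIntegrable_of_muPi (integrable_mul_of_continuousOn_real hab hc)
            zero_mem_Icc_pi hy) fun t _ => ?_
        have : 0 ≤ ‖a t‖ * ‖ξ t‖ + ‖b t‖ * ‖Complex.exp (-(2 * Complex.I * z) * t) * η t‖ := by
          positivity
        linarith
      linarith
  have hdec : ∀ x ∈ Set.Icc 0 π,
      ‖Complex.exp (-(2 * Complex.I * z) * x) * (η x - η 0)‖ ≤ m * decayMajorant b τ x := by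
    intro x hx
    refine (hsecond x hx).trans ?_
    rw [decayMajorant, mul_add, ← intervalIntegral.integral_const_mul]
    refine le_trans ?_ (le_add_of_nonneg_left (by positivity))
    refine intervalIntegral.integral_mono_on hx.1
      (intervalIntegrable_of_muPi (integrable_mul_of_continuousOn_real
        (integrable_exp_mul_norm hb τ x) h.fst.continuousOn.norm) zero_mem_Icc_pi hx)
      (intervalIntegrable_of_muPi ((integrable_exp_mul_norm hb τ x).const_mul m)
        zero_mem_Icc_pi hx) fun t ht => ?_
    rw [mul_comm m]
    gcongr
    exact (le_add_of_nonneg_right (norm_nonneg _)).trans (hbd t ⟨ht.1, ht.2.trans hx.2⟩)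
  have hint0 : 0 ≤ ∫ x, ‖a x‖ * decayMajorant b τ x ∂muPi := by
    refine integral_nonneg_of_ae ?_
    filter_upwards [ae_mem_Ioo] with x hx
    exact mul_nonneg (norm_nonneg _) (decayMajorant_nonneg b τ hx.1.le)
  have hpi0 := decayMajorant_nonneg b τ Real.pi_pos.le
  have hη0 : ‖η 0‖ ≤ m := (le_add_of_nonneg_left (norm_nonneg _)).trans (h0.trans hm1)
  constructor
  · have e : ξ π - ξ 0 =
        ∫ t in (0 : ℝ)..π, a t * Complex.exp (-(2 * Complex.I * z) * t) * η t := by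
      rw [h.fst.eq π pi_mem_Icc_pi]
      ring
    -- The weighted η is at most exp(-2τt)‖η(0)‖ + m · `decayMajorant`, and both terms are at most m
    -- · `decayMajorant`; hence the factor 2m.
    have hi := (integrable_mul_of_continuousOn_real ha.norm
      (continuousOn_decayMajorant hb τ)).const_mul (2 * m)
    rw [e]
    refine (norm_integral_le_muPi hi ?_ pi_mem_Icc_pi).trans ?_
    · filter_upwards [ae_mem_Ioo] with t ht
      have ht' := Set.Ioo_subset_Icc_self ht
      rw [mul_assoc, norm_mul, mul_left_comm]
      gcongr
      rw [show Complex.exp (-(2 * Complex.I * z) * t) * η t =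
          Complex.exp (-(2 * Complex.I * z) * t) * η 0 +
          Complex.exp (-(2 * Complex.I * z) * t) * (η t - η 0) by ring]
      refine (norm_add_le _ _).trans ?_
      rw [two_mul m, add_mul]
      refine add_le_add ?_ (hdec t ht')
      rw [norm_mul, hexp, mul_comm]
      refine mul_le_mul hη0 (le_add_of_nonneg_right ?_) (Real.exp_pos _).le (by positivity)
      exact intervalIntegral.integral_nonneg ht'.1 fun t _ => by positivity
    · rw [intervalIntegral.integral_const_mul, ← integral_muPi, decayBound]
      gcongr
      linarith
  · refine (hdec π pi_mem_Icc_pi).trans ?_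
    have : m * decayMajorant b τ π ≤ m * decayBound a b τ := by
      rw [decayBound]
      gcongr
      linarith
    refine this.trans ?_
    have h2 : 0 ≤ m * decayBound a b τ := by
      rw [decayBound]
      positivity
    linarith

end DiracSystem


/-! ### Diagonalization of the Dirac system. -/

section Transformation

/-- The coefficient `-(q₂ + q₃)/2 - i q₁`. -/
noncomputable def coefLower (Q : ℝ → Matrix (Fin 2) (Fin 2) ℂ) (x : ℝ) : ℂ :=
  -((Q x 0 1 + Q x 1 0) / 2) - Complex.I * Q x 0 0

/-- The coefficient `-(q₂ + q₃)/2 + i q₁`. -/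
noncomputable def coefUpper (Q : ℝ → Matrix (Fin 2) (Fin 2) ℂ) (x : ℝ) : ℂ :=
  -((Q x 0 1 + Q x 1 0) / 2) + Complex.I * Q x 0 0

variable {Q : ℝ → Matrix (Fin 2) (Fin 2) ℂ} (hQ : EntryIntegrable Q)

include hQ in
theorem integrable_coefLower : Integrable (coefLower Q) muPi :=
  (((hQ 0 1).add (hQ 1 0)).div_const 2).neg.sub ((hQ 0 0).const_mul _)

include hQ in
theorem integrable_coefUpper : Integrable (coefUpper Q) muPi :=
  (((hQ 0 1).add (hQ 1 0)).div_const 2).neg.add ((hQ 0 0).const_mul _)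

theorem IsPrim.comp_pi {f d : ℝ → Fin 2 → ℂ} (h : IsPrim f d) (i : Fin 2) :
    IsPrim (fun x => f x i) (fun x => d x i) := by
  refine ⟨Integrable.eval h.integrable i, fun x hx => ?_⟩
  have h1 := congrFun (h.eq x hx) i
  rw [h1, Pi.add_apply]
  congr 1
  rw [intervalIntegral.integral_of_le hx.1, intervalIntegral.integral_of_le hx.1,
    MeasureTheory.eval_integral]
  intro j
  exact (intervalIntegrable_of_muPi (Integrable.eval h.integrable j) zero_mem_Icc_pi hx).1

theorem isPrim_solY (z : ℂ) (v : Fin 2 → ℂ) :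
    IsPrim (ext (solY hQ z v)) fun x => coefA Q z x *ᵥ ext (solY hQ z v) x := by
  have h := isPrim_integral ((entryIntegrable_coefA hQ z).mulVec
    (continuous_ext (solY hQ z v)).continuousOn) v
  refine h.congr (fun x hx => ?_) (Eventually.of_forall fun _ => rfl)
  rw [ext_of_mem _ hx]
  have h2 := congrArg (fun g : CPi => g ⟨x, hx⟩) (solY_eq hQ z v)
  exact h2

/-- The exponent `-½ ∫₀ˣ (q₂ - q₃)`. -/
noncomputable def gaugeExp (Q : ℝ → Matrix (Fin 2) (Fin 2) ℂ) (x : ℝ) : ℂ :=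
  0 + ∫ t in (0 : ℝ)..x, -(1 / 2) * (Q t 0 1 - Q t 1 0)

theorem exp_gaugeExp_pi (Q : ℝ → Matrix (Fin 2) (Fin 2) ℂ) :
    Complex.exp (gaugeExp Q π) * E Q = 1 := by
  rw [gaugeExp, E, ← Complex.exp_add, intervalIntegral.integral_const_mul]
  rw [← Complex.exp_zero]
  congr 1
  ring

/-- Every solution gives a solution of the transformed system. -/
theorem exists_diracSys (htr : ∀ᵐ x ∂muPi, Q x 1 1 = -Q x 0 0) (z : ℂ) (v : Fin 2 → ℂ) :
    ∃ ξ η : ℝ → ℂ, DiracSys (coefLower Q) (coefUpper Q) z ξ η ∧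
      ξ 0 = (v 0 - Complex.I * v 1) / 2 ∧ η 0 = (v 0 + Complex.I * v 1) / 2 ∧
      ext (solY hQ z v) π 0 = E Q * (Complex.exp (Complex.I * π * z) * ξ π +
        Complex.exp (-(Complex.I * π * z)) * η π) ∧
      ext (solY hQ z v) π 1 = E Q * (Complex.I * (Complex.exp (Complex.I * π * z) * ξ π -
        Complex.exp (-(Complex.I * π * z)) * η π)) := by
  set y := ext (solY hQ z v) with hy
  have hP := isPrim_solY hQ z v
  have h0 := hP.comp_pi 0
  have h1 := hP.comp_pi 1
  have hφi : Integrable (fun t => -(1 / 2) * (Q t 0 1 - Q t 1 0)) muPi :=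
    ((hQ 0 1).sub (hQ 1 0)).const_mul _
  have hφ : IsPrim (gaugeExp Q) _ := (isPrim_integral hφi 0)
  have hg := hφ.cexp
  have hm := isPrim_cexp_mul (-(Complex.I * z))
  have hp := isPrim_cexp_mul (Complex.I * z)
  -- The combinations y₁ ∓ i y₂ diagonalize B. Since q₄ = -q₁, the diagonal terms left are (q₂ -
  -- q₃)/2 ± iz; the gauge factor removes the first part and exp(∓izx) the second.
  have hξ := ((hg.mul hm).mul (h0.add (h1.const_mul (-Complex.I)))).const_mul (1 / 2)
  have hη := ((hg.mul hp).mul (h0.add (h1.const_mul Complex.I))).const_mul (1 / 2)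
  have y0 : y 0 = v := by
    rw [hy, ext_of_mem _ zero_mem_Icc_pi, solY_zero]
  rw [hy] at y0
  have hI := Complex.I_sq
  have exp1 : ∀ x : ℝ, Complex.exp (-(2 * Complex.I * z) * x) * Complex.exp (Complex.I * z * x) =
      Complex.exp (-(Complex.I * z) * x) := fun x => by
    rw [← Complex.exp_add]
    ring_nf
  have exp2 : ∀ x : ℝ, Complex.exp (2 * Complex.I * z * x) * Complex.exp (-(Complex.I * z) * x) =
      Complex.exp (Complex.I * z * x) := fun x => by
    rw [← Complex.exp_add]
    ring_nf
  refine ⟨_, _, ⟨hξ.congr (fun _ _ => rfl) ?_, hη.congr (fun _ _ => rfl) ?_⟩, ?_, ?_, ?_, ?_⟩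
  · filter_upwards [htr] with x hx
    have e := exp1 x
    simp only [coefLower, coefA_eq, hx, Matrix.mulVec, dotProduct, Fin.sum_univ_two,
      Matrix.of_apply, Matrix.cons_val_zero, Matrix.cons_val_one, Matrix.cons_val', ← hy,
      Matrix.cons_val_fin_one]
    rw [← e]
    generalize Complex.exp (gaugeExp Q x) = G
    generalize Complex.exp (-(2 * Complex.I * z) * x) = F
    generalize Complex.exp (Complex.I * z * x) = K
    linear_combination (1 / 2 * G * F * K * y x 1 * (z + Q x 0 0)) * hI
  · filter_upwards [htr] with x hx
    have e := exp2 x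
    simp only [coefUpper, coefA_eq, hx, Matrix.mulVec, dotProduct, Fin.sum_univ_two,
      Matrix.of_apply, Matrix.cons_val_zero, Matrix.cons_val_one, Matrix.cons_val', ← hy,
      Matrix.cons_val_fin_one]
    rw [← e]
    generalize Complex.exp (gaugeExp Q x) = G
    generalize Complex.exp (2 * Complex.I * z * x) = F
    generalize Complex.exp (-(Complex.I * z) * x) = K
    linear_combination (1 / 2 * G * F * K * y x 1 * (z + Q x 0 0)) * hI
  · simp [gaugeExp, y0]
    ring
  · simp [gaugeExp, y0]
    ring
  · have e1 := exp_gaugeExp_pi Q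
    have e2 : Complex.exp (Complex.I * π * z) * Complex.exp (-(Complex.I * z) * π) = 1 := by
      rw [← Complex.exp_add, ← Complex.exp_zero]
      ring_nf
    have e3 : Complex.exp (-(Complex.I * π * z)) * Complex.exp (Complex.I * z * π) = 1 := by
      rw [← Complex.exp_add, ← Complex.exp_zero]
      ring_nf
    linear_combination (-y π 0) * e1 - (Complex.exp (gaugeExp Q π) * E Q) * (1 / 2) *
      ((y π 0 - Complex.I * y π 1) * e2 + (y π 0 + Complex.I * y π 1) * e3)
  · have e1 := exp_gaugeExp_pi Q
    have e2 : Complex.exp (Complex.I * π * z) * Complex.exp (-(Complex.I * z) * π) = 1 := by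
      rw [← Complex.exp_add, ← Complex.exp_zero]
      ring_nf
    have e3 : Complex.exp (-(Complex.I * π * z)) * Complex.exp (Complex.I * z * π) = 1 := by
      rw [← Complex.exp_add, ← Complex.exp_zero]
      ring_nf
    linear_combination (-y π 1) * e1 - (Complex.exp (gaugeExp Q π) * E Q) * (1 / 2) *
      Complex.I * ((y π 0 - Complex.I * y π 1) * e2 - (y π 0 + Complex.I * y π 1) * e3)
      + (Complex.exp (gaugeExp Q π) * E Q) * (y π 1) * hI

end Transformation


/-! ### The difference of the two characteristic determinants. -/

section DetDifference

variable {Q : ℝ → Matrix (Fin 2) (Fin 2) ℂ} (hQ : EntryIntegrable Q)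

/-- The sum of the absolute values of the entries of the boundary matrix. -/
noncomputable def bdrySum (U : Matrix (Fin 2) (Fin 4) ℂ) : ℝ := ∑ i, ∑ j, ‖U i j‖

theorem bdrySum_nonneg (U : Matrix (Fin 2) (Fin 4) ℂ) : 0 ≤ bdrySum U :=
  Finset.sum_nonneg fun _ _ => Finset.sum_nonneg fun _ _ => norm_nonneg _

theorem norm_add_le_bdrySum (U : Matrix (Fin 2) (Fin 4) ℂ) (i : Fin 2) {j k : Fin 4} (hjk : j ≠ k)
    {s : ℂ} (hs : ‖s‖ = 1) : ‖U i j + s * U i k‖ ≤ bdrySum U := by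
  calc ‖U i j + s * U i k‖ ≤ ‖U i j‖ + ‖U i k‖ := by
        refine (norm_add_le _ _).trans ?_
        rw [norm_mul, hs, one_mul]
    _ = ∑ l ∈ {j, k}, ‖U i l‖ := (Finset.sum_pair (f := fun l => ‖U i l‖) hjk).symm
    _ ≤ ∑ l, ‖U i l‖ := Finset.sum_le_sum_of_subset_of_nonneg (Finset.subset_univ _)
        fun _ _ _ => norm_nonneg _
    _ ≤ bdrySum U := Finset.single_le_sum (f := fun i => ∑ j, ‖U i j‖)
        (fun _ _ => Finset.sum_nonneg fun _ _ => norm_nonneg _) (Finset.mem_univ i)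

theorem norm_minor_le (U : Matrix (Fin 2) (Fin 4) ℂ) {j k l m : Fin 4} (hjk : j ≠ k) (hlm : l ≠ m)
    {s t : ℂ} (hs : ‖s‖ = 1) (ht : ‖t‖ = 1) :
    ‖(U 0 j + s * U 0 k) * (U 1 l + t * U 1 m) - (U 1 j + s * U 1 k) * (U 0 l + t * U 0 m)‖ ≤
      2 * bdrySum U ^ 2 := by
  refine (norm_sub_le _ _).trans ?_
  rw [norm_mul, norm_mul]
  have h := fun i => norm_add_le_bdrySum U i hjk hs
  have h' := fun i => norm_add_le_bdrySum U i hlm ht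
  have h1 := mul_le_mul (h 0) (h' 1) (norm_nonneg _) (bdrySum_nonneg U)
  have h2 := mul_le_mul (h 1) (h' 0) (norm_nonneg _) (bdrySum_nonneg U)
  nlinarith

theorem bdry_apply (U : Matrix (Fin 2) (Fin 4) ℂ) (y : CPi) (i : Fin 2) :
    bdry U y i = U i 0 * ext y 0 0 + U i 1 * ext y 0 1 + U i 2 * ext y π 0 + U i 3 * ext y π 1 := by
  fin_cases i <;> simp [bdry, boundaryForm] <;> ring

/-- The difference of the characteristic determinants of `L_{Q,U}` and of the associated free
operator, in terms of two solutions of the transformed system. -/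
theorem exists_norm_charDet_sub_le (htr : ∀ᵐ x ∂muPi, Q x 1 1 = -Q x 0 0)
    (U : Matrix (Fin 2) (Fin 4) ℂ) (z : ℂ) :
    ∃ ξ₁ η₁ ξ₂ η₂ : ℝ → ℂ, DiracSys (coefLower Q) (coefUpper Q) z ξ₁ η₁ ∧
      DiracSys (coefLower Q) (coefUpper Q) z ξ₂ η₂ ∧
      ξ₁ 0 = 1 ∧ η₁ 0 = 0 ∧ ξ₂ 0 = 0 ∧ η₂ 0 = 1 ∧
      ‖charDet hQ U z - freeDet (assocBC Q U) z‖ ≤ bdrySum U ^ 2 * ‖E Q‖ *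
        (‖Complex.exp (Complex.I * π * z)‖ * (‖ξ₁ π - ξ₁ 0‖ + ‖ξ₂ π - ξ₂ 0‖) +
          ‖Complex.exp (-(Complex.I * π * z))‖ * (‖η₁ π - η₁ 0‖ + ‖η₂ π - η₂ 0‖)) := by
  -- The initial vectors (1, ±i) are eigenvectors of B and become (ξ, η)(0) = (1, 0) and (0, 1). In
  -- the free case these pairs stay constant, so only the increments of ξ and η measure the
  -- perturbation.
  obtain ⟨ξ₁, η₁, h1, a1, b1, p1, r1⟩ := exists_diracSys hQ htr z ![1, Complex.I]
  obtain ⟨ξ₂, η₂, h2, a2, b2, p2, r2⟩ := exists_diracSys hQ htr z ![1, -Complex.I]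
  simp only [Matrix.cons_val_zero, Matrix.cons_val_one, Complex.I_mul_I, mul_neg, sub_neg_eq_add,
    Matrix.cons_val_fin_one] at a1 b1 a2 b2
  norm_num at a1 b1 a2 b2
  refine ⟨ξ₁, η₁, ξ₂, η₂, h1, h2, a1, b1, a2, b2, ?_⟩
  have hw := h1.wronskian h2
  rw [a1, b1, a2, b2] at hw
  have hee : Complex.exp (Complex.I * π * z) * Complex.exp (-(Complex.I * π * z)) = 1 := by
    rw [← Complex.exp_add, ← Complex.exp_zero]
    ring_nf
  have hlin : ∀ (s : ℂ) (i : Fin 2), bdry U (solY hQ z ![1, s]) i =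
      charMat hQ U i 0 z + s * charMat hQ U i 1 z := by
    intro s i
    have : (![1, s] : Fin 2 → ℂ) = ![1, 0] + s • ![0, 1] := by
      ext k
      fin_cases k <;> simp
    rw [this, map_add, map_add, map_smul, map_smul]
    rfl
  have hz0 : ∀ v, ext (solY hQ z v) 0 = v := fun v => by
    rw [ext_of_mem _ zero_mem_Icc_pi, solY_zero]
  have hP := hlin Complex.I
  have hN := hlin (-Complex.I)
  simp only [bdry_apply, hz0, p1, r1, p2, r2, Matrix.cons_val_zero, Matrix.cons_val_one,
    Matrix.cons_val_fin_one, mul_one] at hP hN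
  have hI := Complex.I_sq
  -- The factor -2i is the determinant of the basis (1, i), (1, -i). The part of Δ quadratic in the
  -- values at π is multiplied by ξ₁η₂ - ξ₂η₁ = 1 and cancels against the J₃₄ term of Δ⁰. What is
  -- left is linear in the increments, with mixed minors of U as coefficients.
  have key : -2 * Complex.I * (charDet hQ U z - freeDet (assocBC Q U) z) = E Q *
      (Complex.exp (Complex.I * π * z) * (ξ₁ π - 1) *
          -((U 0 0 + -Complex.I * U 0 1) * (U 1 2 + Complex.I * U 1 3) -
            (U 1 0 + -Complex.I * U 1 1) * (U 0 2 + Complex.I * U 0 3)) +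
        Complex.exp (Complex.I * π * z) * ξ₂ π *
          ((U 0 0 + Complex.I * U 0 1) * (U 1 2 + Complex.I * U 1 3) -
            (U 1 0 + Complex.I * U 1 1) * (U 0 2 + Complex.I * U 0 3)) +
        Complex.exp (-(Complex.I * π * z)) * η₁ π *
          -((U 0 0 + -Complex.I * U 0 1) * (U 1 2 + -Complex.I * U 1 3) -
            (U 1 0 + -Complex.I * U 1 1) * (U 0 2 + -Complex.I * U 0 3)) +
        Complex.exp (-(Complex.I * π * z)) * (η₂ π - 1) *
          ((U 0 0 + Complex.I * U 0 1) * (U 1 2 + -Complex.I * U 1 3) -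
            (U 1 0 + Complex.I * U 1 1) * (U 0 2 + -Complex.I * U 0 3))) := by
    have e1 : -2 * Complex.I * charDet hQ U z =
        (charMat hQ U 0 0 z + Complex.I * charMat hQ U 0 1 z) *
          (charMat hQ U 1 0 z + -Complex.I * charMat hQ U 1 1 z) -
        (charMat hQ U 1 0 z + Complex.I * charMat hQ U 1 1 z) *
          (charMat hQ U 0 0 z + -Complex.I * charMat hQ U 0 1 z) := by
      rw [charDet]
      ring
    rw [mul_sub, e1, ← hP, ← hP, ← hN, ← hN]
    simp only [freeDet, coefPlus, coefMid, coefMinus, J, assocBC, Matrix.of_apply,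
      Matrix.cons_val_zero, Matrix.cons_val_one, Matrix.cons_val]
    generalize Complex.exp (Complex.I * π * z) = e at *
    generalize Complex.exp (-(Complex.I * π * z)) = e' at *
    generalize E Q = w at *
    have e2 : e * e' * (ξ₁ π * η₂ π - ξ₂ π * η₁ π) = 1 := by
      rw [hee, hw]
      ring
    linear_combination (exp := 1)
      w ^ 2 * ((U 0 2 + Complex.I * U 0 3) * (U 1 2 - Complex.I * U 1 3) -
        (U 1 2 + Complex.I * U 1 3) * (U 0 2 - Complex.I * U 0 3)) * e2 +
      w * (e' - e) * (U 0 0 * U 1 2 - U 0 2 * U 1 0) * hI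
  have hnorm := congrArg norm key
  have hmI : ‖-Complex.I‖ = 1 := by simp
  have n1 := norm_minor_le U (j := 0) (k := 1) (l := 2) (m := 3) (by decide) (by decide) hmI
    Complex.norm_I
  have n2 := norm_minor_le U (j := 0) (k := 1) (l := 2) (m := 3) (by decide) (by decide)
    Complex.norm_I Complex.norm_I
  have n3 := norm_minor_le U (j := 0) (k := 1) (l := 2) (m := 3) (by decide) (by decide) hmI hmI
  have n4 := norm_minor_le U (j := 0) (k := 1) (l := 2) (m := 3) (by decide) (by decide)
    Complex.norm_I hmI
  rw [norm_mul, norm_mul, norm_neg, Complex.norm_I, Complex.norm_ofNat, mul_one, norm_mul] at hnorm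
  have hsum : 2 * ‖charDet hQ U z - freeDet (assocBC Q U) z‖ ≤ ‖E Q‖ *
      (‖Complex.exp (Complex.I * π * z)‖ * ‖ξ₁ π - 1‖ * (2 * bdrySum U ^ 2) +
        ‖Complex.exp (Complex.I * π * z)‖ * ‖ξ₂ π‖ * (2 * bdrySum U ^ 2) +
        ‖Complex.exp (-(Complex.I * π * z))‖ * ‖η₁ π‖ * (2 * bdrySum U ^ 2) +
        ‖Complex.exp (-(Complex.I * π * z))‖ * ‖η₂ π - 1‖ * (2 * bdrySum U ^ 2)) := by
    rw [hnorm]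
    refine mul_le_mul_of_nonneg_left ?_ (norm_nonneg _)
    refine (norm_add_le _ _).trans (add_le_add ((norm_add_le _ _).trans (add_le_add
      ((norm_add_le _ _).trans (add_le_add ?_ ?_)) ?_)) ?_)
    · rw [norm_mul, norm_mul, norm_neg]
      gcongr
    · rw [norm_mul, norm_mul]
      gcongr
    · rw [norm_mul, norm_mul, norm_neg]
      gcongr
    · rw [norm_mul, norm_mul]
      gcongr
  rw [a1, b1, a2, b2, sub_zero, sub_zero]
  linarith

theorem norm_exp_pi (z : ℂ) : ‖Complex.exp (Complex.I * π * z)‖ = Real.exp (-(π * z.im)) := by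
  rw [Complex.norm_exp]
  simp

theorem norm_exp_neg_pi (z : ℂ) : ‖Complex.exp (-(Complex.I * π * z))‖ = Real.exp (π * z.im) := by
  rw [Complex.norm_exp]
  simp

/-- Far from the real axis the characteristic determinants differ by `o(exp (π |Im z|))`. -/
theorem norm_charDet_sub_le_of_large_im (htr : ∀ᵐ x ∂muPi, Q x 1 1 = -Q x 0 0)
    (U : Matrix (Fin 2) (Fin 4) ℂ) {c : ℝ} (hc : 0 < c) :
    ∃ h : ℝ, 0 ≤ h ∧ ∀ z : ℂ, h ≤ |z.im| →
      ‖charDet hQ U z - freeDet (assocBC Q U) z‖ ≤ c * Real.exp (π * |z.im|) := by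
  set a := coefLower Q
  set b := coefUpper Q
  have ha : Integrable a muPi := integrable_coefLower hQ
  have hb : Integrable b muPi := integrable_coefUpper hQ
  set K := 2 * Real.exp (∫ t, (‖a t‖ + ‖b t‖) ∂muPi) with hK
  have hK' : 2 * Real.exp (∫ t, (‖b t‖ + ‖a t‖) ∂muPi) = K := by
    rw [hK]
    simp only [add_comm]
  have hlim := (((tendsto_decayBound ha hb).add (tendsto_decayBound hb ha)).const_mul
    (bdrySum U ^ 2 * ‖E Q‖ * (4 * K)))
  rw [add_zero, mul_zero] at hlim
  obtain ⟨h, hh⟩ := eventually_atTop.1 (hlim.eventually (gt_mem_nhds hc))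
  refine ⟨max h 0, le_max_right _ _, fun z hz => ?_⟩
  have hτ := hh |z.im| ((le_max_left _ _).trans hz)
  obtain ⟨ξ₁, η₁, ξ₂, η₂, h1, h2, a1, b1, a2, b2, hle⟩ := exists_norm_charDet_sub_le hQ htr U z
  refine hle.trans ?_
  have hnn : ∀ (a b : ℝ → ℂ) (τ : ℝ), 0 ≤ decayBound a b τ := by
    intro a b τ
    refine add_nonneg (integral_nonneg_of_ae ?_) (decayMajorant_nonneg b τ Real.pi_pos.le)
    filter_upwards [ae_mem_Ioo] with x hx
    exact mul_nonneg (norm_nonneg _) (decayMajorant_nonneg b τ hx.1.le)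
  set D := decayBound a b |z.im| + decayBound b a |z.im| with hD
  have hK0 : 0 ≤ K := by positivity
  have hD1 : K * decayBound a b |z.im| ≤ K * D :=
    mul_le_mul_of_nonneg_left (le_add_of_nonneg_right (hnn _ _ _)) hK0
  have hD2 : K * decayBound b a |z.im| ≤ K * D :=
    mul_le_mul_of_nonneg_left (le_add_of_nonneg_left (hnn _ _ _)) hK0
  have hX := Real.exp_pos (π * |z.im|)
  -- Four increments of this kind occur, which accounts for the factor 4K in `hlim`. The lower
  -- half-plane is handled directly, the upper one after `DiracSys.swap`.
  suffices hs : ∀ ξ η : ℝ → ℂ, DiracSys a b z ξ η → ‖ξ 0‖ + ‖η 0‖ ≤ 1 →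
      ‖Complex.exp (Complex.I * π * z)‖ * ‖ξ π - ξ 0‖ ≤ Real.exp (π * |z.im|) * (K * D) ∧
      ‖Complex.exp (-(Complex.I * π * z))‖ * ‖η π - η 0‖ ≤ Real.exp (π * |z.im|) * (K * D) by
    have s1 := hs ξ₁ η₁ h1 (by rw [a1, b1]; simp)
    have s2 := hs ξ₂ η₂ h2 (by rw [a2, b2]; simp)
    have hB : 0 ≤ bdrySum U ^ 2 * ‖E Q‖ := by positivity
    calc _ ≤ bdrySum U ^ 2 * ‖E Q‖ * (4 * (Real.exp (π * |z.im|) * (K * D))) := by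
          refine mul_le_mul_of_nonneg_left ?_ hB
          linarith [s1.1, s1.2, s2.1, s2.2]
      _ = (bdrySum U ^ 2 * ‖E Q‖ * (4 * K) * D) * Real.exp (π * |z.im|) := by ring
      _ ≤ _ := by gcongr
  intro ξ η hs h0
  rcases le_total z.im 0 with hz0 | hz0
  · have hp := hs.halfPlane ha hb hz0 h0
    rw [abs_of_nonpos hz0] at hD1 ⊢
    constructor
    · rw [norm_exp_pi, ← mul_neg]
      gcongr
      exact hp.1.trans hD1
    -- The half-plane estimate controls η only after multiplication by exp(-2izπ); splitting this
    -- factor off leaves exp(iπz), whose modulus is exp(π |Im z|) here.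
    · have e : Complex.exp (-(Complex.I * π * z)) =
          Complex.exp (Complex.I * π * z) * Complex.exp (-(2 * Complex.I * z) * π) := by
        rw [← Complex.exp_add]
        ring_nf
      rw [e, norm_mul, norm_exp_pi, ← mul_neg, mul_assoc, ← norm_mul]
      gcongr
      exact hp.2.trans hD1
  · have hp := hs.swap.halfPlane hb ha (by simpa using hz0) (by rwa [add_comm])
    rw [hK'] at hp
    simp only [Complex.neg_im, neg_neg] at hp
    rw [abs_of_nonneg hz0] at hD2 ⊢
    constructor
    · have e : Complex.exp (Complex.I * π * z) =
          Complex.exp (-(Complex.I * π * z)) * Complex.exp (-(2 * Complex.I * -z) * π) := by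
        rw [← Complex.exp_add]
        ring_nf
      rw [e, norm_mul, norm_exp_neg_pi, mul_assoc, ← norm_mul]
      gcongr
      exact hp.2.trans hD2
    · rw [norm_exp_neg_pi]
      gcongr
      exact hp.1.trans hD2

/-- The density `|q₁| + |q₂ + q₃|`. -/
noncomputable def weight (Q : ℝ → Matrix (Fin 2) (Fin 2) ℂ) (x : ℝ) : ℝ :=
  ‖Q x 0 0‖ + ‖Q x 0 1 + Q x 1 0‖

include hQ in
theorem integrable_weight : Integrable (weight Q) muPi :=
  (hQ 0 0).norm.add ((hQ 0 1).add (hQ 1 0)).norm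

theorem norm_coefLower_le (Q : ℝ → Matrix (Fin 2) (Fin 2) ℂ) (x : ℝ) :
    ‖coefLower Q x‖ ≤ weight Q x := by
  refine (norm_sub_le _ _).trans ?_
  rw [norm_neg, norm_div, norm_mul, Complex.norm_I, Complex.norm_ofNat, weight]
  linarith [norm_nonneg (Q x 0 1 + Q x 1 0)]

theorem norm_coefUpper_le (Q : ℝ → Matrix (Fin 2) (Fin 2) ℂ) (x : ℝ) :
    ‖coefUpper Q x‖ ≤ weight Q x := by
  refine (norm_add_le _ _).trans ?_
  rw [norm_neg, norm_div, norm_mul, Complex.norm_I, Complex.norm_ofNat, weight]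
  linarith [norm_nonneg (Q x 0 1 + Q x 1 0)]

include hQ in
theorem continuousOn_upsilon (j : Fin 4) (z : ℂ) :
    ContinuousOn (fun x => upsilon Q j x z) (Set.Icc 0 π) := by
  have hs : Continuous fun t : ℝ => Complex.sin (2 * z * t) := by fun_prop
  have hc : Continuous fun t : ℝ => Complex.cos (2 * z * t) := by fun_prop
  have h := fun {d : ℝ → ℂ} (hd : Integrable d muPi) => (isPrim_integral hd 0).continuousOn
  simp only [zero_add] at h
  fin_cases j
  · exact h (integrable_mul_of_continuousOn (hQ 0 0) hs.continuousOn)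
  · exact h (integrable_mul_of_continuousOn (hQ 0 0) hc.continuousOn)
  · exact continuousOn_const.mul
      (h (integrable_mul_of_continuousOn ((hQ 0 1).add (hQ 1 0)) hs.continuousOn))
  · exact continuousOn_const.mul
      (h (integrable_mul_of_continuousOn ((hQ 0 1).add (hQ 1 0)) hc.continuousOn))

include hQ in
theorem continuousOn_UpsilonAt (z : ℂ) :
    ContinuousOn (fun x => UpsilonAt Q x z) (Set.Icc 0 π) :=
  continuousOn_finsetSum _ fun j _ => (continuousOn_upsilon hQ j z).norm

include hQ in
-- For s = i the integrand is `coefLower` times exp(-2izt), for s = -i it is `coefUpper` times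
-- exp(2izt). Both oscillating primitives are therefore combinations of the four υⱼ, with
-- coefficients of modulus one.
theorem integral_coef_exp (s z : ℂ) {x : ℝ} (hx : x ∈ Set.Icc 0 π) :
    ∫ t in (0 : ℝ)..x, (-((Q t 0 1 + Q t 1 0) / 2) - s * Q t 0 0) *
      (Complex.cos (2 * z * t) - s * Complex.sin (2 * z * t)) =
      -upsilon Q 3 x z + s * upsilon Q 2 x z - s * upsilon Q 1 x z + s ^ 2 * upsilon Q 0 x z := by
  have hs : Continuous fun t : ℝ => Complex.sin (2 * z * t) := by fun_prop
  have hc : Continuous fun t : ℝ => Complex.cos (2 * z * t) := by fun_prop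
  have i0 := intervalIntegrable_of_muPi (integrable_mul_of_continuousOn (hQ 0 0) hs.continuousOn)
    zero_mem_Icc_pi hx
  have i1 := intervalIntegrable_of_muPi (integrable_mul_of_continuousOn (hQ 0 0) hc.continuousOn)
    zero_mem_Icc_pi hx
  have i2 := intervalIntegrable_of_muPi (integrable_mul_of_continuousOn
    ((hQ 0 1).add (hQ 1 0)) hs.continuousOn) zero_mem_Icc_pi hx
  have i3 := intervalIntegrable_of_muPi (integrable_mul_of_continuousOn
    ((hQ 0 1).add (hQ 1 0)) hc.continuousOn) zero_mem_Icc_pi hx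
  simp only [upsilon, Matrix.cons_val_zero, Matrix.cons_val_one, Matrix.cons_val,
    ← intervalIntegral.integral_const_mul]
  rw [← intervalIntegral.integral_neg, ← intervalIntegral.integral_add,
    ← intervalIntegral.integral_sub, ← intervalIntegral.integral_add]
  · refine intervalIntegral.integral_congr fun t _ => ?_
    ring
  · exact ((i3.const_mul _).neg.add ((i2.const_mul _).const_mul _)).sub (i1.const_mul _)
  · exact i0.const_mul _
  · exact (i3.const_mul _).neg.add ((i2.const_mul _).const_mul _)
  · exact i1.const_mul _
  · exact (i3.const_mul _).neg
  · exact (i2.const_mul _).const_mul _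

theorem norm_comb_upsilon_le (Q : ℝ → Matrix (Fin 2) (Fin 2) ℂ) {s : ℂ} (hs : ‖s‖ = 1) (z : ℂ)
    (x : ℝ) : ‖-upsilon Q 3 x z + s * upsilon Q 2 x z - s * upsilon Q 1 x z +
      s ^ 2 * upsilon Q 0 x z‖ ≤ UpsilonAt Q x z := by
  refine (norm_add_le _ _).trans ((add_le_add_left ((norm_sub_le _ _).trans
    (add_le_add_left (norm_add_le _ _) _)) _).trans ?_)
  rw [norm_neg, norm_mul, norm_mul, norm_mul, norm_pow, hs, UpsilonAt, Fin.sum_univ_four]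
  linarith

theorem exp_eq_cos_sub (z : ℂ) (t : ℝ) : Complex.exp (-(2 * Complex.I * z) * t) =
    Complex.cos (2 * z * t) - Complex.I * Complex.sin (2 * z * t) := by
  have := Complex.exp_mul_I (-(2 * z * t))
  rw [Complex.cos_neg, Complex.sin_neg] at this
  rw [show -(2 * Complex.I * z) * (t : ℂ) = -(2 * z * t) * Complex.I by ring, this]
  ring

/-- Closeness of the characteristic determinants in a horizontal strip. -/
theorem norm_charDet_sub_le_strip (htr : ∀ᵐ x ∂muPi, Q x 1 1 = -Q x 0 0)
    (U : Matrix (Fin 2) (Fin 4) ℂ) {r : ℝ} {z : ℂ} (hz : |z.im| ≤ r) :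
    ‖charDet hQ U z - freeDet (assocBC Q U) z‖ ≤ bdrySum U ^ 2 * ‖E Q‖ * (4 * Real.exp (π * r) *
      Real.exp (Real.exp (2 * r * π) * (2 * ∫ t, weight Q t ∂muPi)) *
      (UpsilonAt Q π z + Real.exp (2 * r * π) * ∫ t, weight Q t * UpsilonAt Q t z ∂muPi)) := by
  obtain ⟨ξ₁, η₁, ξ₂, η₂, h1, h2, a1, b1, a2, b2, hle⟩ := exists_norm_charDet_sub_le hQ htr U z
  refine hle.trans ?_
  have ha := integrable_coefLower hQ
  have hb := integrable_coefUpper hQ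
  have hw := integrable_weight hQ
  have hn := continuousOn_UpsilonAt hQ z
  have hn0 : ∀ x, 0 ≤ UpsilonAt Q x z := fun x => Finset.sum_nonneg fun _ _ => norm_nonneg _
  -- X bounds the increments of both components for initial data of total size 1. Two solutions with
  -- two components each give the factor 4 of the statement.
  set X := Real.exp (Real.exp (2 * r * π) * (2 * ∫ t, weight Q t ∂muPi)) *
      (UpsilonAt Q π z + Real.exp (2 * r * π) * ∫ t, weight Q t * UpsilonAt Q t z ∂muPi) with hX
  have hexp : Real.exp (Real.exp (2 * r * π) * ∫ t, (‖coefLower Q t‖ + ‖coefUpper Q t‖) ∂muPi) ≤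
      Real.exp (Real.exp (2 * r * π) * (2 * ∫ t, weight Q t ∂muPi)) := by
    gcongr
    rw [← integral_const_mul]
    refine integral_mono (ha.norm.add hb.norm) (hw.const_mul 2) fun t => ?_
    change ‖coefLower Q t‖ + ‖coefUpper Q t‖ ≤ 2 * weight Q t
    linarith [norm_coefLower_le Q t, norm_coefUpper_le Q t]
  have hint : ∀ c : ℝ → ℂ, Integrable c muPi → (∀ t, ‖c t‖ ≤ weight Q t) →
      ∫ t, ‖c t‖ * UpsilonAt Q t z ∂muPi ≤ ∫ t, weight Q t * UpsilonAt Q t z ∂muPi := by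
    intro c hc hcw
    exact integral_mono (integrable_mul_of_continuousOn_real hc.norm hn)
      (integrable_mul_of_continuousOn_real hw hn) fun t =>
        mul_le_mul_of_nonneg_right (hcw t) (hn0 t)
  have hfst : ∀ ξ η : ℝ → ℂ, DiracSys (coefLower Q) (coefUpper Q) z ξ η → ‖ξ 0‖ + ‖η 0‖ = 1 →
      ‖ξ π - ξ 0‖ ≤ X := by
    intro ξ η hs h0
    refine (hs.strip ha hb hz hn fun x hx => ?_).trans ?_
    · have := integral_coef_exp hQ Complex.I z hx
      simp only [exp_eq_cos_sub]
      simp only [coefLower]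
      rw [this]
      exact norm_comb_upsilon_le Q Complex.norm_I z x
    · rw [h0, one_mul, hX]
      exact mul_le_mul hexp (add_le_add_right (mul_le_mul_of_nonneg_left
        (hint _ hb (norm_coefUpper_le Q)) (Real.exp_pos _).le) _) (add_nonneg (hn0 _)
        (mul_nonneg (Real.exp_pos _).le (integral_nonneg fun t =>
          mul_nonneg (norm_nonneg _) (hn0 t)))) (Real.exp_pos _).le
  have hsnd : ∀ ξ η : ℝ → ℂ, DiracSys (coefLower Q) (coefUpper Q) z ξ η → ‖ξ 0‖ + ‖η 0‖ = 1 →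
      ‖η π - η 0‖ ≤ X := by
    intro ξ η hs h0
    refine (hs.swap.strip hb ha (by simpa using hz) hn fun x hx => ?_).trans ?_
    · have h1 : ∀ t : ℝ, coefUpper Q t * Complex.exp (-(2 * Complex.I * -z) * t) =
          (-((Q t 0 1 + Q t 1 0) / 2) - (-Complex.I) * Q t 0 0) *
            (Complex.cos (2 * z * t) - (-Complex.I) * Complex.sin (2 * z * t)) := by
        intro t
        rw [exp_eq_cos_sub, coefUpper, mul_neg, neg_mul, Complex.cos_neg, Complex.sin_neg]
        ring
      simp only [h1, integral_coef_exp hQ (-Complex.I) z hx]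
      exact norm_comb_upsilon_le Q (s := -Complex.I) (by simp) z x
    · rw [add_comm ‖η 0‖, h0, one_mul, hX]
      simp only [add_comm ‖coefUpper Q _‖]
      exact mul_le_mul hexp (add_le_add_right (mul_le_mul_of_nonneg_left
        (hint _ ha (norm_coefLower_le Q)) (Real.exp_pos _).le) _) (add_nonneg (hn0 _)
        (mul_nonneg (Real.exp_pos _).le (integral_nonneg fun t =>
          mul_nonneg (norm_nonneg _) (hn0 t)))) (Real.exp_pos _).le
  have i1 : ‖ξ₁ 0‖ + ‖η₁ 0‖ = 1 := by rw [a1, b1]; simp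
  have i2 : ‖ξ₂ 0‖ + ‖η₂ 0‖ = 1 := by rw [a2, b2]; simp
  have e1 : ‖Complex.exp (Complex.I * π * z)‖ ≤ Real.exp (π * r) := by
    rw [norm_exp_pi]
    refine Real.exp_le_exp.2 ?_
    nlinarith [(abs_le.1 hz).1, Real.pi_pos]
  have e2 : ‖Complex.exp (-(Complex.I * π * z))‖ ≤ Real.exp (π * r) := by
    rw [norm_exp_neg_pi]
    refine Real.exp_le_exp.2 ?_
    nlinarith [(abs_le.1 hz).2, Real.pi_pos]
  refine mul_le_mul_of_nonneg_left ?_ (by positivity)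
  calc _ ≤ Real.exp (π * r) * (X + X) + Real.exp (π * r) * (X + X) := by
        gcongr
        · exact hfst _ _ h1 i1
        · exact hfst _ _ h2 i2
        · exact hsnd _ _ h1 i1
        · exact hsnd _ _ h2 i2
    _ = _ := by rw [hX]; ring

end DetDifference


/-! ### Riemann–Lebesgue estimates and continuity of the υⱼ. -/

section OscillatoryIntegrals

/-- An exponential integral of a continuously differentiable function. -/
theorem norm_mul_integral_exp_le {g : ℝ → ℂ} (hg : ContDiff ℝ 1 g) {C K : ℝ} {w : ℂ} {x : ℝ}
    (hx : x ∈ Set.Icc 0 π) (hC : ∀ t ∈ Set.Icc 0 π, ‖g t‖ ≤ C)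
    (hC' : ∀ t ∈ Set.Icc 0 π, ‖deriv g t‖ ≤ C)
    (hK : ∀ t ∈ Set.Icc 0 π, ‖Complex.exp (w * (t : ℝ))‖ ≤ K) :
    ‖w‖ * ‖∫ t in (0 : ℝ)..x, g t * Complex.exp (w * t)‖ ≤ (2 + π) * (C * K) := by
  have hv : ∀ t : ℝ, HasDerivAt (fun t : ℝ => Complex.exp (w * t))
      (w * Complex.exp (w * t)) t := by
    intro t
    have h := ((Complex.ofRealCLM.hasDerivAt (x := t)).const_mul w).cexp
    simpa [mul_comm] using! h
  have hd := hg.continuous_deriv le_rfl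
  -- The two boundary terms are at most CK each and the remaining integral is at most π CK, whence 2
  -- + π.
  have hibp := intervalIntegral.integral_mul_deriv_eq_deriv_mul (a := 0) (b := x) (u := g)
    (v := fun t : ℝ => Complex.exp (w * t)) (u' := deriv g)
    (v' := fun t : ℝ => w * Complex.exp (w * t))
    (fun t _ => (hg.differentiable one_ne_zero t).hasDerivAt) (fun t _ => hv t)
    (hd.intervalIntegrable _ _) (Continuous.intervalIntegrable (by fun_prop) _ _)
  have hCK : ∀ t ∈ Set.Icc 0 π, ∀ y : ℂ, ‖y‖ ≤ C → ‖y * Complex.exp (w * (t : ℝ))‖ ≤ C * K := by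
    intro t ht y hy
    rw [norm_mul]
    exact mul_le_mul hy (hK t ht) (norm_nonneg _) ((norm_nonneg _).trans hy)
  have h0 := hCK 0 zero_mem_Icc_pi _ (hC 0 zero_mem_Icc_pi)
  have hCK0 : 0 ≤ C * K := (norm_nonneg _).trans h0
  have h1 : ‖∫ t in (0 : ℝ)..x, deriv g t * Complex.exp (w * t)‖ ≤ π * (C * K) := by
    refine (intervalIntegral.norm_integral_le_of_norm_le_const (C := C * K) fun t ht => ?_).trans ?_
    · rw [Set.uIoc_of_le hx.1] at ht
      have ht' : t ∈ Set.Icc 0 π := ⟨ht.1.le, ht.2.trans hx.2⟩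
      exact hCK t ht' _ (hC' t ht')
    · rw [sub_zero, abs_of_nonneg hx.1, mul_comm]
      exact mul_le_mul_of_nonneg_right hx.2 hCK0
  have h2 : w * ∫ t in (0 : ℝ)..x, g t * Complex.exp (w * t) =
      ∫ t in (0 : ℝ)..x, g t * (w * Complex.exp (w * t)) := by
    rw [← intervalIntegral.integral_const_mul]
    exact intervalIntegral.integral_congr fun t _ => by ring
  rw [← norm_mul, h2, hibp]
  refine (norm_sub_le _ _).trans ?_
  refine (add_le_add (norm_sub_le _ _) h1).trans ?_
  have h3 := hCK x hx _ (hC x hx)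
  linarith

/-- The Riemann–Lebesgue lemma, uniformly in a strip and with respect to the upper limit. -/
theorem exists_norm_integral_exp_le {q : ℝ → ℂ} (hq : Integrable q muPi) (h : ℝ) {η : ℝ}
    (hη : 0 < η) : ∃ X : ℝ, ∀ w : ℂ, |w.re| ≤ h → X ≤ ‖w‖ → ∀ x ∈ Set.Icc 0 π,
      ‖∫ t in (0 : ℝ)..x, q t * Complex.exp (w * t)‖ ≤ η := by
  set K := Real.exp (|h| * π) with hKdef
  have hK0 : 0 < K := Real.exp_pos _
  have hK : ∀ w : ℂ, |w.re| ≤ h → ∀ t ∈ Set.Icc 0 π, ‖Complex.exp (w * (t : ℝ))‖ ≤ K := by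
    intro w hw t ht
    rw [Complex.norm_exp, Complex.re_mul_ofReal]
    refine Real.exp_le_exp.2 ?_
    calc w.re * t ≤ |h| * t :=
          mul_le_mul_of_nonneg_right (((le_abs_self _).trans hw).trans (le_abs_self _)) ht.1
      _ ≤ |h| * π := mul_le_mul_of_nonneg_left ht.2 (abs_nonneg _)
  -- Approximation of q in L₁ by a smooth g: K bounds the exponentials in the strip, so the error
  -- contributes at most η/2, while the integral of g is O(1/‖w‖).
  obtain ⟨g, -, hg, hle⟩ := MemLp.exist_eLpNorm_sub_le (p := 1) (by simp) le_rfl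
    (memLp_one_iff_integrable.2 hq) (ε := η / (2 * K)) (by positivity)
  have hg1 : ContDiff ℝ 1 g := hg.of_le (by exact_mod_cast le_top)
  have hd := hg1.continuous_deriv le_rfl
  obtain ⟨C₁, hC₁⟩ := isCompact_Icc.exists_bound_of_continuousOn (s := Set.Icc 0 π)
    hg1.continuous.continuousOn
  obtain ⟨C₂, hC₂⟩ := isCompact_Icc.exists_bound_of_continuousOn (s := Set.Icc 0 π)
    hd.continuousOn
  set C := max C₁ C₂ with hCdef
  have hgi : Integrable g muPi :=
    hg1.continuous.continuousOn.integrableOn_compact isCompact_Icc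
  have hnorm : ∫ t, ‖q t - g t‖ ∂muPi ≤ η / (2 * K) := by
    have h1 := integral_norm_eq_lintegral_enorm (hq.sub hgi).aestronglyMeasurable
    rw [eLpNorm_one_eq_lintegral_enorm] at hle
    calc ∫ t, ‖q t - g t‖ ∂muPi = (∫⁻ t, ‖(q - g) t‖ₑ ∂muPi).toReal := h1
      _ ≤ η / (2 * K) := ENNReal.toReal_le_of_le_ofReal (by positivity) hle
  refine ⟨max 1 ((2 + π) * (C * K) / (η / 2)), fun w hw hX x hx => ?_⟩
  have hw1 : 1 ≤ ‖w‖ := (le_max_left _ _).trans hX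
  have hec : Continuous fun t : ℝ => Complex.exp (w * t) := by fun_prop
  have hi1 := integrable_mul_of_continuousOn hgi hec.continuousOn
  have hi2 := integrable_mul_of_continuousOn (hq.sub hgi) hec.continuousOn
  have hsplit : ∫ t in (0 : ℝ)..x, q t * Complex.exp (w * t) =
      (∫ t in (0 : ℝ)..x, g t * Complex.exp (w * t)) +
        ∫ t in (0 : ℝ)..x, (q - g) t * Complex.exp (w * t) := by
    rw [← intervalIntegral.integral_add (intervalIntegrable_of_muPi hi1 zero_mem_Icc_pi hx)
      (intervalIntegrable_of_muPi hi2 zero_mem_Icc_pi hx)]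
    refine intervalIntegral.integral_congr fun t _ => ?_
    simp only [Pi.sub_apply]
    ring
  have hb1 := norm_mul_integral_exp_le hg1 hx (C := C)
    (fun t ht => (hC₁ t ht).trans (le_max_left _ _))
    (fun t ht => (hC₂ t ht).trans (le_max_right _ _)) (hK w hw)
  have hb1' : ‖∫ t in (0 : ℝ)..x, g t * Complex.exp (w * t)‖ ≤ η / 2 := by
    have hX' := (le_max_right _ _).trans hX
    rw [div_le_iff₀ (by positivity)] at hX'
    refine le_of_mul_le_mul_left ?_ (zero_lt_one.trans_le hw1)
    exact hb1.trans hX'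
  have hb2 : ‖∫ t in (0 : ℝ)..x, (q - g) t * Complex.exp (w * t)‖ ≤ η / 2 := by
    have hin := ((hq.sub hgi).norm.mul_const K)
    calc _ ≤ ∫ t in (0 : ℝ)..x, ‖(q - g) t‖ * K := by
          refine norm_integral_le_muPi hin ?_ hx
          filter_upwards [ae_mem_Ioo] with t ht
          rw [norm_mul]
          exact mul_le_mul_of_nonneg_left (hK w hw t ⟨ht.1.le, ht.2.le⟩) (norm_nonneg _)
      _ ≤ ∫ t, ‖(q - g) t‖ * K ∂muPi :=
          integral_le_muPi hin (Eventually.of_forall fun t => by positivity) hx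
      _ = (∫ t, ‖q t - g t‖ ∂muPi) * K := integral_mul_const _ _
      _ ≤ η / (2 * K) * K := mul_le_mul_of_nonneg_right hnorm hK0.le
      _ = η / 2 := by field_simp
  rw [hsplit]
  exact (norm_add_le _ _).trans (by linarith)

/-- Euler's formulas with w = ±2iz; then |Re w| = 2 |Im z|, so the exponential estimate is needed in
a strip of twice the width. -/
theorem exists_norm_integral_sin_cos_le {q : ℝ → ℂ} (hq : Integrable q muPi) (h : ℝ) {η : ℝ}
    (hη : 0 < η) : ∃ X : ℝ, ∀ z : ℂ, |z.im| ≤ h → X ≤ ‖z‖ → ∀ x ∈ Set.Icc 0 π,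
      ‖∫ t in (0 : ℝ)..x, q t * Complex.sin (2 * z * t)‖ ≤ η ∧
      ‖∫ t in (0 : ℝ)..x, q t * Complex.cos (2 * z * t)‖ ≤ η := by
  obtain ⟨X, hX⟩ := exists_norm_integral_exp_le hq (2 * h) hη
  refine ⟨X / 2, fun z hz hzX x hx => ?_⟩
  have hn : ‖2 * z * Complex.I‖ = 2 * ‖z‖ := by simp
  have hre : (2 * z * Complex.I).re = -(2 * z.im) := by simp
  have h1 := hX (2 * z * Complex.I) (by rw [hre, abs_neg, abs_mul, abs_two]; linarith)
    (by rw [hn]; linarith) x hx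
  have h2 := hX (-(2 * z * Complex.I))
    (by rw [Complex.neg_re, hre, neg_neg, abs_mul, abs_two]; linarith)
    (by rw [norm_neg, hn]; linarith) x hx
  have hec : ∀ w : ℂ, IntervalIntegrable (fun t => q t * Complex.exp (w * t)) volume 0 x := by
    intro w
    have hc : Continuous fun t : ℝ => Complex.exp (w * t) := by fun_prop
    exact intervalIntegrable_of_muPi (integrable_mul_of_continuousOn hq hc.continuousOn)
      zero_mem_Icc_pi hx
  have hsin : ∫ t in (0 : ℝ)..x, q t * Complex.sin (2 * z * t) =
      ((∫ t in (0 : ℝ)..x, q t * Complex.exp (-(2 * z * Complex.I) * t)) -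
        ∫ t in (0 : ℝ)..x, q t * Complex.exp (2 * z * Complex.I * t)) * (Complex.I / 2) := by
    rw [← intervalIntegral.integral_sub (hec _) (hec _), ← intervalIntegral.integral_mul_const]
    refine intervalIntegral.integral_congr fun t _ => ?_
    simp only [Complex.sin]
    ring_nf
  have hcos : ∫ t in (0 : ℝ)..x, q t * Complex.cos (2 * z * t) =
      ((∫ t in (0 : ℝ)..x, q t * Complex.exp (2 * z * Complex.I * t)) +
        ∫ t in (0 : ℝ)..x, q t * Complex.exp (-(2 * z * Complex.I) * t)) * (1 / 2) := by
    rw [← intervalIntegral.integral_add (hec _) (hec _), ← intervalIntegral.integral_mul_const]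
    refine intervalIntegral.integral_congr fun t _ => ?_
    simp only [Complex.cos]
    ring_nf
  rw [hsin, hcos, norm_mul, norm_mul, norm_div, Complex.norm_I, norm_div, norm_one,
    Complex.norm_ofNat]
  constructor
  · have := norm_sub_le (∫ t in (0 : ℝ)..x, q t * Complex.exp (-(2 * z * Complex.I) * t))
      (∫ t in (0 : ℝ)..x, q t * Complex.exp (2 * z * Complex.I * t))
    linarith
  · have := norm_add_le (∫ t in (0 : ℝ)..x, q t * Complex.exp (2 * z * Complex.I * t))
      (∫ t in (0 : ℝ)..x, q t * Complex.exp (-(2 * z * Complex.I) * t))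
    linarith

variable {Q : ℝ → Matrix (Fin 2) (Fin 2) ℂ} (hQ : EntryIntegrable Q)

include hQ in
theorem exists_norm_upsilon_le (h : ℝ) {η : ℝ} (hη : 0 < η) :
    ∃ X : ℝ, ∀ z : ℂ, |z.im| ≤ h → X ≤ ‖z‖ → ∀ x ∈ Set.Icc 0 π, ∀ j, ‖upsilon Q j x z‖ ≤ η := by
  obtain ⟨X₁, h₁⟩ := exists_norm_integral_sin_cos_le (hQ 0 0) h hη
  obtain ⟨X₂, h₂⟩ := exists_norm_integral_sin_cos_le ((hQ 0 1).add (hQ 1 0)) h hη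
  refine ⟨max X₁ X₂, fun z hz hX x hx j => ?_⟩
  obtain ⟨a, b⟩ := h₁ z hz ((le_max_left _ _).trans hX) x hx
  obtain ⟨c, d⟩ := h₂ z hz ((le_max_right _ _).trans hX) x hx
  simp only [Pi.add_apply] at c d
  have hhalf : ∀ y : ℂ, ‖y‖ ≤ η → ‖1 / 2 * y‖ ≤ η := by
    intro y hy
    rw [norm_mul, norm_div, norm_one, Complex.norm_ofNat]
    linarith [norm_nonneg y]
  fin_cases j
  · exact a
  · exact b
  · exact hhalf _ c
  · exact hhalf _ d

/-- Continuous dependence of integrals with a summable weight on a parameter, uniformly in the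
upper limit. -/
theorem eventually_norm_integral_sub_le {q : ℝ → ℂ} (hq : Integrable q muPi) {φ : ℂ → ℝ → ℂ}
    (hφ : Continuous fun w : ℂ × ℝ => φ w.1 w.2) (z : ℂ) {η : ℝ} (hη : 0 < η) :
    ∀ᶠ w in 𝓝 z, ∀ x ∈ Set.Icc 0 π,
      ‖(∫ t in (0 : ℝ)..x, q t * φ w t) - ∫ t in (0 : ℝ)..x, q t * φ z t‖ ≤ η := by
  set N := ∫ t, ‖q t‖ ∂muPi with hN
  have hN0 : 0 ≤ N := integral_nonneg fun _ => norm_nonneg _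
  have hη' : 0 < η / (N + 1) := by positivity
  have hφc : ∀ w, Continuous (φ w) := fun w => hφ.comp (Continuous.prodMk_right w)
  -- Compactness of [0, π] makes the continuity of φ in the parameter uniform in t. The denominator
  -- N + 1 covers the case N = 0.
  have hev : ∀ᶠ w in 𝓝 z, ∀ t ∈ Set.Icc 0 π, ‖φ w t - φ z t‖ < η / (N + 1) := by
    refine isCompact_Icc.eventually_forall_of_forall_eventually fun t _ => ?_
    have hc : Continuous fun w : ℂ × ℝ => ‖φ w.1 w.2 - φ z w.2‖ :=
      (hφ.sub ((hφc z).comp continuous_snd)).norm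
    exact (hc.tendsto (z, t)).eventually_lt_const (by simpa using hη')
  filter_upwards [hev] with w hw x hx
  have i1 := integrable_mul_of_continuousOn hq (hφc w).continuousOn
  have i2 := integrable_mul_of_continuousOn hq (hφc z).continuousOn
  have hin := hq.norm.mul_const (η / (N + 1))
  rw [← intervalIntegral.integral_sub (intervalIntegrable_of_muPi i1 zero_mem_Icc_pi hx)
    (intervalIntegrable_of_muPi i2 zero_mem_Icc_pi hx)]
  calc _ ≤ ∫ t in (0 : ℝ)..x, ‖q t‖ * (η / (N + 1)) := by
        refine norm_integral_le_muPi hin ?_ hx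
        filter_upwards [ae_mem_Ioo] with t ht
        rw [← mul_sub, norm_mul]
        exact mul_le_mul_of_nonneg_left (hw t ⟨ht.1.le, ht.2.le⟩).le (norm_nonneg _)
    _ ≤ ∫ t, ‖q t‖ * (η / (N + 1)) ∂muPi :=
        integral_le_muPi hin (Eventually.of_forall fun t => by positivity) hx
    _ = N * (η / (N + 1)) := integral_mul_const _ _
    _ ≤ η := by
        rw [mul_div_assoc', div_le_iff₀ (by positivity)]
        nlinarith

include hQ in
theorem eventually_norm_upsilon_sub_le (j : Fin 4) (z : ℂ) {η : ℝ} (hη : 0 < η) :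
    ∀ᶠ w in 𝓝 z, ∀ x ∈ Set.Icc 0 π, ‖upsilon Q j x w - upsilon Q j x z‖ ≤ η := by
  have hs : Continuous fun w : ℂ × ℝ => Complex.sin (2 * w.1 * w.2) := by fun_prop
  have hc : Continuous fun w : ℂ × ℝ => Complex.cos (2 * w.1 * w.2) := by fun_prop
  have hhalf : ∀ y y' : ℂ, ‖y - y'‖ ≤ η → ‖1 / 2 * y - 1 / 2 * y'‖ ≤ η := by
    intro y y' hy
    rw [← mul_sub, norm_mul, norm_div, norm_one, Complex.norm_ofNat]
    linarith [norm_nonneg (y - y')]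
  fin_cases j
  · exact eventually_norm_integral_sub_le (φ := fun w t => Complex.sin (2 * w * t)) (hQ 0 0) hs z hη
  · exact eventually_norm_integral_sub_le (φ := fun w t => Complex.cos (2 * w * t)) (hQ 0 0) hc z hη
  · exact (eventually_norm_integral_sub_le (φ := fun w t => Complex.sin (2 * w * t))
      ((hQ 0 1).add (hQ 1 0)) hs z hη).mono fun w hw x hx => hhalf _ _ (hw x hx)
  · exact (eventually_norm_integral_sub_le (φ := fun w t => Complex.cos (2 * w * t))
      ((hQ 0 1).add (hQ 1 0)) hc z hη).mono fun w hw x hx => hhalf _ _ (hw x hx)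

end OscillatoryIntegrals


/-! ### Hölder's inequality and the remainder constant; the case of vanishing remainder. -/

section Remainder

variable {Q : ℝ → Matrix (Fin 2) (Fin 2) ℂ}

theorem memLp_of_continuousOn {f : ℝ → ℂ} (hf : ContinuousOn f (Set.Icc 0 π)) (ν : ℝ≥0∞) :
    MemLp f ν muPi := by
  obtain ⟨C, hC⟩ := isCompact_Icc.exists_bound_of_continuousOn hf
  refine MemLp.of_bound (hf.aestronglyMeasurable measurableSet_Icc) C ?_
  filter_upwards [ae_mem_Ioo] with x hx using hC x ⟨hx.1.le, hx.2.le⟩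

/-- The `L_ν` norm is controlled by the supremum norm. -/
theorem eLpNorm_toReal_le {f : ℝ → ℂ} {η : ℝ} (hη : 0 ≤ η) (ν : ℝ≥0∞)
    (hf : ∀ x ∈ Set.Icc 0 π, ‖f x‖ ≤ η) :
    (eLpNorm f ν muPi).toReal ≤ (muPi Set.univ ^ ν.toReal⁻¹).toReal * η := by
  have h1 : eLpNorm f ν muPi ≤ muPi Set.univ ^ ν.toReal⁻¹ * ENNReal.ofReal η := by
    refine eLpNorm_le_of_ae_bound ?_
    filter_upwards [ae_mem_Ioo] with x hx using hf x ⟨hx.1.le, hx.2.le⟩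
  have h2 : muPi Set.univ ^ ν.toReal⁻¹ ≠ ⊤ :=
    ENNReal.rpow_ne_top_of_nonneg (by positivity) (measure_ne_top _ _)
  refine (ENNReal.toReal_mono (ENNReal.mul_ne_top h2 ENNReal.ofReal_ne_top) h1).trans_eq ?_
  rw [ENNReal.toReal_mul, ENNReal.toReal_ofReal hη]

/-- The reverse triangle inequality, which needs ν ≥ 1. Continuous functions have finite norms, so
passing to real numbers loses nothing. -/
theorem abs_eLpNorm_toReal_sub_le {f g : ℝ → ℂ} (hf : ContinuousOn f (Set.Icc 0 π))
    (hg : ContinuousOn g (Set.Icc 0 π)) {ν : ℝ≥0∞} (hν : 1 ≤ ν) :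
    |(eLpNorm f ν muPi).toReal - (eLpNorm g ν muPi).toReal| ≤
      (eLpNorm (f - g) ν muPi).toReal := by
  have key : ∀ {f g : ℝ → ℂ}, MemLp f ν muPi → MemLp g ν muPi →
      (eLpNorm f ν muPi).toReal - (eLpNorm g ν muPi).toReal ≤
        (eLpNorm (f - g) ν muPi).toReal := by
    intro f g hf hg
    have h1 : eLpNorm f ν muPi ≤ eLpNorm (f - g) ν muPi + eLpNorm g ν muPi := by
      have := eLpNorm_add_le (hf.sub hg).1 hg.1 hν
      rwa [sub_add_cancel] at this
    have h2 := ENNReal.toReal_mono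
      (ENNReal.add_ne_top.2 ⟨(hf.sub hg).eLpNorm_ne_top, hg.eLpNorm_ne_top⟩) h1
    rw [ENNReal.toReal_add (hf.sub hg).eLpNorm_ne_top hg.eLpNorm_ne_top] at h2
    linarith
  have hf' := memLp_of_continuousOn hf ν
  have hg' := memLp_of_continuousOn hg ν
  refine abs_sub_le_iff.2 ⟨key hf' hg', ?_⟩
  rw [eLpNorm_sub_comm]
  exact key hg' hf'

/-- The sum `Υ(π, z) + Υ_ν(z)`, the maximum of which is `discMax`. -/
noncomputable def upsilonTotal (Q : ℝ → Matrix (Fin 2) (Fin 2) ℂ) (ν : ℝ≥0∞) (z : ℂ) : ℝ :=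
  UpsilonAt Q π z + UpsilonNorm Q ν z

theorem UpsilonAt_nonneg (Q : ℝ → Matrix (Fin 2) (Fin 2) ℂ) (x : ℝ) (z : ℂ) :
    0 ≤ UpsilonAt Q x z := Finset.sum_nonneg fun _ _ => norm_nonneg _

theorem UpsilonNorm_nonneg (Q : ℝ → Matrix (Fin 2) (Fin 2) ℂ) (ν : ℝ≥0∞) (z : ℂ) :
    0 ≤ UpsilonNorm Q ν z := Finset.sum_nonneg fun _ _ => ENNReal.toReal_nonneg

theorem upsilonTotal_nonneg (Q : ℝ → Matrix (Fin 2) (Fin 2) ℂ) (ν : ℝ≥0∞) (z : ℂ) :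
    0 ≤ upsilonTotal Q ν z := add_nonneg (UpsilonAt_nonneg Q π z) (UpsilonNorm_nonneg Q ν z)

/-- The υⱼ depend continuously on z uniformly in x, and a uniform bound on [0, π] controls the L_ν
norm up to the constant c. -/
theorem continuous_upsilonTotal (hQ : EntryIntegrable Q) {ν : ℝ≥0∞} (hν : 1 ≤ ν) :
    Continuous (upsilonTotal Q ν) := by
  refine Continuous.add (continuous_finsetSum _ fun j _ => Continuous.norm ?_)
    (continuous_finsetSum _ fun j _ => ?_)
  · refine continuous_iff_continuousAt.2 fun z => Metric.tendsto_nhds.2 fun η hη => ?_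
    filter_upwards [eventually_norm_upsilon_sub_le hQ j z (half_pos hη)] with w hw
    rw [dist_eq_norm]
    exact (hw π pi_mem_Icc_pi).trans_lt (half_lt_self hη)
  · refine continuous_iff_continuousAt.2 fun z => Metric.tendsto_nhds.2 fun η hη => ?_
    set c := (muPi Set.univ ^ ν.toReal⁻¹).toReal with hc
    have hc0 : 0 ≤ c := ENNReal.toReal_nonneg
    have hη' : 0 < η / (c + 1) := by positivity
    filter_upwards [eventually_norm_upsilon_sub_le hQ j z hη'] with w hw
    rw [Real.dist_eq]
    refine (abs_eLpNorm_toReal_sub_le (continuousOn_upsilon hQ j w) (continuousOn_upsilon hQ j z)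
      hν).trans_lt ((eLpNorm_toReal_le hη'.le ν hw).trans_lt ?_)
    rw [mul_div_assoc', div_lt_iff₀ (by positivity)]
    nlinarith

/-- Decay of `Υ(π, z) + Υ_ν(z)` in a horizontal strip. -/
theorem exists_upsilonTotal_le (hQ : EntryIntegrable Q) (ν : ℝ≥0∞) (h : ℝ) {η : ℝ} (hη : 0 < η) :
    ∃ X : ℝ, ∀ z : ℂ, |z.im| ≤ h → X ≤ ‖z‖ → upsilonTotal Q ν z ≤ η := by
  set c := (muPi Set.univ ^ ν.toReal⁻¹).toReal with hc
  have hc0 : 0 ≤ c := ENNReal.toReal_nonneg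
  -- Four values at π and four norms, each at most c times the supremum, add up to 4(1 + c) times
  -- this number.
  have hη' : 0 < η / (4 * (c + 1)) := by positivity
  obtain ⟨X, hX⟩ := exists_norm_upsilon_le hQ h hη'
  refine ⟨X, fun z hz hzX => ?_⟩
  have h1 : UpsilonAt Q π z ≤ ∑ _j : Fin 4, η / (4 * (c + 1)) :=
    Finset.sum_le_sum fun j _ => hX z hz hzX π pi_mem_Icc_pi j
  have h2 : UpsilonNorm Q ν z ≤ ∑ _j : Fin 4, c * (η / (4 * (c + 1))) :=
    Finset.sum_le_sum fun j _ => eLpNorm_toReal_le hη'.le ν fun x hx => hX z hz hzX x hx j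
  simp only [Finset.sum_const, Finset.card_univ, Fintype.card_fin, nsmul_eq_mul] at h1 h2
  refine (add_le_add h1 h2).trans_eq ?_
  field_simp
  push_cast
  ring

/-- Hölder's inequality for the weight of the remainder. -/
theorem integral_norm_mul_norm_le {p p' : ℝ≥0∞} (hp : p⁻¹ + p'⁻¹ = 1) {q f : ℝ → ℂ}
    (hq : Integrable q muPi) {R : ℝ} (hR : 0 ≤ R) (hqR : eLpNorm q p muPi ≤ ENNReal.ofReal R)
    (hf : ContinuousOn f (Set.Icc 0 π)) :
    ∫ x, ‖q x‖ * ‖f x‖ ∂muPi ≤ R * (eLpNorm f p' muPi).toReal := by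
  have : ENNReal.HolderTriple p p' 1 := ⟨by rw [hp, inv_one]⟩
  have hfm := memLp_of_continuousOn hf p'
  have hi : Integrable (q • f) muPi := integrable_mul_of_continuousOn hq hf
  have h1 := integral_norm_eq_lintegral_enorm hi.aestronglyMeasurable
  have h2 : eLpNorm (q • f) 1 muPi ≤ ENNReal.ofReal R * eLpNorm f p' muPi :=
    (eLpNorm_smul_le_mul_eLpNorm hfm.1 hq.aestronglyMeasurable).trans (by gcongr)
  rw [eLpNorm_one_eq_lintegral_enorm] at h2
  have h3 := ENNReal.toReal_mono
    (ENNReal.mul_ne_top ENNReal.ofReal_ne_top hfm.eLpNorm_ne_top) h2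
  rw [← h1, ENNReal.toReal_mul, ENNReal.toReal_ofReal hR] at h3
  refine le_trans (le_of_eq (integral_congr_ae (Eventually.of_forall fun x => ?_))) h3
  simp

theorem Admissible.nonneg {p : ℝ≥0∞} {R : ℝ} (hQ : Admissible p R Q) : 0 ≤ R :=
  (Finset.sum_nonneg fun _ _ => Finset.sum_nonneg fun _ _ =>
    integral_nonneg fun _ => norm_nonneg _).trans hQ.norm_le

theorem Admissible.sum_le {p : ℝ≥0∞} {R : ℝ} (hQ : Admissible p R Q) :
    (∫ x, ‖Q x 0 0‖ ∂muPi) + (∫ x, ‖Q x 0 1‖ ∂muPi) + ∫ x, ‖Q x 1 0‖ ∂muPi ≤ R := by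
  have h := hQ.norm_le
  simp only [Fin.sum_univ_two] at h
  have : 0 ≤ ∫ x, ‖Q x 1 1‖ ∂muPi := integral_nonneg fun _ => norm_nonneg _
  linarith

theorem Admissible.integral_weight_le {p : ℝ≥0∞} {R : ℝ} (hQ : Admissible p R Q) :
    ∫ x, weight Q x ∂muPi ≤ R := by
  have h := hQ.sum_le
  have h0 := hQ.integrable
  have h1 : ∫ x, ‖Q x 0 1 + Q x 1 0‖ ∂muPi ≤
      (∫ x, ‖Q x 0 1‖ ∂muPi) + ∫ x, ‖Q x 1 0‖ ∂muPi := by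
    rw [← integral_add (h0 0 1).norm (h0 1 0).norm]
    exact integral_mono ((h0 0 1).add (h0 1 0)).norm ((h0 0 1).norm.add (h0 1 0).norm)
      fun x => norm_add_le _ _
  have h2 : ∫ x, weight Q x ∂muPi = (∫ x, ‖Q x 0 0‖ ∂muPi) + ∫ x, ‖Q x 0 1 + Q x 1 0‖ ∂muPi :=
    integral_add (h0 0 0).norm ((h0 0 1).add (h0 1 0)).norm
  linarith

/-- Together with the bound on the weight, this keeps the remainder constant dependent on R only and
not on Q. -/
theorem Admissible.norm_E_le {p : ℝ≥0∞} {R : ℝ} (hQ : Admissible p R Q) :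
    ‖E Q‖ ≤ Real.exp R := by
  have h := hQ.sum_le
  have h0 := hQ.integrable
  have h1 : ‖∫ t in (0 : ℝ)..π, (Q t 0 1 - Q t 1 0)‖ ≤
      (∫ x, ‖Q x 0 1‖ ∂muPi) + ∫ x, ‖Q x 1 0‖ ∂muPi := by
    rw [← integral_muPi, ← integral_add (h0 0 1).norm (h0 1 0).norm]
    exact norm_integral_le_of_norm_le ((h0 0 1).norm.add (h0 1 0).norm)
      (Eventually.of_forall fun x => norm_sub_le _ _)
  have h2 : 0 ≤ ∫ x, ‖Q x 0 0‖ ∂muPi := integral_nonneg fun _ => norm_nonneg _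
  rw [E, Complex.norm_exp]
  refine Real.exp_le_exp.2 ((Complex.re_le_norm _).trans ?_)
  rw [norm_mul, norm_div, norm_one, Complex.norm_ofNat]
  have := norm_nonneg (∫ t in (0 : ℝ)..π, (Q t 0 1 - Q t 1 0))
  linarith

/-- Hölder's inequality applied to each of the two densities |q₁| and |q₂ + q₃|, both of L_p norm at
most R; this produces 2R and explains the L_{p'} norm in the definition of sₙ. -/
theorem Admissible.integral_weight_mul_le {p p' : ℝ≥0∞} (hp : p⁻¹ + p'⁻¹ = 1) {R : ℝ}
    (hQ : Admissible p R Q) (z : ℂ) :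
    ∫ t, weight Q t * UpsilonAt Q t z ∂muPi ≤ 2 * R * UpsilonNorm Q p' z := by
  have h0 := hQ.integrable
  have hs : Integrable (fun x => Q x 0 1 + Q x 1 0) muPi := (h0 0 1).add (h0 1 0)
  have hc := fun j => continuousOn_upsilon h0 j z
  have hi1 := fun j => integrable_mul_of_continuousOn_real (h0 0 0).norm (hc j).norm
  have hi2 := fun j => integrable_mul_of_continuousOn_real hs.norm (hc j).norm
  have heq : ∀ t, weight Q t * UpsilonAt Q t z = ∑ j : Fin 4, (‖Q t 0 0‖ * ‖upsilon Q j t z‖ +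
      ‖Q t 0 1 + Q t 1 0‖ * ‖upsilon Q j t z‖) := by
    intro t
    rw [weight, UpsilonAt, Finset.mul_sum]
    exact Finset.sum_congr rfl fun j _ => add_mul _ _ _
  have hsum : ∫ t, weight Q t * UpsilonAt Q t z ∂muPi = ∑ j : Fin 4,
      ((∫ t, ‖Q t 0 0‖ * ‖upsilon Q j t z‖ ∂muPi) +
        ∫ t, ‖Q t 0 1 + Q t 1 0‖ * ‖upsilon Q j t z‖ ∂muPi) := by
    refine (integral_congr_ae (Eventually.of_forall heq)).trans ?_
    refine (integral_finsetSum _ fun j _ => (hi1 j).add (hi2 j)).trans ?_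
    exact Finset.sum_congr rfl fun j _ => integral_add (hi1 j) (hi2 j)
  rw [hsum, UpsilonNorm, Finset.mul_sum]
  refine Finset.sum_le_sum fun j _ => ?_
  have e1 := integral_norm_mul_norm_le hp (h0 0 0) hQ.nonneg hQ.diag_le (hc j)
  have e2 := integral_norm_mul_norm_le hp hs hQ.nonneg hQ.offdiag_le (hc j)
  linarith

/-- The constant in the estimate of the difference of the characteristic determinants. -/
noncomputable def remainderConst (U : Matrix (Fin 2) (Fin 4) ℂ) (R r : ℝ) : ℝ :=
  bdrySum U ^ 2 * Real.exp R * (4 * Real.exp (π * r) *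
      Real.exp (Real.exp (2 * r * π) * (2 * R)) * (1 + Real.exp (2 * r * π) * (2 * R)))

theorem remainderConst_nonneg (U : Matrix (Fin 2) (Fin 4) ℂ) {R : ℝ} (hR : 0 ≤ R) (r : ℝ) :
    0 ≤ remainderConst U R r := by
  rw [remainderConst]
  positivity

/-- Closeness of the characteristic determinants in a horizontal strip, in terms of `Υ`. -/
theorem Admissible.norm_charDet_sub_le {p p' : ℝ≥0∞} (hp : p⁻¹ + p'⁻¹ = 1) {R : ℝ}
    (hQ : Admissible p R Q) (U : Matrix (Fin 2) (Fin 4) ℂ) {r : ℝ} {z : ℂ} (hz : |z.im| ≤ r) :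
    ‖charDet hQ.integrable U z - freeDet (assocBC Q U) z‖ ≤
      remainderConst U R r * upsilonTotal Q p' z := by
  refine (norm_charDet_sub_le_strip hQ.integrable hQ.trace_zero U hz).trans ?_
  have hR := hQ.nonneg
  have h1 := hQ.integral_weight_le
  have h2 := hQ.integral_weight_mul_le hp z
  have h3 := UpsilonAt_nonneg Q π z
  have h4 := UpsilonNorm_nonneg Q p' z
  have hg := Real.exp_pos (2 * r * π)
  have h5 : 0 ≤ ∫ t, weight Q t * UpsilonAt Q t z ∂muPi :=
    integral_nonneg fun t => mul_nonneg (add_nonneg (norm_nonneg _) (norm_nonneg _))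
      (UpsilonAt_nonneg Q t z)
  have h6 : UpsilonAt Q π z + Real.exp (2 * r * π) * ∫ t, weight Q t * UpsilonAt Q t z ∂muPi ≤
      (1 + Real.exp (2 * r * π) * (2 * R)) * upsilonTotal Q p' z := by
    rw [upsilonTotal]
    have e1 := mul_le_mul_of_nonneg_left h2 hg.le
    have e2 : 0 ≤ Real.exp (2 * r * π) * (2 * R) * UpsilonAt Q π z := by positivity
    nlinarith
  have h7 : Real.exp (Real.exp (2 * r * π) * (2 * ∫ t, weight Q t ∂muPi)) ≤
      Real.exp (Real.exp (2 * r * π) * (2 * R)) :=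
    Real.exp_le_exp.2 (mul_le_mul_of_nonneg_left (by linarith) hg.le)
  have h8 := hQ.norm_E_le
  have h9 : 0 ≤ UpsilonAt Q π z +
      Real.exp (2 * r * π) * ∫ t, weight Q t * UpsilonAt Q t z ∂muPi := by positivity
  calc _ ≤ bdrySum U ^ 2 * Real.exp R * (4 * Real.exp (π * r) *
        Real.exp (Real.exp (2 * r * π) * (2 * R)) *
        ((1 + Real.exp (2 * r * π) * (2 * R)) * upsilonTotal Q p' z)) := by gcongr
    _ = _ := by rw [remainderConst]; ring

/-- A function with vanishing primitive vanishes almost everywhere. -/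
theorem ae_eq_zero_of_integral_eq_zero {d : ℝ → ℂ} (hd : Integrable d muPi)
    (h : ∀ x ∈ Set.Icc 0 π, ∫ t in (0 : ℝ)..x, d t = 0) : ∀ᵐ x ∂muPi, d x = 0 := by
  filter_upwards [(isPrim_integral hd 0).ae_hasDerivAt, ae_mem_Ioo] with x hx hm
  refine hx.unique ((hasDerivAt_const x (0 : ℂ)).congr_of_eventuallyEq ?_)
  filter_upwards [Icc_mem_nhds hm.1 hm.2] with t ht
  rw [h t ht, add_zero]

/-- Both q sin and q cos have vanishing primitives, hence vanish almost everywhere, and sin² + cos²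
= 1 recovers q. -/
theorem ae_eq_zero_of_integral_sin_cos {q : ℝ → ℂ} (hq : Integrable q muPi) {z : ℂ}
    (hs : ∀ x ∈ Set.Icc 0 π, ∫ t in (0 : ℝ)..x, q t * Complex.sin (2 * z * t) = 0)
    (hc : ∀ x ∈ Set.Icc 0 π, ∫ t in (0 : ℝ)..x, q t * Complex.cos (2 * z * t) = 0) :
    ∀ᵐ x ∂muPi, q x = 0 := by
  have c1 : Continuous fun t : ℝ => Complex.sin (2 * z * t) := by fun_prop
  have c2 : Continuous fun t : ℝ => Complex.cos (2 * z * t) := by fun_prop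
  filter_upwards [ae_eq_zero_of_integral_eq_zero (integrable_mul_of_continuousOn hq
    c1.continuousOn) hs, ae_eq_zero_of_integral_eq_zero (integrable_mul_of_continuousOn hq
    c2.continuousOn) hc] with x h1 h2
  have h3 := Complex.sin_sq_add_cos_sq (2 * z * x)
  linear_combination (Complex.sin (2 * z * x)) * h1 + (Complex.cos (2 * z * x)) * h2 - q x * h3

theorem eq_zero_of_eLpNorm_eq_zero {f : ℝ → ℂ} (hf : ContinuousOn f (Set.Icc 0 π)) {ν : ℝ≥0∞}
    (hν : 1 ≤ ν) (h : (eLpNorm f ν muPi).toReal = 0) : ∀ x ∈ Set.Icc 0 π, f x = 0 := by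
  have hm := memLp_of_continuousOn hf ν
  have h1 := (ENNReal.toReal_eq_zero_iff _).1 h |>.resolve_right hm.eLpNorm_ne_top
  rw [eLpNorm_eq_zero_iff hm.1 (by positivity)] at h1
  exact Measure.eqOn_Icc_of_ae_eq (μ := volume) Real.pi_pos.ne h1 hf continuousOn_const

/-- If `Υ(π, ·) + Υ_ν` vanishes at one point, then `q₁ = q₂ + q₃ = 0` and both characteristic
determinants are equal. -/
theorem charDet_eq_freeDet_of_weight (hQ : EntryIntegrable Q)
    (htr : ∀ᵐ x ∂muPi, Q x 1 1 = -Q x 0 0) (U : Matrix (Fin 2) (Fin 4) ℂ)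
    (h1 : ∀ᵐ x ∂muPi, Q x 0 0 = 0) (h2 : ∀ᵐ x ∂muPi, Q x 0 1 + Q x 1 0 = 0) (z : ℂ) :
    charDet hQ U z = freeDet (assocBC Q U) z := by
  have hint : ∀ {q : ℝ → ℂ} (g : ℝ → ℂ), (∀ᵐ x ∂muPi, q x = 0) → ∀ x ∈ Set.Icc 0 π,
      ∫ t in (0 : ℝ)..x, q t * g t = 0 := by
    intro q g hq x hx
    rw [integral_congr_muPi (g := fun _ => 0) (hq.mono fun t ht => by rw [ht, zero_mul]) hx]
    simp
  have hU : ∀ x ∈ Set.Icc 0 π, UpsilonAt Q x z = 0 := by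
    intro x hx
    have := hint (fun t => Complex.sin (2 * z * t)) h1 x hx
    have := hint (fun t => Complex.cos (2 * z * t)) h1 x hx
    have := hint (fun t => Complex.sin (2 * z * t)) h2 x hx
    have := hint (fun t => Complex.cos (2 * z * t)) h2 x hx
    simp only [UpsilonAt, upsilon, Fin.sum_univ_four, Matrix.cons_val_zero, Matrix.cons_val_one,
      Matrix.cons_val, *, norm_zero, mul_zero, add_zero]
  have h := norm_charDet_sub_le_strip hQ htr U (le_refl |z.im|)
  have h3 : ∫ t, weight Q t * UpsilonAt Q t z ∂muPi = 0 := by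
    refine integral_eq_zero_of_ae ?_
    filter_upwards [ae_mem_Ioo] with t ht
    rw [hU t ⟨ht.1.le, ht.2.le⟩, mul_zero, Pi.zero_apply]
  rw [hU π pi_mem_Icc_pi, h3, mul_zero, add_zero, mul_zero, mul_zero] at h
  exact sub_eq_zero.1 (norm_le_zero_iff.1 h)

/-- It covers the degenerate radius rₙ = 0, where no circle is available for Rouché's theorem. Zero
L_ν norms make the continuous υⱼ(·, z₀) vanish identically, so q₁ and q₂ + q₃ vanish almost
everywhere. -/
theorem charDet_eq_freeDet_of_upsilonTotal (hQ : EntryIntegrable Q)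
    (htr : ∀ᵐ x ∂muPi, Q x 1 1 = -Q x 0 0) (U : Matrix (Fin 2) (Fin 4) ℂ) {ν : ℝ≥0∞}
    (hν : 1 ≤ ν) {z₀ : ℂ} (h : upsilonTotal Q ν z₀ = 0) (z : ℂ) :
    charDet hQ U z = freeDet (assocBC Q U) z := by
  have h0 : UpsilonNorm Q ν z₀ = 0 := by
    have := UpsilonAt_nonneg Q π z₀
    have := UpsilonNorm_nonneg Q ν z₀
    rw [upsilonTotal] at h
    linarith
  have h1 := fun j => (Finset.sum_eq_zero_iff_of_nonneg
    (fun _ _ => ENNReal.toReal_nonneg)).1 h0 j (Finset.mem_univ j)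
  have h2 := fun j => eq_zero_of_eLpNorm_eq_zero (continuousOn_upsilon hQ j z₀) hν (h1 j)
  refine charDet_eq_freeDet_of_weight hQ htr U
    (ae_eq_zero_of_integral_sin_cos (z := z₀) (hQ 0 0) (h2 0) (h2 1))
    (ae_eq_zero_of_integral_sin_cos (z := z₀) ((hQ 0 1).add (hQ 1 0)) (fun x hx => ?_)
      fun x hx => ?_) z
  · exact (mul_eq_zero.1 (h2 2 x hx)).resolve_left (by norm_num)
  · exact (mul_eq_zero.1 (h2 3 x hx)).resolve_left (by norm_num)

theorem assocBC_zero (U : Matrix (Fin 2) (Fin 4) ℂ) : assocBC 0 U = U := by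
  ext i j
  fin_cases j <;> simp [assocBC, E]

theorem entryIntegrable_zero : EntryIntegrable 0 := fun _ _ => integrable_zero _ _ _

/-- The characteristic determinant of the free operator. -/
theorem charDet_zero (U : Matrix (Fin 2) (Fin 4) ℂ) (z : ℂ) :
    charDet entryIntegrable_zero U z = freeDet U z := by
  have h := charDet_eq_freeDet_of_weight entryIntegrable_zero
    (Eventually.of_forall fun x => by simp) U (Eventually.of_forall fun x => by simp)
    (Eventually.of_forall fun x => by simp) z
  rwa [assocBC_zero] at h

end Remainder

/-! ### The maximum sₙ(r) as a function of the radius. -/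

section DiscMax

variable {Q : ℝ → Matrix (Fin 2) (Fin 2) ℂ}

theorem discMax_eq (Q : ℝ → Matrix (Fin 2) (Fin 2) ℂ) (ν : ℝ≥0∞) (z₀ : ℂ) (r : ℝ) :
    discMax Q ν z₀ r = sSup (upsilonTotal Q ν '' Metric.closedBall z₀ r) := rfl

theorem upsilonTotal_le_discMax (hQ : EntryIntegrable Q) {ν : ℝ≥0∞} (hν : 1 ≤ ν) {z₀ z : ℂ}
    {r : ℝ} (hz : z ∈ Metric.closedBall z₀ r) : upsilonTotal Q ν z ≤ discMax Q ν z₀ r :=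
  le_csSup ((isCompact_closedBall z₀ r).bddAbove_image
    (continuous_upsilonTotal hQ hν).continuousOn) (Set.mem_image_of_mem _ hz)

theorem discMax_le {ν : ℝ≥0∞} {z₀ : ℂ} {r η : ℝ} (hr : 0 ≤ r)
    (h : ∀ z ∈ Metric.closedBall z₀ r, upsilonTotal Q ν z ≤ η) : discMax Q ν z₀ r ≤ η := by
  refine csSup_le ((Metric.nonempty_closedBall.2 hr).image _) ?_
  rintro _ ⟨z, hz, rfl⟩
  exact h z hz

theorem discMax_mono (hQ : EntryIntegrable Q) {ν : ℝ≥0∞} (hν : 1 ≤ ν) (z₀ : ℂ) {r s : ℝ}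
    (hr : 0 ≤ r) (hrs : r ≤ s) : discMax Q ν z₀ r ≤ discMax Q ν z₀ s :=
  discMax_le hr fun _ hz =>
    upsilonTotal_le_discMax hQ hν (Metric.closedBall_subset_closedBall hrs hz)

theorem discMax_nonneg (hQ : EntryIntegrable Q) {ν : ℝ≥0∞} (hν : 1 ≤ ν) (z₀ : ℂ) {r : ℝ}
    (hr : 0 ≤ r) : 0 ≤ discMax Q ν z₀ r :=
  (upsilonTotal_nonneg Q ν z₀).trans
    (upsilonTotal_le_discMax hQ hν (Metric.mem_closedBall_self hr))

/-- Rescaling by r turns the disc into the fixed compact unit disc, over which the supremum of a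
jointly continuous function is continuous in the parameter. -/
theorem continuousOn_discMax (hQ : EntryIntegrable Q) {ν : ℝ≥0∞} (hν : 1 ≤ ν) (z₀ : ℂ) :
    ContinuousOn (discMax Q ν z₀) (Set.Ici 0) := by
  have hc : Continuous fun w : ℝ × ℂ => upsilonTotal Q ν (z₀ + w.1 * w.2) :=
    (continuous_upsilonTotal hQ hν).comp (by fun_prop)
  have h := (isCompact_closedBall (0 : ℂ) 1).continuous_sSup
    (f := fun (r : ℝ) w => upsilonTotal Q ν (z₀ + r * w)) hc
  refine h.continuousOn.congr fun r hr => ?_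
  have himg : (fun w : ℂ => z₀ + r * w) '' Metric.closedBall 0 1 = Metric.closedBall z₀ r := by
    have := affinity_unitClosedBall (E := ℂ) (Set.mem_Ici.1 hr) z₀
    rw [← this, ← Set.image_smul, ← Set.image_vadd, Set.image_image]
    rfl
  rw [discMax_eq, ← himg, Set.image_image]

end DiscMax


/-! ### Zeros of entire functions: the argument principle and Rouché's theorem. -/

section Rouche

open Metric

/-- The set of zeros of `f`, each of them repeated according to its order. -/
def ZeroIndex (f : ℂ → ℂ) : Type := Σ μ : ℂ, Fin (analyticOrderNatAt f μ)

variable {f g : ℂ → ℂ} {c : ℂ} {r : ℝ}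

theorem analyticOrderAt_ne_top_of_differentiable (hf : Differentiable ℂ f) {z : ℂ} (hz : f z ≠ 0)
    (μ : ℂ) : analyticOrderAt f μ ≠ ⊤ := by
  intro h
  rw [analyticOrderAt_eq_top] at h
  have han : AnalyticOnNhd ℂ f Set.univ := fun w _ => hf.analyticAt w
  exact hz (han.eqOn_zero_of_preconnected_of_eventuallyEq_zero isPreconnected_univ
    (Set.mem_univ μ) h (Set.mem_univ z))

theorem analyticOrderNatAt_eq_zero_iff (hf : Differentiable ℂ f) {z : ℂ} (hz : f z ≠ 0) {μ : ℂ} :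
    analyticOrderNatAt f μ = 0 ↔ f μ ≠ 0 := by
  rw [analyticOrderNatAt, ENat.toNat_eq_zero, (hf.analyticAt μ).analyticOrderAt_eq_zero]
  exact or_iff_left (analyticOrderAt_ne_top_of_differentiable hf hz μ)

theorem finite_zeros_closedBall (hf : Differentiable ℂ f) {z : ℂ} (hz : f z ≠ 0) (c : ℂ) (r : ℝ) :
    {μ | f μ = 0 ∧ μ ∈ closedBall c r}.Finite := by
  have han : AnalyticOnNhd ℂ f Set.univ := fun w _ => hf.analyticAt w
  have h1 := han.preimage_zero_mem_codiscrete hz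
  have h2 : f ⁻¹' {0}ᶜ ∈ codiscreteWithin (closedBall c r) :=
    codiscreteWithin_mono (Set.subset_univ _) h1
  refine (IsCompact.finite_sdiff_of_mem_codiscreteWithin (isCompact_closedBall c r) h2).subset ?_
  intro μ hμ
  exact ⟨hμ.2, by simp [hμ.1]⟩

/-- Splitting off the full power of a linear factor from an entire function. -/
theorem exists_eq_pow_mul (n : ℕ) : ∀ {f : ℂ → ℂ} {a : ℂ}, Differentiable ℂ f →
    analyticOrderAt f a = n →
    ∃ h : ℂ → ℂ, Differentiable ℂ h ∧ h a ≠ 0 ∧ ∀ z, f z = (z - a) ^ n * h z := by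
  induction n with
  | zero =>
    intro f a hf h0
    refine ⟨f, hf, ?_, fun z => by simp⟩
    rwa [Nat.cast_zero, (hf.analyticAt a).analyticOrderAt_eq_zero] at h0
  | succ n ih =>
    intro f a hf hn
    have hfa : f a = 0 := apply_eq_zero_of_analyticOrderAt_ne_zero (by rw [hn]; simp)
    have hd : Differentiable ℂ (dslope f a) := by
      rw [← differentiableOn_univ] at hf ⊢
      exact (Complex.differentiableOn_dslope univ_mem).2 hf
    have hmul : f = (· - a) * dslope f a := by
      funext z
      have := sub_smul_dslope f a z
      rw [hfa, sub_zero, smul_eq_mul] at this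
      exact this.symm
    have hord : analyticOrderAt (dslope f a) a = n := by
      have hlin : AnalyticAt ℂ (fun z : ℂ => z - a) a := by fun_prop
      have h1 : analyticOrderAt f a = 1 + analyticOrderAt (dslope f a) a := by
        conv_lhs => rw [hmul]
        rw [analyticOrderAt_mul hlin (hd.analyticAt a)]
        congr 1
        exact hlin.analyticOrderAt_eq_one_of_zero_deriv_ne_zero (by simp) (by simp)
      rw [hn, Nat.cast_succ, add_comm] at h1
      exact (ENat.add_right_injective_of_ne_top (by simp) h1).symm
    obtain ⟨h, hh, hha, hz⟩ := ih hd hord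
    refine ⟨h, hh, hha, fun z => ?_⟩
    have h2 := congrFun hmul z
    rw [Pi.mul_apply, hz z] at h2
    rw [h2]
    ring

/-- Zeros are divided out one at a time. The factors already removed do not vanish at a new point,
so the quotient has there the same order as f. -/
theorem exists_eq_prod_mul (hf : Differentiable ℂ f) {z₀ : ℂ} (hz₀ : f z₀ ≠ 0) (F : Finset ℂ) :
    ∃ h : ℂ → ℂ, Differentiable ℂ h ∧ (∀ μ ∈ F, h μ ≠ 0) ∧
      ∀ z, f z = (∏ μ ∈ F, (z - μ) ^ analyticOrderNatAt f μ) * h z := by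
  classical
  induction F using Finset.induction_on with
  | empty => exact ⟨f, hf, by simp, fun z => by simp⟩
  | insert a F ha ih =>
    obtain ⟨h, hh, hF, hz⟩ := ih
    have hp : Differentiable ℂ fun z : ℂ => ∏ μ ∈ F, (z - μ) ^ analyticOrderNatAt f μ := by
      fun_prop
    have hpa : (∏ μ ∈ F, (a - μ) ^ analyticOrderNatAt f μ) ≠ 0 :=
      Finset.prod_ne_zero_iff.2 fun μ hμ =>
        pow_ne_zero _ (sub_ne_zero.2 fun e => ha (e ▸ hμ))
    have hord : analyticOrderAt h a = analyticOrderNatAt f a := by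
      rw [Nat.cast_analyticOrderNatAt (analyticOrderAt_ne_top_of_differentiable hf hz₀ a)]
      have e : f = (fun z : ℂ => ∏ μ ∈ F, (z - μ) ^ analyticOrderNatAt f μ) * h := funext hz
      conv_rhs => rw [e]
      rw [analyticOrderAt_mul (hp.analyticAt a) (hh.analyticAt a),
        (hp.analyticAt a).analyticOrderAt_eq_zero.2 hpa, zero_add]
    obtain ⟨k, hk, hka, hkz⟩ := exists_eq_pow_mul _ hh hord
    refine ⟨k, hk, fun μ hμ => ?_, fun z => ?_⟩
    · rcases Finset.mem_insert.1 hμ with rfl | hμ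
      · exact hka
      · have := hF μ hμ
        rw [hkz μ] at this
        exact right_ne_zero_of_mul this
    · rw [Finset.prod_insert ha, hz z, hkz z]
      ring

/-- The argument principle for an entire function. -/
theorem circleIntegral_logDeriv (hf : Differentiable ℂ f) (hr : 0 < r)
    (hs : ∀ z ∈ sphere c r, f z ≠ 0) {F : Finset ℂ} (hF : ∀ μ, μ ∈ F ↔ f μ = 0 ∧ μ ∈ ball c r) :
    CircleIntegrable (logDeriv f) c r ∧
    (∮ z in C(c, r), logDeriv f z) =
      2 * π * Complex.I * ((∑ μ ∈ F, analyticOrderNatAt f μ : ℕ) : ℂ) := by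
  obtain ⟨z₀, hz₀s⟩ := (NormedSpace.sphere_nonempty (x := c) (r := r)).2 hr.le
  have hz₀ := hs z₀ hz₀s
  obtain ⟨h, hh, hhF, hfz⟩ := exists_eq_prod_mul hf hz₀ F
  have hne : ∀ z ∈ closedBall c r, h z ≠ 0 := by
    intro z hz h0
    have hfz0 : f z = 0 := by rw [hfz, h0, mul_zero]
    have hzb : z ∈ ball c r := by
      rcases (mem_closedBall.1 hz).lt_or_eq with hlt | heq
      · exact hlt
      · exact absurd hfz0 (hs z heq)
    exact hhF z ((hF z).2 ⟨hfz0, hzb⟩) h0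
  have hsub : ∀ z ∈ sphere c r, ∀ μ ∈ F, z - μ ≠ 0 := by
    intro z hz μ hμ e
    rw [sub_eq_zero] at e
    exact hs z hz (e ▸ ((hF μ).1 hμ).1)
  have hld : Set.EqOn (logDeriv f)
      (fun z => (∑ μ ∈ F, (analyticOrderNatAt f μ : ℂ) * (z - μ)⁻¹) + logDeriv h z)
      (sphere c r) := by
    intro z hz
    have e : f = fun z => (∏ μ ∈ F, (z - μ) ^ analyticOrderNatAt f μ) * h z := funext hfz
    have hp : ∀ μ ∈ F, (z - μ) ^ analyticOrderNatAt f μ ≠ 0 :=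
      fun μ hμ => pow_ne_zero _ (hsub z hz μ hμ)
    have h1 : logDeriv f z = logDeriv
        (fun z => ∏ μ ∈ F, (z - μ) ^ analyticOrderNatAt f μ) z + logDeriv h z := by
      conv_lhs => rw [e]
      exact logDeriv_mul (f := fun z : ℂ => ∏ μ ∈ F, (z - μ) ^ analyticOrderNatAt f μ) z
        (Finset.prod_ne_zero_iff.2 hp) (hne z (sphere_subset_closedBall hz)) (by fun_prop) (hh z)
    rw [h1]
    congr 1
    have h2 := logDeriv_prod (s := F)
      (f := fun (μ : ℂ) (z : ℂ) => (z - μ) ^ analyticOrderNatAt f μ) (x := z) hp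
      (fun μ _ => by fun_prop)
    rw [h2]
    refine Finset.sum_congr rfl fun μ _ => ?_
    rw [logDeriv_fun_pow (by fun_prop), logDeriv_apply]
    simp [div_eq_mul_inv]
  have hi1 : ∀ μ ∈ F, CircleIntegrable (fun z => (analyticOrderNatAt f μ : ℂ) * (z - μ)⁻¹) c r := by
    intro μ hμ
    refine ContinuousOn.circleIntegrable hr.le ?_
    exact continuousOn_const.mul ((continuousOn_id.sub continuousOn_const).inv₀
      fun z hz => hsub z hz μ hμ)
  have hi1' : CircleIntegrable (fun z => ∑ μ ∈ F, (analyticOrderNatAt f μ : ℂ) * (z - μ)⁻¹) c r := by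
    refine ContinuousOn.circleIntegrable hr.le ?_
    exact continuousOn_finsetSum _ fun μ hμ =>
      continuousOn_const.mul ((continuousOn_id.sub continuousOn_const).inv₀
        fun z hz => hsub z hz μ hμ)
  have hdh : Differentiable ℂ (deriv h) := by
    rw [← differentiableOn_univ]
    exact (differentiableOn_univ.2 hh).deriv isOpen_univ
  have hld_d : ∀ z ∈ closedBall c r, DifferentiableAt ℂ (logDeriv h) z := fun z hz =>
    (hdh z).div (hh z) (hne z hz)
  have hlc : ContinuousOn (logDeriv h) (closedBall c r) :=
    fun z hz => (hld_d z hz).continuousAt.continuousWithinAt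
  have hi2 : CircleIntegrable (logDeriv h) c r :=
    ContinuousOn.circleIntegrable hr.le (hlc.mono sphere_subset_closedBall)
  have hi : CircleIntegrable
      (fun z => (∑ μ ∈ F, (analyticOrderNatAt f μ : ℂ) * (z - μ)⁻¹) + logDeriv h z) c r :=
    hi1'.add hi2
  refine ⟨?_, ?_⟩
  · refine ContinuousOn.circleIntegrable hr.le ?_
    have hdf : Differentiable ℂ (deriv f) := by
      rw [← differentiableOn_univ]
      exact (differentiableOn_univ.2 hf).deriv isOpen_univ
    exact hdf.continuous.continuousOn.div hf.continuous.continuousOn hs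
  · rw [circleIntegral.integral_congr hr.le hld, circleIntegral.integral_add hi1' hi2,
      circleIntegral.integral_fun_sum hi1,
      Complex.circleIntegral_eq_zero_of_differentiable_on_off_countable hr.le Set.countable_empty
        hlc (fun z hz => hld_d z (ball_subset_closedBall hz.1)), add_zero]
    push_cast
    rw [Finset.mul_sum]
    refine Finset.sum_congr rfl fun μ hμ => ?_
    rw [circleIntegral.integral_const_mul,
      circleIntegral.integral_sub_inv_of_mem_ball ((hF μ).1 hμ).2, mul_comm]

theorem ne_zero_of_norm_sub_lt {a b : ℂ} (h : ‖a - b‖ < ‖b‖) : a ≠ 0 ∧ b ≠ 0 := by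
  refine ⟨?_, ?_⟩
  · rintro rfl
    simp at h
  · rintro rfl
    simp at h
    exact absurd h (not_lt.2 (norm_nonneg _))

/-- Rouché's theorem for entire functions on a disc: equality of the sums of the orders. -/
theorem sum_order_eq_of_norm_sub_lt (hf : Differentiable ℂ f) (hg : Differentiable ℂ g)
    (hr : 0 < r) (h : ∀ z ∈ sphere c r, ‖f z - g z‖ < ‖g z‖) {F G : Finset ℂ}
    (hF : ∀ μ, μ ∈ F ↔ f μ = 0 ∧ μ ∈ ball c r) (hG : ∀ μ, μ ∈ G ↔ g μ = 0 ∧ μ ∈ ball c r) :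
    ∑ μ ∈ F, analyticOrderNatAt f μ = ∑ μ ∈ G, analyticOrderNatAt g μ := by
  have hf0 : ∀ z ∈ sphere c r, f z ≠ 0 := fun z hz => (ne_zero_of_norm_sub_lt (h z hz)).1
  have hg0 : ∀ z ∈ sphere c r, g z ≠ 0 := fun z hz => (ne_zero_of_norm_sub_lt (h z hz)).2
  obtain ⟨i1, e1⟩ := circleIntegral_logDeriv hf hr hf0 hF
  obtain ⟨i2, e2⟩ := circleIntegral_logDeriv hg hr hg0 hG
  -- On the circle |f/g - 1| < 1, so f/g stays in the slit plane and log(f/g) is a single-valued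
  -- primitive of the integrand.
  have hz : (∮ z in C(c, r), (logDeriv f z - logDeriv g z)) = 0 := by
    refine circleIntegral.integral_eq_zero_of_hasDerivWithinAt
      (f := fun z => Complex.log (f z / g z)) hr.le fun z hz => HasDerivAt.hasDerivWithinAt ?_
    have hgz := hg0 z hz
    have hfz := hf0 z hz
    have hslit : f z / g z ∈ Complex.slitPlane := by
      refine Complex.mem_slitPlane_of_norm_lt_one (z := f z / g z - 1) ?_ |> fun h => by
        simpa using h
      rw [div_sub_one hgz, norm_div, div_lt_one (norm_pos_iff.2 hgz)]
      exact h z hz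
    have hd := ((hf z).hasDerivAt.div (hg z).hasDerivAt hgz).clog hslit
    have he : logDeriv f z - logDeriv g z =
        (deriv f z * g z - f z * deriv g z) / g z ^ 2 / (f / g) z := by
      rw [logDeriv_apply, logDeriv_apply, Pi.div_apply]
      field_simp
    rw [he]
    exact hd
  rw [circleIntegral.integral_sub i1 i2, e1, e2, sub_eq_zero] at hz
  have h2 := mul_left_cancel₀ Complex.two_pi_I_ne_zero hz
  exact_mod_cast h2

/-- The zeros in a disc, repeated according to their orders. -/
theorem finite_zeroIndex_ball {F : Finset ℂ}
    (hF : ∀ μ, μ ∈ F ↔ f μ = 0 ∧ μ ∈ ball c r) :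
    Finite {t : ZeroIndex f // t.1 ∈ ball c r} ∧
    Nat.card {t : ZeroIndex f // t.1 ∈ ball c r} = ∑ μ ∈ F, analyticOrderNatAt f μ := by
  have e : {t : ZeroIndex f // t.1 ∈ ball c r} ≃ Σ μ : F, Fin (analyticOrderNatAt f μ) :=
    { toFun := fun t => ⟨⟨t.1.1, (hF _).2 ⟨apply_eq_zero_of_analyticOrderNatAt_ne_zero
        (Nat.pos_of_ne_zero (fun h0 => (Fin.elim0 (h0 ▸ t.1.2)))).ne', t.2⟩⟩, t.1.2⟩
      invFun := fun s => ⟨⟨s.1.1, s.2⟩, ((hF _).1 s.1.2).2⟩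
      left_inv := fun t => rfl
      right_inv := fun s => rfl }
  refine ⟨Finite.of_equiv _ e.symm, ?_⟩
  rw [Nat.card_congr e, Nat.card_eq_fintype_card, Fintype.card_sigma]
  simp only [Fintype.card_fin]
  exact Finset.sum_coe_sort F fun μ => analyticOrderNatAt f μ

/-- Rouché's theorem for entire functions on a disc. -/
theorem rouche (hf : Differentiable ℂ f) (hg : Differentiable ℂ g) (hr : 0 < r)
    (h : ∀ z ∈ sphere c r, ‖f z - g z‖ < ‖g z‖) :
    Finite {t : ZeroIndex f // t.1 ∈ ball c r} ∧ Finite {t : ZeroIndex g // t.1 ∈ ball c r} ∧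
    Nat.card {t : ZeroIndex f // t.1 ∈ ball c r} =
      Nat.card {t : ZeroIndex g // t.1 ∈ ball c r} := by
  obtain ⟨z₀, hz₀⟩ := (NormedSpace.sphere_nonempty (x := c) (r := r)).2 hr.le
  obtain ⟨hf0, hg0⟩ := ne_zero_of_norm_sub_lt (h z₀ hz₀)
  have key : ∀ {f : ℂ → ℂ}, Differentiable ℂ f → f z₀ ≠ 0 →
      ∃ F : Finset ℂ, ∀ μ, μ ∈ F ↔ f μ = 0 ∧ μ ∈ ball c r := by
    intro f hf hf0
    have hfin : {μ | f μ = 0 ∧ μ ∈ ball c r}.Finite :=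
      (finite_zeros_closedBall hf hf0 c r).subset fun μ hμ => ⟨hμ.1, ball_subset_closedBall hμ.2⟩
    exact ⟨hfin.toFinset, fun μ => by simp⟩
  obtain ⟨F, hF⟩ := key hf hf0
  obtain ⟨G, hG⟩ := key hg hg0
  obtain ⟨a1, a2⟩ := finite_zeroIndex_ball hF
  obtain ⟨b1, b2⟩ := finite_zeroIndex_ball hG
  exact ⟨a1, b1, by rw [a2, b2, sum_order_eq_of_norm_sub_lt hf hg hr h hF hG]⟩

end Rouche


/-! ### Zeros of the free characteristic determinant. -/

section FreeOperator

open Metric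

/-- Scaling the last two columns by E multiplies the regularity expression by E ≠ 0, since every
minor involved takes one column from each half. The other sign gives `coefMinus`. -/
theorem Regular.coefPlus_ne_zero {U : Matrix (Fin 2) (Fin 4) ℂ} (hU : Regular U)
    (Q : ℝ → Matrix (Fin 2) (Fin 2) ℂ) : coefPlus (assocBC Q U) ≠ 0 := by
  have h : coefPlus (assocBC Q U) =
      E Q * (J U 0 3 + J U 2 1 + Complex.I * (J U 3 1 - J U 0 2)) := by
    simp [coefPlus, J, assocBC]
    ring
  rw [h]
  exact mul_ne_zero (Complex.exp_ne_zero _) hU.1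

theorem Regular.coefMinus_ne_zero {U : Matrix (Fin 2) (Fin 4) ℂ} (hU : Regular U)
    (Q : ℝ → Matrix (Fin 2) (Fin 2) ℂ) : coefMinus (assocBC Q U) ≠ 0 := by
  have h : coefMinus (assocBC Q U) =
      E Q * (J U 0 3 + J U 2 1 - Complex.I * (J U 3 1 - J U 0 2)) := by
    simp [coefMinus, J, assocBC]
    ring
  rw [h]
  exact mul_ne_zero (Complex.exp_ne_zero _) hU.2

/-- An exponential with the simple zeros `κ + 2k`. -/
noncomputable def expFactor (κ z : ℂ) : ℂ :=
  Complex.exp (Complex.I * π * z) - Complex.exp (Complex.I * π * κ)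

theorem I_mul_pi_ne_zero : Complex.I * (π : ℂ) ≠ 0 :=
  mul_ne_zero Complex.I_ne_zero (Complex.ofReal_ne_zero.2 Real.pi_ne_zero)

theorem expFactor_eq_zero_iff {κ z : ℂ} : expFactor κ z = 0 ↔ ∃ k : ℤ, κ + 2 * k = z := by
  rw [expFactor, sub_eq_zero, Complex.exp_eq_exp_iff_exists_int]
  refine exists_congr fun k => ⟨fun h => ?_, fun h => by rw [← h]; ring⟩
  refine mul_left_cancel₀ I_mul_pi_ne_zero ?_
  rw [h]
  ring

theorem differentiable_expFactor (κ : ℂ) : Differentiable ℂ (expFactor κ) := by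
  unfold expFactor
  fun_prop

theorem order_expFactor {κ μ : ℂ} (h : expFactor κ μ = 0) :
    analyticOrderAt (expFactor κ) μ = 1 := by
  refine ((differentiable_expFactor κ).analyticAt μ).analyticOrderAt_eq_one_of_zero_deriv_ne_zero
    h ?_
  have hd : HasDerivAt (expFactor κ) (Complex.exp (Complex.I * π * μ) * (Complex.I * π)) μ := by
    have := (((hasDerivAt_id μ).const_mul (Complex.I * π)).cexp).sub_const
      (Complex.exp (Complex.I * π * κ))
    rw [mul_one] at this
    exact this
  rw [hd.deriv]
  exact mul_ne_zero (Complex.exp_ne_zero _) I_mul_pi_ne_zero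

theorem ncard_expFactor (κ μ : ℂ) : {k : ℤ | κ + 2 * k = μ}.Finite ∧
    analyticOrderAt (expFactor κ) μ = ({k : ℤ | κ + 2 * k = μ}.ncard : ℕ) := by
  have han := (differentiable_expFactor κ).analyticAt μ
  by_cases h : ∃ k : ℤ, κ + 2 * k = μ
  · obtain ⟨k, hk⟩ := h
    have hs : {k : ℤ | κ + 2 * k = μ} = {k} := by
      ext l
      rw [Set.mem_ofPred_eq, Set.mem_singleton_iff, ← hk]
      refine ⟨fun e => ?_, fun e => by rw [e]⟩
      exact_mod_cast mul_left_cancel₀ two_ne_zero (add_left_cancel e)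
    rw [hs, Set.ncard_singleton, Nat.cast_one]
    refine ⟨Set.finite_singleton k, ?_⟩
    exact order_expFactor (expFactor_eq_zero_iff.2 ⟨k, hk⟩)
  · have hs : {k : ℤ | κ + 2 * k = μ} = ∅ := by
      ext l
      exact ⟨fun e => h ⟨l, e⟩, fun e => e.elim⟩
    rw [hs, Set.ncard_empty, Nat.cast_zero, han.analyticOrderAt_eq_zero]
    exact ⟨Set.finite_empty, fun e => h (expFactor_eq_zero_iff.1 e)⟩

theorem freeEigenvalue_two_mul (κ₀ κ₁ : ℂ) (k : ℤ) :
    freeEigenvalue κ₀ κ₁ (2 * k) = κ₀ + 2 * k := by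
  rw [freeEigenvalue, if_pos (even_two_mul k)]
  push_cast
  ring

theorem freeEigenvalue_two_mul_add_one (κ₀ κ₁ : ℂ) (k : ℤ) :
    freeEigenvalue κ₀ κ₁ (2 * k + 1) = κ₁ + 1 + 2 * k := by
  rw [freeEigenvalue, if_neg (by simp)]
  push_cast
  ring

theorem freeEigenvalue_add_two_mul (κ₀ κ₁ : ℂ) (n k : ℤ) :
    freeEigenvalue κ₀ κ₁ (n + 2 * k) = freeEigenvalue κ₀ κ₁ n + 2 * k := by
  have h : Even (n + 2 * k) ↔ Even n := by simp [Int.even_add]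
  simp only [freeEigenvalue, h]
  split_ifs <;> push_cast <;> ring

theorem differentiable_freeDet (V : Matrix (Fin 2) (Fin 4) ℂ) : Differentiable ℂ (freeDet V) := by
  unfold freeDet
  fun_prop

theorem freeDet_add_two_mul (V : Matrix (Fin 2) (Fin 4) ℂ) (z : ℂ) (k : ℤ) :
    freeDet V (z + 2 * k) = freeDet V z := by
  have h1 : Complex.exp (Complex.I * π * (z + 2 * k)) = Complex.exp (Complex.I * π * z) :=
    Complex.exp_eq_exp_iff_exists_int.2 ⟨k, by ring⟩
  have h2 : Complex.exp (-(Complex.I * π * (z + 2 * k))) = Complex.exp (-(Complex.I * π * z)) :=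
    Complex.exp_eq_exp_iff_exists_int.2 ⟨-k, by push_cast; ring⟩
  rw [freeDet, freeDet, h1, h2]

variable {V : Matrix (Fin 2) (Fin 4) ℂ} {κ₀ κ₁ : ℂ}

/-- Factorization of the free characteristic determinant. -/
theorem freeDet_eq_mul (h : IsFreeExponents V κ₀ κ₁) (z : ℂ) :
    freeDet V z = coefPlus V / 2 * Complex.exp (-(Complex.I * π * z)) *
      (expFactor κ₀ z * expFactor (κ₁ + 1) z) := by
  obtain ⟨w₀, w₁, rfl, rfl, hw⟩ := h
  have hpi : (π : ℂ) ≠ 0 := Complex.ofReal_ne_zero.2 Real.pi_ne_zero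
  have e0 : Complex.exp (Complex.I * π * (-(Complex.I / π) * w₀)) = Complex.exp w₀ := by
    congr 1
    field_simp
    rw [Complex.I_sq]
    ring
  -- The odd indices 2k + 1 give κ₁ + 1 + 2k. With κ₁ = 1 - (i/π)w₁ the total shift is 2, one full
  -- period of e^{iπz}.
  have e1 : Complex.exp (Complex.I * π * (1 - Complex.I / π * w₁ + 1)) = Complex.exp w₁ := by
    refine Complex.exp_eq_exp_iff_exists_int.2 ⟨1, ?_⟩
    field_simp
    push_cast
    linear_combination (-w₁) * Complex.I_sq
  have hinv : Complex.exp (Complex.I * π * z) * Complex.exp (-(Complex.I * π * z)) = 1 := by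
    rw [← Complex.exp_add, add_neg_cancel, Complex.exp_zero]
  have hz := hw (Complex.exp (Complex.I * π * z))
  rw [expFactor, expFactor, e0, e1, freeDet]
  linear_combination (1 / 2 * Complex.exp (-(Complex.I * π * z))) * hz -
    (coefPlus V / 2 * Complex.exp (Complex.I * π * z) + coefMid V) * hinv

/-- The zeros of the free characteristic determinant are the numbers `freeEigenvalue`, and the
order of a zero is the number of its repetitions. -/
theorem ncard_freeEigenvalue (h : IsFreeExponents V κ₀ κ₁) (ha : coefPlus V ≠ 0) (μ : ℂ) :
    {n : ℤ | freeEigenvalue κ₀ κ₁ n = μ}.Finite ∧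
    analyticOrderAt (freeDet V) μ = ({n : ℤ | freeEigenvalue κ₀ κ₁ n = μ}.ncard : ℕ) := by
  obtain ⟨f0, o0⟩ := ncard_expFactor κ₀ μ
  obtain ⟨f1, o1⟩ := ncard_expFactor (κ₁ + 1) μ
  have hs : {n : ℤ | freeEigenvalue κ₀ κ₁ n = μ} =
      (fun k : ℤ => 2 * k) '' {k : ℤ | κ₀ + 2 * k = μ} ∪
      (fun k : ℤ => 2 * k + 1) '' {k : ℤ | κ₁ + 1 + 2 * k = μ} := by
    ext n
    constructor
    · intro hn
      obtain ⟨k, rfl | rfl⟩ := Int.even_or_odd' n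
      · exact Or.inl ⟨k, (freeEigenvalue_two_mul κ₀ κ₁ k).symm.trans hn, rfl⟩
      · exact Or.inr ⟨k, (freeEigenvalue_two_mul_add_one κ₀ κ₁ k).symm.trans hn, rfl⟩
    · rintro (⟨k, hk, rfl⟩ | ⟨k, hk, rfl⟩)
      · exact (freeEigenvalue_two_mul κ₀ κ₁ k).trans hk
      · exact (freeEigenvalue_two_mul_add_one κ₀ κ₁ k).trans hk
  have hdis : Disjoint ((fun k : ℤ => 2 * k) '' {k : ℤ | κ₀ + 2 * k = μ})
      ((fun k : ℤ => 2 * k + 1) '' {k : ℤ | κ₁ + 1 + 2 * k = μ}) := by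
    rw [Set.disjoint_left]
    rintro _ ⟨k, -, rfl⟩ ⟨l, -, hl⟩
    simp only at hl
    omega
  rw [hs]
  refine ⟨(f0.image _).union (f1.image _), ?_⟩
  rw [Set.ncard_union_eq hdis (f0.image _) (f1.image _),
    Set.ncard_image_of_injective _ (fun a b hab => by simpa using hab),
    Set.ncard_image_of_injective _ (fun a b hab => by simpa using hab), Nat.cast_add, ← o0, ← o1]
  have hf : freeDet V = (fun z => coefPlus V / 2 * Complex.exp (-(Complex.I * π * z))) *
      (expFactor κ₀ * expFactor (κ₁ + 1)) := funext fun z => freeDet_eq_mul h z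
  have hd : Differentiable ℂ fun z => coefPlus V / 2 * Complex.exp (-(Complex.I * π * z)) := by
    fun_prop
  have d0 := (differentiable_expFactor κ₀).analyticAt μ
  have d1 := (differentiable_expFactor (κ₁ + 1)).analyticAt μ
  rw [hf, analyticOrderAt_mul (hd.analyticAt μ) (d0.mul d1), analyticOrderAt_mul d0 d1,
    (hd.analyticAt μ).analyticOrderAt_eq_zero.2
      (mul_ne_zero (div_ne_zero ha two_ne_zero) (Complex.exp_ne_zero _)), zero_add]

theorem freeDet_eq_zero_iff (h : IsFreeExponents V κ₀ κ₁) (ha : coefPlus V ≠ 0) {z : ℂ} :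
    freeDet V z = 0 ↔ ∃ n : ℤ, freeEigenvalue κ₀ κ₁ n = z := by
  obtain ⟨hfin, ho⟩ := ncard_freeEigenvalue h ha z
  have han := (differentiable_freeDet V).analyticAt z
  rw [← not_iff_not, ← ne_eq, ← han.analyticOrderAt_eq_zero, ho, Nat.cast_eq_zero,
    Set.ncard_eq_zero hfin, Set.eq_empty_iff_forall_notMem, not_exists]
  rfl

/-- The common multiplicity of all eigenvalues of the free operator. -/
theorem order_freeDet_freeEigenvalue (h : IsFreeExponents V κ₀ κ₁) (ha : coefPlus V ≠ 0) (n : ℤ) :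
    analyticOrderAt (freeDet V) (freeEigenvalue κ₀ κ₁ n) =
      (if freeDiscr V = 0 then 2 else 1 : ℕ) := by
  have hsame : freeDiscr V = 0 ↔
      Complex.exp (Complex.I * π * κ₀) = Complex.exp (Complex.I * π * (κ₁ + 1)) := by
    have hz : ∀ z : ℂ, coefPlus V * Complex.exp (Complex.I * π * z) ^ 2 +
        2 * coefMid V * Complex.exp (Complex.I * π * z) + coefMinus V =
        coefPlus V * (expFactor κ₀ z * expFactor (κ₁ + 1) z) := by
      intro z
      have h1 := freeDet_eq_mul h z
      have hinv : Complex.exp (Complex.I * π * z) * Complex.exp (-(Complex.I * π * z)) = 1 := by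
        rw [← Complex.exp_add, add_neg_cancel, Complex.exp_zero]
      rw [freeDet] at h1
      linear_combination (2 * Complex.exp (Complex.I * π * z)) * h1 +
        (coefPlus V * (expFactor κ₀ z * expFactor (κ₁ + 1) z) - coefMinus V) * hinv
    -- At z = 0 and z = 1 the exponential equals 1 and -1; the sum and difference of the two
    -- identities are Vieta's formulas, and the discriminant becomes (coefPlus · (x - y))².
    have e0 := hz 0
    have e1 := hz 1
    rw [expFactor, expFactor] at e0 e1
    rw [mul_zero, Complex.exp_zero] at e0
    have hm1 : Complex.exp (Complex.I * π * 1) = -1 := by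
      rw [mul_one, mul_comm, Complex.exp_pi_mul_I]
    rw [hm1] at e1
    set x := Complex.exp (Complex.I * π * κ₀)
    set y := Complex.exp (Complex.I * π * (κ₁ + 1))
    have hb : 2 * coefMid V = -(coefPlus V * (x + y)) := by linear_combination (e0 - e1) / 2
    have hc : coefMinus V = coefPlus V * (x * y) := by linear_combination (e0 + e1) / 2
    have hdisc : freeDiscr V = (coefPlus V * (x - y)) ^ 2 := by
      rw [freeDiscr, hb, hc]
      ring
    rw [hdisc, sq_eq_zero_iff, mul_eq_zero_iff_left ha, sub_eq_zero]
  set μ := freeEigenvalue κ₀ κ₁ n with hμ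
  have hn : expFactor κ₀ μ = 0 ∨ expFactor (κ₁ + 1) μ = 0 := by
    obtain ⟨k, rfl | rfl⟩ := Int.even_or_odd' n
    · exact Or.inl (expFactor_eq_zero_iff.2 ⟨k, (freeEigenvalue_two_mul κ₀ κ₁ k).symm⟩)
    · exact Or.inr (expFactor_eq_zero_iff.2 ⟨k, (freeEigenvalue_two_mul_add_one κ₀ κ₁ k).symm⟩)
  have hf : freeDet V = (fun z => coefPlus V / 2 * Complex.exp (-(Complex.I * π * z))) *
      (expFactor κ₀ * expFactor (κ₁ + 1)) := funext fun z => freeDet_eq_mul h z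
  have hd : Differentiable ℂ fun z => coefPlus V / 2 * Complex.exp (-(Complex.I * π * z)) := by
    fun_prop
  have d0 := (differentiable_expFactor κ₀).analyticAt μ
  have d1 := (differentiable_expFactor (κ₁ + 1)).analyticAt μ
  rw [hf, analyticOrderAt_mul (hd.analyticAt μ) (d0.mul d1), analyticOrderAt_mul d0 d1,
    (hd.analyticAt μ).analyticOrderAt_eq_zero.2
      (mul_ne_zero (div_ne_zero ha two_ne_zero) (Complex.exp_ne_zero _)), zero_add]
  have hone : ∀ κ, expFactor κ μ = 0 → analyticOrderAt (expFactor κ) μ = 1 :=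
    fun κ hκ => order_expFactor hκ
  have hsub : expFactor κ₀ μ - expFactor (κ₁ + 1) μ =
      Complex.exp (Complex.I * π * (κ₁ + 1)) - Complex.exp (Complex.I * π * κ₀) := by
    rw [expFactor, expFactor]
    ring
  split_ifs with hdz
  · rw [hsame.1 hdz, sub_self, sub_eq_zero] at hsub
    rw [hsub, or_self] at hn
    rw [hone _ hn, hone _ (hsub.trans hn)]
    rfl
  · have hne : expFactor κ₀ μ ≠ expFactor (κ₁ + 1) μ := by
      intro e
      rw [e, sub_self, eq_comm, sub_eq_zero] at hsub
      exact hdz (hsame.2 hsub.symm)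
    rcases hn with hn | hn
    · rw [hone _ hn, d1.analyticOrderAt_eq_zero.2 (fun e => hne (hn.trans e.symm))]
      rfl
    · rw [hone _ hn, d0.analyticOrderAt_eq_zero.2 (fun e => hne (e.trans hn.symm))]
      rfl

end FreeOperator


/-! ### Lower bounds for the free determinant near and away from its zeros. -/

section LowerBounds

open Metric

variable {V : Matrix (Fin 2) (Fin 4) ℂ} {κ₀ κ₁ : ℂ}

/-- Lower bounds for the free characteristic determinant near its zeros. -/
theorem exists_detLowerBound (h : IsFreeExponents V κ₀ κ₁) (ha : coefPlus V ≠ 0) {ε : ℝ}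
    (hε : 0 < ε)
    (hdis : ∀ m n : ℤ, freeEigenvalue κ₀ κ₁ m ≠ freeEigenvalue κ₀ κ₁ n →
      Disjoint (closedBall (freeEigenvalue κ₀ κ₁ m) ε) (closedBall (freeEigenvalue κ₀ κ₁ n) ε)) :
    ∃ c : ℝ, 0 < c ∧
      DetLowerBound V (freeEigenvalue κ₀ κ₁) ε (if freeDiscr V = 0 then 2 else 1) c := by
  set m : ℕ := if freeDiscr V = 0 then 2 else 1 with hm
  have key : ∀ n : ℤ, ∃ c : ℝ, 0 < c ∧ ∀ z : ℂ, 0 < ‖z - freeEigenvalue κ₀ κ₁ n‖ →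
      ‖z - freeEigenvalue κ₀ κ₁ n‖ < ε →
      c * ‖z - freeEigenvalue κ₀ κ₁ n‖ ^ m < ‖freeDet V z‖ := by
    intro n
    set l := freeEigenvalue κ₀ κ₁ n with hl
    -- The quotient of Δ⁰ by (z - λ⁰ₙ)^m has no zero in the closed disc, since the discs about
    -- distinct λ⁰ₖ are disjoint. Half of its minimal modulus gives the strict inequality.
    obtain ⟨g, hg, hgl, hz⟩ := exists_eq_pow_mul m (differentiable_freeDet V)
      (order_freeDet_freeEigenvalue h ha n)
    obtain ⟨w, hw, hmin⟩ := (isCompact_closedBall l ε).exists_isMinOn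
      (nonempty_closedBall.2 hε.le) hg.continuous.norm.continuousOn
    have hgw : g w ≠ 0 := by
      intro h0
      obtain ⟨k, hk⟩ := (freeDet_eq_zero_iff h ha).1 (show freeDet V w = 0 by
        rw [hz, h0, mul_zero])
      by_cases hkl : freeEigenvalue κ₀ κ₁ k = l
      · rw [← hk, hkl] at h0
        exact hgl h0
      · refine Set.disjoint_left.1 (hdis k n hkl) (mem_closedBall_self hε.le) ?_
        rw [hk]
        exact hw
    have hpos := norm_pos_iff.2 hgw
    refine ⟨‖g w‖ / 2, half_pos hpos, fun z h0 h1 => ?_⟩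
    have h2 : ‖g w‖ ≤ ‖g z‖ := hmin (mem_closedBall_iff_norm.2 h1.le)
    rw [hz z, norm_mul, norm_pow, mul_comm (‖z - l‖ ^ m)]
    exact mul_lt_mul_of_pos_right (by linarith) (pow_pos h0 m)
  -- By 2-periodicity the centers n = 0 and n = 1 represent all others.
  obtain ⟨c₀, hc₀, h₀⟩ := key 0
  obtain ⟨c₁, hc₁, h₁⟩ := key 1
  refine ⟨min c₀ c₁, lt_min hc₀ hc₁, fun n z hz0 hz1 => ?_⟩
  have hshift : ∀ (j k : ℤ) (c : ℝ), n = j + 2 * k → min c₀ c₁ ≤ c →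
      (∀ z : ℂ, 0 < ‖z - freeEigenvalue κ₀ κ₁ j‖ → ‖z - freeEigenvalue κ₀ κ₁ j‖ < ε →
      c * ‖z - freeEigenvalue κ₀ κ₁ j‖ ^ m < ‖freeDet V z‖) →
      min c₀ c₁ * ‖z - freeEigenvalue κ₀ κ₁ n‖ ^ m < ‖freeDet V z‖ := by
    intro j k c hn hc hj
    have e : z - freeEigenvalue κ₀ κ₁ n = z - 2 * k - freeEigenvalue κ₀ κ₁ j := by
      rw [hn, freeEigenvalue_add_two_mul]
      ring
    have e' : freeDet V z = freeDet V (z - 2 * k) := by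
      rw [← freeDet_add_two_mul V (z - 2 * k) k, sub_add_cancel]
    rw [e] at hz0 hz1 ⊢
    rw [e']
    exact (mul_le_mul_of_nonneg_right hc (by positivity)).trans_lt (hj _ hz0 hz1)
  obtain ⟨k, hk | hk⟩ := Int.even_or_odd' n
  · exact hshift 0 k c₀ (by omega) (min_le_left _ _) h₀
  · exact hshift 1 k c₁ (by omega) (min_le_right _ _) h₁

/-- Growth of the free characteristic determinant far from the real axis. -/
theorem exists_le_norm_freeDet_of_large_im (V : Matrix (Fin 2) (Fin 4) ℂ) (ha : coefPlus V ≠ 0)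
    (hc : coefMinus V ≠ 0) : ∃ h : ℝ, ∃ κ : ℝ, 0 < κ ∧ ∀ z : ℂ, h ≤ |z.im| →
      κ * Real.exp (π * |z.im|) ≤ ‖freeDet V z‖ := by
  set a := ‖coefPlus V‖ with hadef
  set c := ‖coefMinus V‖ with hcdef
  set b := ‖coefMid V‖ with hbdef
  have ha0 : 0 < a := norm_pos_iff.2 ha
  have hc0 : 0 < c := norm_pos_iff.2 hc
  have hb0 : 0 ≤ b := norm_nonneg _
  set κ := min a c / 4 with hκ
  have hκ0 : 0 < κ := div_pos (lt_min ha0 hc0) (by norm_num)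
  have hκa : 4 * κ ≤ a := by
    have := min_le_left a c
    rw [hκ]
    linarith
  have hκc : 4 * κ ≤ c := by
    have := min_le_right a c
    rw [hκ]
    linarith
  -- The dominant exponential has a coefficient of modulus at least 2κ. From this height on, the
  -- other two terms together are at most b + a + c ≤ κ exp(π |Im z|).
  refine ⟨(b + a + c) / κ, κ, hκ0, fun z hz => ?_⟩
  have hexp : b + a + c ≤ κ * Real.exp (π * |z.im|) := by
    rw [div_le_iff₀ hκ0] at hz
    have h1 := Real.add_one_le_exp (π * |z.im|)
    have h2 : |z.im| ≤ π * |z.im| := by nlinarith [Real.pi_gt_three, abs_nonneg z.im]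
    nlinarith
  have hterm1 : ‖coefPlus V / 2 * Complex.exp (Complex.I * π * z)‖ =
      a / 2 * Real.exp (-(π * z.im)) := by
    rw [norm_mul, norm_exp_pi, norm_div, Complex.norm_ofNat]
  have hterm2 : ‖coefMinus V / 2 * Complex.exp (-(Complex.I * π * z))‖ =
      c / 2 * Real.exp (π * z.im) := by
    rw [norm_mul, norm_exp_neg_pi, norm_div, Complex.norm_ofNat]
  rw [freeDet]
  set A := coefPlus V / 2 * Complex.exp (Complex.I * π * z)
  set C := coefMinus V / 2 * Complex.exp (-(Complex.I * π * z))
  have hpos := Real.exp_pos (π * |z.im|)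
  rcases le_total 0 z.im with him | him
  · rw [abs_of_nonneg him] at *
    have h1 : Real.exp (-(π * z.im)) ≤ 1 := Real.exp_le_one_iff.2 (by
      have := mul_nonneg Real.pi_pos.le him
      linarith)
    have h2 : ‖C‖ ≤ ‖A + coefMid V + C‖ + (‖A‖ + b) := by
      have e : C = (A + coefMid V + C) - (A + coefMid V) := by ring
      calc ‖C‖ = ‖(A + coefMid V + C) - (A + coefMid V)‖ := by rw [← e]
        _ ≤ _ := (norm_sub_le _ _).trans (add_le_add_right (norm_add_le _ _) _)
    rw [hterm1, hterm2] at h2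
    nlinarith
  · rw [abs_of_nonpos him, mul_neg] at *
    have h1 : Real.exp (π * z.im) ≤ 1 := Real.exp_le_one_iff.2 (by
      have := mul_nonneg Real.pi_pos.le (neg_nonneg.2 him)
      linarith)
    have h2 : ‖A‖ ≤ ‖A + coefMid V + C‖ + (b + ‖C‖) := by
      have e : A = (A + coefMid V + C) - (coefMid V + C) := by ring
      calc ‖A‖ = ‖(A + coefMid V + C) - (coefMid V + C)‖ := by rw [← e]
        _ ≤ _ := (norm_sub_le _ _).trans (add_le_add_right (norm_add_le _ _) _)
    rw [hterm1, hterm2] at h2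
    nlinarith

/-- Lower bound for the free characteristic determinant away from its zeros. -/
theorem exists_le_norm_freeDet (h : IsFreeExponents V κ₀ κ₁) (ha : coefPlus V ≠ 0)
    (hc : coefMinus V ≠ 0) {δ : ℝ} (hδ : 0 < δ) : ∃ κ : ℝ, 0 < κ ∧ ∀ z : ℂ,
      (∀ n : ℤ, δ ≤ ‖z - freeEigenvalue κ₀ κ₁ n‖) →
      κ * Real.exp (π * |z.im|) ≤ ‖freeDet V z‖ := by
  obtain ⟨y, κ, hκ, hlarge⟩ := exists_le_norm_freeDet_of_large_im V ha hc
  -- By periodicity it suffices to consider one period rectangle below the height y, with the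
  -- δ-discs about the zeros removed; this set is compact and Δ⁰ has no zeros in it.
  set K : Set ℂ := (Set.Icc 0 2 ×ℂ Set.Icc (-y) y) ∩
    ⋂ n : ℤ, {z | δ ≤ ‖z - freeEigenvalue κ₀ κ₁ n‖} with hK
  have hKc : IsCompact K := by
    refine (isCompact_Icc.reProdIm isCompact_Icc).inter_right (isClosed_iInter fun n => ?_)
    exact isClosed_le continuous_const (by fun_prop)
  have hmin : ∃ m : ℝ, 0 < m ∧ ∀ z ∈ K, m ≤ ‖freeDet V z‖ := by
    rcases K.eq_empty_or_nonempty with he | hne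
    · exact ⟨1, one_pos, fun z hz => by rw [he] at hz; exact hz.elim⟩
    · obtain ⟨w, hw, hm⟩ := hKc.exists_isMinOn hne
        (differentiable_freeDet V).continuous.norm.continuousOn
      refine ⟨‖freeDet V w‖, norm_pos_iff.2 fun h0 => ?_, fun z hz => hm hz⟩
      obtain ⟨k, hk⟩ := (freeDet_eq_zero_iff h ha).1 h0
      have := Set.mem_iInter.1 hw.2 k
      rw [Set.mem_ofPred_eq, hk, sub_self, norm_zero] at this
      exact absurd hδ (not_lt.2 this)
  obtain ⟨m, hm0, hm⟩ := hmin
  refine ⟨min κ (m / Real.exp (π * y)), lt_min hκ (by positivity), fun z hz => ?_⟩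
  rcases le_or_gt y |z.im| with hy | hy
  · exact (mul_le_mul_of_nonneg_right (min_le_left _ _) (Real.exp_pos _).le).trans (hlarge z hy)
  · set k : ℤ := ⌊z.re / 2⌋ with hk
    have hzK : z - 2 * k ∈ K := by
      refine ⟨?_, Set.mem_iInter.2 fun n => ?_⟩
      · have h1 := Int.floor_le (z.re / 2)
        have h2 := Int.lt_floor_add_one (z.re / 2)
        rw [← hk] at h1 h2
        rw [Complex.mem_reProdIm]
        have hre : (z - 2 * (k : ℂ)).re = z.re - 2 * k := by simp
        have him : (z - 2 * (k : ℂ)).im = z.im := by simp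
        rw [hre, him]
        have h3 := abs_lt.1 hy
        exact ⟨⟨by linarith, by linarith⟩, ⟨by linarith, by linarith⟩⟩
      · have h1 := hz (n + 2 * k)
        rw [freeEigenvalue_add_two_mul] at h1
        rw [Set.mem_ofPred_eq]
        convert h1 using 2
        ring
    have h1 := hm _ hzK
    have e : freeDet V (z - 2 * k) = freeDet V z := by
      rw [← freeDet_add_two_mul V (z - 2 * k) k, sub_add_cancel]
    rw [e] at h1
    refine le_trans ?_ h1
    calc _ ≤ m / Real.exp (π * y) * Real.exp (π * y) := by
          refine mul_le_mul (min_le_right _ _) (Real.exp_le_exp.2 ?_) (Real.exp_pos _).le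
            (by positivity)
          exact mul_le_mul_of_nonneg_left hy.le Real.pi_pos.le
      _ = m := div_mul_cancel₀ _ (Real.exp_pos _).ne'

/-- Away from the zeros of the free characteristic determinant, the difference of the determinants
is smaller than the free determinant at all points of large modulus. -/
theorem Admissible.exists_norm_sub_lt {p p' : ℝ≥0∞} (hp : p⁻¹ + p'⁻¹ = 1) {R : ℝ}
    {Q : ℝ → Matrix (Fin 2) (Fin 2) ℂ} (hQ : Admissible p R Q) {U : Matrix (Fin 2) (Fin 4) ℂ}
    (hU : Regular U) (h : IsFreeExponents (assocBC Q U) κ₀ κ₁) {δ : ℝ} (hδ : 0 < δ) :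
    ∃ X : ℝ, ∀ z : ℂ, X ≤ ‖z‖ → (∀ n : ℤ, δ ≤ ‖z - freeEigenvalue κ₀ κ₁ n‖) →
      ‖charDet hQ.integrable U z - freeDet (assocBC Q U) z‖ < ‖freeDet (assocBC Q U) z‖ := by
  obtain ⟨κ, hκ, hlow⟩ := exists_le_norm_freeDet h (hU.coefPlus_ne_zero Q)
    (hU.coefMinus_ne_zero Q) hδ
  -- Above the height y the difference is at most half of the lower bound for Δ⁰. In the remaining
  -- strip the bound by Υ(π, ·) + Υ_{p'} tends to zero, so a large modulus suffices.
  obtain ⟨y, -, hy⟩ := norm_charDet_sub_le_of_large_im hQ.integrable hQ.trace_zero U (half_pos hκ)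
  set K := remainderConst U R y
  have hK : 0 ≤ K := remainderConst_nonneg U hQ.nonneg y
  obtain ⟨X, hX⟩ := exists_upsilonTotal_le hQ.integrable p' y
    (η := κ / 2 / (K + 1)) (by positivity)
  refine ⟨X, fun z hz hzn => ?_⟩
  have hl := hlow z hzn
  have hexp : 0 < κ * Real.exp (π * |z.im|) := mul_pos hκ (Real.exp_pos _)
  rcases le_or_gt y |z.im| with him | him
  · have := hy z him
    linarith
  · have h1 := hQ.norm_charDet_sub_le hp U him.le
    have h2 := mul_le_mul_of_nonneg_left (hX z him.le hz) hK
    have h3 : K * (κ / 2 / (K + 1)) ≤ κ / 2 := by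
      rw [mul_div_assoc', div_le_iff₀ (by positivity)]
      nlinarith
    have h4 : κ ≤ κ * Real.exp (π * |z.im|) := le_mul_of_one_le_right hκ.le
      (Real.one_le_exp (mul_nonneg Real.pi_pos.le (abs_nonneg _)))
    linarith

end LowerBounds


/-! ### Matching the zeros of the two determinants. -/

section Numbering

open Metric

variable {f g : ℂ → ℂ} {l : ℤ → ℂ} {δ ρ X : ℝ}

theorem ZeroIndex.apply_eq_zero (t : ZeroIndex f) : f t.1 = 0 :=
  apply_eq_zero_of_analyticOrderNatAt_ne_zero
    (Nat.pos_of_ne_zero (fun h0 => (Fin.elim0 (h0 ▸ t.2)))).ne'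

theorem nonempty_equiv_of_card {α β : Type*} (ha : Finite α) (hb : Finite β)
    (h : Nat.card α = Nat.card β) : Nonempty (α ≃ β) :=
  (Finite.card_eq).1 h

theorem exists_equiv_of_fiber {α β γ : Type*} (a : α → γ) (b : β → γ)
    (h : ∀ k, Nonempty ({x // a x = k} ≃ {y // b y = k})) : ∃ e : α ≃ β, ∀ x, b (e x) = a x :=
  ⟨Equiv.ofFiberEquiv fun k => (h k).some, fun x => Equiv.ofFiberEquiv_map _ x⟩

/-- It ensures that circles of radius δ about the points `l n` avoid the open δ-discs about all of
them, as the comparison estimate requires. -/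
theorem le_norm_sub_of_separated (hsep : ∀ m n, l m ≠ l n → 2 * δ ≤ ‖l m - l n‖) {z : ℂ} {n : ℤ}
    (hz : ‖z - l n‖ = δ) (m : ℤ) : δ ≤ ‖z - l m‖ := by
  by_cases hmn : l m = l n
  · rw [hmn, hz]
  · have h1 := hsep m n hmn
    have h2 : ‖l m - l n‖ ≤ ‖z - l n‖ + ‖z - l m‖ := by
      rw [show l m - l n = (z - l n) - (z - l m) by ring]
      exact norm_sub_le _ _
    linarith

theorem eq_of_separated (hsep : ∀ m n, l m ≠ l n → 2 * δ ≤ ‖l m - l n‖) {z : ℂ} {m n : ℤ}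
    (hm : ‖z - l m‖ ≤ δ) (hn : ‖z - l n‖ < δ) : l m = l n := by
  by_contra hne
  have h1 := hsep m n hne
  have h2 : ‖l m - l n‖ ≤ ‖z - l n‖ + ‖z - l m‖ := by
    rw [show l m - l n = (z - l n) - (z - l m) by ring]
    exact norm_sub_le _ _
  linarith

/-- Two entire functions that are close to each other away from the points `l n` have the same
zeros up to small shifts, apart from finitely many of them. -/
theorem exists_equiv_zeroIndex (hf : Differentiable ℂ f) (hg : Differentiable ℂ g) (hδ : 0 < δ)
    (hsep : ∀ m n, l m ≠ l n → 2 * δ ≤ ‖l m - l n‖) (hρ : 0 < ρ) (hX : X ≤ ρ)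
    (hgap : ∀ n, δ ≤ |‖l n‖ - ρ|)
    (hest : ∀ z, X ≤ ‖z‖ → (∀ n, δ ≤ ‖z - l n‖) → ‖f z - g z‖ < ‖g z‖) :
    ∃ e : ZeroIndex g ≃ ZeroIndex f, ∀ t n, t.1 = l n → ρ ≤ ‖l n‖ → ‖(e t).1 - l n‖ < δ := by
  classical
  -- Points are classed as `none` inside |z| < ρ, as `some (l n)` within δ of l n outside, and as
  -- `some z` otherwise; the last classes contain no zeros. A bijection is then built class by class
  -- from equal counts.
  let cls : ℂ → Option ℂ := fun z => if ‖z‖ < ρ then none else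
    if h : ∃ n, ‖z - l n‖ < δ then some (l h.choose) else some z
  have hnone : ∀ z, cls z = none ↔ z ∈ ball 0 ρ := by
    intro z
    rw [mem_ball_zero_iff]
    simp only [cls]
    split_ifs <;> simp_all
  have heq : ∀ {z : ℂ} {m n : ℤ}, ‖z - l m‖ < δ → ‖z - l n‖ < δ → l m = l n := by
    intro z m n hm hn
    exact eq_of_separated hsep hm.le hn
  -- The gap keeps the δ-discs from crossing the circle |z| = ρ, so no disc is split between two
  -- classes.
  have hout : ∀ n, ρ - δ < ‖l n‖ → ρ + δ ≤ ‖l n‖ := by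
    intro n hn
    have h1 := hgap n
    rcases le_abs.1 h1 with h | h <;> linarith
  have hfar : ∀ {z : ℂ} {n : ℤ}, ρ ≤ ‖z‖ → ‖z - l n‖ < δ → ρ + δ ≤ ‖l n‖ := by
    intro z n hz hn
    refine hout n ?_
    have := norm_sub_norm_le z (l n)
    linarith
  have hsome : ∀ {z : ℂ} {n : ℤ}, ρ ≤ ‖l n‖ → ‖z - l n‖ < δ → cls z = some (l n) := by
    intro z n hln hn
    have h1 : ¬ ‖z‖ < ρ := by
      have h2 := hout n (by linarith)
      have h3 := norm_sub_norm_le (l n) z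
      rw [norm_sub_rev] at h3
      linarith
    have h2 : ∃ n, ‖z - l n‖ < δ := ⟨n, hn⟩
    simp only [cls, if_neg h1, dif_pos h2]
    rw [heq h2.choose_spec hn]
  have hsome' : ∀ {z w : ℂ}, (∃ n, ‖z - l n‖ < δ) → cls z = some w →
      ∃ n, w = l n ∧ ρ ≤ ‖l n‖ ∧ ‖z - l n‖ < δ := by
    intro z w h2 hz
    have h1 : ¬ ‖z‖ < ρ := fun h1 => by simp [cls, h1] at hz
    simp only [cls, if_neg h1, dif_pos h2] at hz
    refine ⟨h2.choose, (Option.some_injective _ hz).symm, ?_, h2.choose_spec⟩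
    linarith [hfar (not_lt.1 h1) h2.choose_spec]
  have hnear : ∀ {z : ℂ}, ρ ≤ ‖z‖ → f z = 0 ∨ g z = 0 → ∃ n, ‖z - l n‖ < δ := by
    intro z hz h0
    by_contra hcon
    push Not at hcon
    have h1 := ne_zero_of_norm_sub_lt (hest z (hX.trans hz) hcon)
    exact h0.elim h1.1 h1.2
  have hnotball : ∀ {z w : ℂ}, cls z = some w → ρ ≤ ‖z‖ := by
    intro z w hz
    by_contra h1
    have h2 := (hnone z).2 (mem_ball_zero_iff.2 (not_le.1 h1))
    rw [h2] at hz
    exact Option.some_ne_none _ hz.symm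
  have hfib : ∀ k : Option ℂ, Nonempty ({t : ZeroIndex g // cls t.1 = k} ≃
      {t : ZeroIndex f // cls t.1 = k}) := by
    intro k
    rcases k with _ | w
    · obtain ⟨a, b, c⟩ := rouche (f := f) (g := g) (c := 0) hf hg hρ fun z hz => by
        rw [mem_sphere_zero_iff_norm] at hz
        refine hest z (hX.trans hz.ge) fun n => (hgap n).trans ?_
        rw [← hz, abs_sub_comm]
        exact abs_norm_sub_norm_le _ _
      obtain ⟨e⟩ := nonempty_equiv_of_card b a c.symm
      exact ⟨(Equiv.subtypeEquivRight fun t : ZeroIndex g => hnone t.1).trans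
        (e.trans (Equiv.subtypeEquivRight fun t : ZeroIndex f => (hnone t.1).symm))⟩
    · by_cases hw : ∃ n, w = l n ∧ ρ ≤ ‖l n‖
      · obtain ⟨n, rfl, hn⟩ := hw
        have hiff : ∀ z : ℂ, f z = 0 ∨ g z = 0 → (cls z = some (l n) ↔ z ∈ ball (l n) δ) := by
          intro z h0
          rw [mem_ball_iff_norm]
          refine ⟨fun hz => ?_, fun hz => hsome hn hz⟩
          obtain ⟨m, hm, -, hz'⟩ := hsome' (hnear (hnotball hz) h0) hz
          rwa [hm]
        obtain ⟨a, b, c⟩ := rouche (f := f) (g := g) (c := l n) hf hg hδ fun z hz => by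
          rw [mem_sphere_iff_norm] at hz
          refine hest z ?_ fun m => ?_
          · have h2 := hout n (by linarith)
            have h3 := norm_sub_norm_le (l n) z
            rw [norm_sub_rev] at h3
            linarith
          · exact le_norm_sub_of_separated hsep hz m
        obtain ⟨e⟩ := nonempty_equiv_of_card b a c.symm
        exact ⟨(Equiv.subtypeEquivRight fun t : ZeroIndex g =>
          hiff t.1 (Or.inr t.apply_eq_zero)).trans (e.trans
            (Equiv.subtypeEquivRight fun t : ZeroIndex f =>
            (hiff t.1 (Or.inl t.apply_eq_zero)).symm))⟩
      · have hno : ∀ z : ℂ, f z = 0 ∨ g z = 0 → cls z ≠ some w := by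
          intro z h0 hz
          obtain ⟨m, hm, h1, -⟩ := hsome' (hnear (hnotball hz) h0) hz
          exact hw ⟨m, hm, h1⟩
        have : IsEmpty {t : ZeroIndex g // cls t.1 = some w} :=
          ⟨fun t => hno t.1.1 (Or.inr t.1.apply_eq_zero) t.2⟩
        have : IsEmpty {t : ZeroIndex f // cls t.1 = some w} :=
          ⟨fun t => hno t.1.1 (Or.inl t.1.apply_eq_zero) t.2⟩
        exact ⟨Equiv.equivOfIsEmpty _ _⟩
  obtain ⟨s, hs⟩ := exists_equiv_of_fiber (fun t : ZeroIndex g => cls t.1)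
    (fun t : ZeroIndex f => cls t.1) hfib
  refine ⟨s, fun t n ht hn => ?_⟩
  have h1 := hs t
  rw [hsome (z := t.1) hn (by rw [ht, sub_self, norm_zero]; exact hδ)] at h1
  obtain ⟨m, hm, -, h2⟩ := hsome' (hnear (hnotball h1) (Or.inl (s t).apply_eq_zero)) h1
  rwa [hm]

/-- A family of complex numbers at bounded distance from the integers leaves gaps in modulus. -/
theorem exists_radius_gap {C : ℝ} (hl : ∀ n : ℤ, ‖l n - n‖ ≤ C) (hδ : 0 < δ) (hδ8 : δ ≤ 1 / 8)
    (X : ℝ) : ∃ ρ, X ≤ ρ ∧ ∀ n, δ ≤ |‖l n‖ - ρ| := by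
  by_contra hcon
  push Not at hcon
  obtain ⟨B, hB⟩ := exists_nat_ge (|X| + C + 1)
  -- Were there no gap, each radius |X| + 2δj would have some l(nⱼ) within δ of it in modulus, and
  -- the nⱼ would be distinct. For j < 4B + 4, the bound δ ≤ 1/8 confines them to the 4B + 3
  -- integers of modulus at most 2B + 1, against the pigeonhole principle.
  choose n hn using fun j : ℕ => hcon (|X| + 2 * δ * j)
    ((le_abs_self X).trans (le_add_of_nonneg_right (by positivity)))
  have hinj : Function.Injective n := by
    intro i j hij
    have h1 := hn i
    have h2 := hn j
    rw [hij] at h1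
    rw [abs_lt] at h1 h2
    have h3 : 2 * δ * ((i : ℝ) - j) < 2 * δ * 1 := by linarith
    have h4 : 2 * δ * ((j : ℝ) - i) < 2 * δ * 1 := by linarith
    have h5 := lt_of_mul_lt_mul_left h3 (by positivity)
    have h6 := lt_of_mul_lt_mul_left h4 (by positivity)
    have h7 : (i : ℝ) < j + 1 := by linarith
    have h8 : (j : ℝ) < i + 1 := by linarith
    norm_cast at h7 h8
    omega
  have hmaps : ∀ j ∈ Finset.range (4 * B + 4),
      n j ∈ Finset.Icc (-(2 * B + 1 : ℤ)) (2 * B + 1) := by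
    intro j hj
    have hj' : (j : ℝ) ≤ 4 * B + 4 := by exact_mod_cast (Finset.mem_range.1 hj).le
    have h1 := (abs_lt.1 (hn j)).2
    have h2 : ‖((n j : ℤ) : ℂ)‖ ≤ ‖l (n j)‖ + C := by
      have h3 := norm_sub_norm_le ((n j : ℤ) : ℂ) (l (n j))
      rw [norm_sub_rev] at h3
      linarith [hl (n j)]
    rw [Complex.norm_intCast] at h2
    have h3 : 2 * δ * j ≤ B + 1 := by nlinarith
    have h4 : (|n j| : ℝ) ≤ 2 * B + 1 := by
      linarith
    rw [Finset.mem_Icc, ← abs_le]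
    exact_mod_cast h4
  have hcard := Finset.card_le_card_of_injOn n hmaps hinj.injOn
  rw [Finset.card_range, Int.card_Icc] at hcard
  omega

/-- Zeros of Δ⁰ are isolated, and by 2-periodicity the indices 0 and 1 determine a uniform distance.
The bound 1/8 is what the search for a radius with a gap requires. -/
theorem exists_separation {V : Matrix (Fin 2) (Fin 4) ℂ} {κ₀ κ₁ : ℂ}
    (h : IsFreeExponents V κ₀ κ₁) (ha : coefPlus V ≠ 0) : ∃ δ : ℝ, 0 < δ ∧ δ ≤ 1 / 8 ∧
      ∀ m n : ℤ, freeEigenvalue κ₀ κ₁ m ≠ freeEigenvalue κ₀ κ₁ n →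
        2 * δ ≤ ‖freeEigenvalue κ₀ κ₁ m - freeEigenvalue κ₀ κ₁ n‖ := by
  have key : ∀ n : ℤ, ∃ r > 0, ∀ m : ℤ, freeEigenvalue κ₀ κ₁ m ≠ freeEigenvalue κ₀ κ₁ n →
      r ≤ ‖freeEigenvalue κ₀ κ₁ m - freeEigenvalue κ₀ κ₁ n‖ := by
    intro n
    have han := (differentiable_freeDet V).analyticAt (freeEigenvalue κ₀ κ₁ n)
    have hne := han.eventually_eq_zero_or_eventually_ne_zero.resolve_left fun h0 => by
      have h1 := analyticOrderAt_eq_top.2 h0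
      rw [order_freeDet_freeEigenvalue h ha n] at h1
      exact ENat.natCast_ne_top _ h1
    rw [eventually_nhdsWithin_iff, Metric.eventually_nhds_iff] at hne
    obtain ⟨r, hr, hball⟩ := hne
    refine ⟨r, hr, fun m hm => ?_⟩
    by_contra hlt
    refine hball (y := freeEigenvalue κ₀ κ₁ m) ?_ hm ((freeDet_eq_zero_iff h ha).2 ⟨m, rfl⟩)
    rw [dist_eq_norm]
    exact not_le.1 hlt
  obtain ⟨r₀, hr₀, h₀⟩ := key 0
  obtain ⟨r₁, hr₁, h₁⟩ := key 1
  refine ⟨min (min r₀ r₁ / 2) (1 / 8), by positivity, min_le_right _ _, fun m n hmn => ?_⟩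
  have hle : 2 * min (min r₀ r₁ / 2) (1 / 8) ≤ min r₀ r₁ := by
    have := min_le_left (min r₀ r₁ / 2) (1 / 8)
    linarith
  refine hle.trans ?_
  have hshift : ∀ (j k : ℤ), n = j + 2 * k → freeEigenvalue κ₀ κ₁ m - freeEigenvalue κ₀ κ₁ n =
      freeEigenvalue κ₀ κ₁ (m + 2 * -k) - freeEigenvalue κ₀ κ₁ j := by
    intro j k hn
    rw [hn, freeEigenvalue_add_two_mul, freeEigenvalue_add_two_mul]
    push_cast
    ring
  obtain ⟨k, hk | hk⟩ := Int.even_or_odd' n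
  · rw [← sub_ne_zero, hshift 0 k (by omega), sub_ne_zero] at hmn
    rw [hshift 0 k (by omega)]
    exact (min_le_left _ _).trans (h₀ _ hmn)
  · rw [← sub_ne_zero, hshift 1 k (by omega), sub_ne_zero] at hmn
    rw [hshift 1 k (by omega)]
    exact (min_le_right _ _).trans (h₁ _ hmn)

theorem norm_freeEigenvalue_sub_le (κ₀ κ₁ : ℂ) (n : ℤ) :
    ‖freeEigenvalue κ₀ κ₁ n - n‖ ≤ ‖κ₀‖ + ‖κ₁‖ := by
  rw [freeEigenvalue]
  split_ifs
  · rw [add_sub_cancel_right]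
    exact le_add_of_nonneg_right (norm_nonneg _)
  · rw [add_sub_cancel_right]
    exact le_add_of_nonneg_left (norm_nonneg _)

theorem nonempty_zeroIndex_fiber_equiv (f : ℂ → ℂ) (μ : ℂ) :
    Nonempty ({t : ZeroIndex f // t.1 = μ} ≃ Fin (analyticOrderNatAt f μ)) :=
  ⟨{ toFun := fun t => t.2 ▸ t.1.2
     invFun := fun i => ⟨⟨μ, i⟩, rfl⟩
     left_inv := by rintro ⟨⟨_, i⟩, rfl⟩; rfl
     right_inv := fun i => rfl }⟩

/-- The free eigenvalues are the zeros of the free characteristic determinant. -/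
theorem exists_equiv_zeroIndex_freeDet {V : Matrix (Fin 2) (Fin 4) ℂ} {κ₀ κ₁ : ℂ}
    (h : IsFreeExponents V κ₀ κ₁) (ha : coefPlus V ≠ 0) :
    ∃ e : ℤ ≃ ZeroIndex (freeDet V), ∀ n, (e n).1 = freeEigenvalue κ₀ κ₁ n := by
  have hfib : ∀ μ : ℂ, Nonempty ({n : ℤ // freeEigenvalue κ₀ κ₁ n = μ} ≃
      {t : ZeroIndex (freeDet V) // t.1 = μ}) := by
    intro μ
    obtain ⟨hfin, ho⟩ := ncard_freeEigenvalue h ha μ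
    obtain ⟨e⟩ := nonempty_zeroIndex_fiber_equiv (freeDet V) μ
    refine nonempty_equiv_of_card hfin (Finite.of_equiv _ e.symm) ?_
    rw [Nat.card_congr e, Nat.card_fin, analyticOrderNatAt, ho]
    rfl
  obtain ⟨e, he⟩ := exists_equiv_of_fiber (freeEigenvalue κ₀ κ₁)
    (fun t : ZeroIndex (freeDet V) => t.1) hfib
  exact ⟨e, he⟩

/-- A numbering of the zeros of the characteristic determinant is a numbering of the eigenvalues. -/
theorem isEigenvalueNumbering_of_zeroIndex {Q : ℝ → Matrix (Fin 2) (Fin 2) ℂ}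
    (hQ : EntryIntegrable Q) (U : Matrix (Fin 2) (Fin 4) ℂ) {z₀ : ℂ} (hz₀ : charDet hQ U z₀ ≠ 0)
    (e : ℤ ≃ ZeroIndex (charDet hQ U)) :
    IsEigenvalueNumbering (diracOperator Q U) fun n => (e n).1 := by
  intro μ
  have hd : Differentiable ℂ (charDet hQ U) := fun z => (analyticAt_charDet hQ U z).differentiableAt
  have hrank := rank_rootSubspace hQ U (μ := μ) (m := analyticOrderNatAt (charDet hQ U) μ)
    (Nat.cast_analyticOrderNatAt (analyticOrderAt_ne_top_of_differentiable hd hz₀ μ)).symm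
  obtain ⟨e'⟩ := nonempty_zeroIndex_fiber_equiv (charDet hQ U) μ
  have e2 : {n : ℤ | (e n).1 = μ} ≃ Fin (analyticOrderNatAt (charDet hQ U) μ) :=
    (e.subtypeEquiv fun n => Iff.rfl).trans e'
  refine ⟨Finite.of_equiv _ e2.symm, ?_, ?_⟩
  · exact Module.rank_lt_aleph0_iff.1 (hrank ▸ Cardinal.natCast_lt_aleph0)
  · rw [Module.finrank_eq_of_rank_eq hrank, ← Nat.card_coe_set_eq, Nat.card_congr e2,
      Nat.card_eq_fintype_card, Fintype.card_fin]

/-- If Rouché's theorem applies on two concentric circles, all zeros in the large disc lie in the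
small one. -/
theorem mem_ball_of_rouche (hf : Differentiable ℂ f) (hg : Differentiable ℂ g) {c : ℂ} {r : ℝ}
    (hr : 0 < r) (hrδ : r ≤ δ) (h1 : ∀ z ∈ sphere c r, ‖f z - g z‖ < ‖g z‖)
    (h2 : ∀ z ∈ sphere c δ, ‖f z - g z‖ < ‖g z‖) (hc : ∀ z ∈ ball c δ, g z = 0 → z = c)
    {μ : ℂ} (hμ : μ ∈ ball c δ) (h0 : f μ = 0) : μ ∈ ball c r := by
  obtain ⟨a, -, e⟩ := rouche hf hg hr h1
  obtain ⟨a', -, e'⟩ := rouche hf hg (hr.trans_le hrδ) h2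
  obtain ⟨z₀, hz₀⟩ := (NormedSpace.sphere_nonempty (x := c) (r := r)).2 hr.le
  have hne := (ne_zero_of_norm_sub_lt (h1 z₀ hz₀)).1
  by_contra hcon
  -- The only possible zero of g in the large disc is its center, so g has equally many zeros in
  -- both discs. By Rouché's theorem so has f, and an extra zero in between would break the
  -- equality.
  have hsub : {t : ZeroIndex g | t.1 ∈ ball c r} = {t : ZeroIndex g | t.1 ∈ ball c δ} := by
    ext t
    refine ⟨fun ht => ball_subset_ball hrδ ht, fun ht => ?_⟩
    have := hc _ ht t.apply_eq_zero
    rw [Set.mem_ofPred_eq, this]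
    exact mem_ball_self hr
  have hcard : {t : ZeroIndex f | t.1 ∈ ball c r}.ncard =
      {t : ZeroIndex f | t.1 ∈ ball c δ}.ncard := by
    have e1 : {t : ZeroIndex f | t.1 ∈ ball c r}.ncard =
        {t : ZeroIndex g | t.1 ∈ ball c r}.ncard := e
    have e2 : {t : ZeroIndex f | t.1 ∈ ball c δ}.ncard =
        {t : ZeroIndex g | t.1 ∈ ball c δ}.ncard := e'
    rw [e1, e2, hsub]
  have hord : analyticOrderNatAt f μ ≠ 0 :=
    fun h => (analyticOrderNatAt_eq_zero_iff hf hne).1 h h0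
  have hlt : {t : ZeroIndex f | t.1 ∈ ball c r} ⊂ {t : ZeroIndex f | t.1 ∈ ball c δ} := by
    refine ⟨fun t ht => ball_subset_ball hrδ ht, fun hss => hcon ?_⟩
    exact hss (a := (⟨μ, ⟨0, Nat.pos_of_ne_zero hord⟩⟩ : ZeroIndex f)) hμ
  exact (Set.ncard_lt_ncard hlt a').ne hcard

end Numbering


/-! ### Localization of the eigenvalues of large index. -/

section Localization

open Metric

theorem exists_nat_of_eventually_cofinite {P : ℤ → Prop} (h : ∀ᶠ n in cofinite, P n) :
    ∃ N : ℕ, ∀ n : ℤ, (N : ℤ) ≤ |n| → P n := by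
  obtain ⟨b, hb⟩ := (Set.Finite.image Int.natAbs (eventually_cofinite.1 h)).bddAbove
  refine ⟨b + 1, fun n hn => ?_⟩
  by_contra hP
  have h1 : n.natAbs ≤ b := hb ⟨n, hP, rfl⟩
  rw [Int.abs_eq_natAbs] at hn
  omega

theorem eventually_le_norm_freeEigenvalue (κ₀ κ₁ : ℂ) (X : ℝ) :
    ∀ᶠ n in cofinite, X ≤ ‖freeEigenvalue κ₀ κ₁ n‖ := by
  obtain ⟨N, hN⟩ := exists_nat_ge (X + (‖κ₀‖ + ‖κ₁‖))
  refine eventually_cofinite.2 ((Set.finite_Icc (-(N : ℤ)) N).subset fun n hn => ?_)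
  rw [Set.mem_ofPred_eq, not_le] at hn
  have h1 := norm_freeEigenvalue_sub_le κ₀ κ₁ n
  have h2 := norm_sub_norm_le (n : ℂ) (freeEigenvalue κ₀ κ₁ n)
  rw [norm_sub_rev, Complex.norm_intCast] at h2
  have h3 : (|n| : ℝ) ≤ N := by linarith
  exact abs_le.1 (by exact_mod_cast h3)

variable {p p' : ℝ≥0∞} {R : ℝ} {Q : ℝ → Matrix (Fin 2) (Fin 2) ℂ}
  {U : Matrix (Fin 2) (Fin 4) ℂ} {κ₀ κ₁ : ℂ}

theorem tendsto_discMax (hQ : EntryIntegrable Q) (ν : ℝ≥0∞) {ε α : ℝ} (hε : 0 < ε)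
    (hν : 1 ≤ ν)
    (hα : ∀ n : ℤ, ∀ z ∈ closedBall (freeEigenvalue κ₀ κ₁ n) ε, |z.im| < α) :
    Tendsto (fun n : ℤ => discMax Q ν (freeEigenvalue κ₀ κ₁ n) ε) cofinite (𝓝 0) := by
  refine Metric.tendsto_nhds.2 fun η hη => ?_
  obtain ⟨X, hX⟩ := exists_upsilonTotal_le hQ ν α (half_pos hη)
  filter_upwards [eventually_le_norm_freeEigenvalue κ₀ κ₁ (X + ε)] with n hn
  rw [Real.dist_eq, sub_zero, abs_of_nonneg (discMax_nonneg hQ hν _ hε.le)]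
  refine (discMax_le hε.le fun z hz => hX z (hα n z hz).le ?_).trans_lt (half_lt_self hη)
  have h1 := norm_sub_norm_le (freeEigenvalue κ₀ κ₁ n) z
  rw [norm_sub_rev] at h1
  have h2 := mem_closedBall_iff_norm.1 hz
  linarith

/-- The eigenvalues can be numbered so that the `n`-th one is close to the `n`-th free one. -/
theorem Admissible.exists_numbering (hp : p⁻¹ + p'⁻¹ = 1) (hQ : Admissible p R Q) (hU : Regular U)
    (h : IsFreeExponents (assocBC Q U) κ₀ κ₁) :
    IsEigenvalueNumbering (diracOperator 0 (assocBC Q U)) (freeEigenvalue κ₀ κ₁) ∧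
    ∃ ev : ℤ → ℂ, IsEigenvalueNumbering (diracOperator Q U) ev ∧
      (∀ n, charDet hQ.integrable U (ev n) = 0) ∧ ∃ δ : ℝ, 0 < δ ∧
      (∀ m n : ℤ, freeEigenvalue κ₀ κ₁ m ≠ freeEigenvalue κ₀ κ₁ n →
        2 * δ ≤ ‖freeEigenvalue κ₀ κ₁ m - freeEigenvalue κ₀ κ₁ n‖) ∧
      ∀ᶠ n in cofinite, ‖ev n - freeEigenvalue κ₀ κ₁ n‖ < δ ∧
        ∀ z ∈ sphere (freeEigenvalue κ₀ κ₁ n) δ,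
          ‖charDet hQ.integrable U z - freeDet (assocBC Q U) z‖ < ‖freeDet (assocBC Q U) z‖ := by
  set V := assocBC Q U
  have ha : coefPlus V ≠ 0 := hU.coefPlus_ne_zero Q
  -- δ depends on the free eigenvalues only, so the numbering is fixed before any ε is chosen.
  obtain ⟨δ, hδ, hδ8, hsep⟩ := exists_separation h ha
  obtain ⟨X, hX⟩ := hQ.exists_norm_sub_lt hp hU h hδ
  have hev : ∀ᶠ n in cofinite, ∀ z ∈ sphere (freeEigenvalue κ₀ κ₁ n) δ,
      ‖charDet hQ.integrable U z - freeDet V z‖ < ‖freeDet V z‖ := by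
    filter_upwards [eventually_le_norm_freeEigenvalue κ₀ κ₁ (X + δ)] with n hn z hz
    rw [mem_sphere_iff_norm] at hz
    refine hX z ?_ (le_norm_sub_of_separated hsep hz)
    have h1 := norm_sub_norm_le (freeEigenvalue κ₀ κ₁ n) z
    rw [norm_sub_rev] at h1
    linarith
  obtain ⟨n₀, hn₀⟩ := hev.exists
  obtain ⟨z₀, hz₀⟩ := (NormedSpace.sphere_nonempty (x := freeEigenvalue κ₀ κ₁ n₀) (r := δ)).2 hδ.le
  obtain ⟨hf0, hg0⟩ := ne_zero_of_norm_sub_lt (hn₀ z₀ hz₀)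
  have hd : Differentiable ℂ (charDet hQ.integrable U) :=
    fun z => (analyticAt_charDet hQ.integrable U z).differentiableAt
  -- The radius exceeds X for the comparison estimate, and 1 so that it is positive.
  obtain ⟨ρ, hρ, hgap⟩ := exists_radius_gap (norm_freeEigenvalue_sub_le κ₀ κ₁) hδ hδ8 (max X 1)
  obtain ⟨e₀, he₀⟩ := exists_equiv_zeroIndex_freeDet h ha
  obtain ⟨e, he⟩ := exists_equiv_zeroIndex hd (differentiable_freeDet V) hδ hsep
    (zero_lt_one.trans_le ((le_max_right _ _).trans hρ)) ((le_max_left _ _).trans hρ) hgap hX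
  constructor
  · have hfun : charDet entryIntegrable_zero V = freeDet V := funext (charDet_zero V)
    have h1 := exists_equiv_zeroIndex_freeDet h ha
    rw [← hfun] at h1 hg0
    obtain ⟨e₁, he₁⟩ := h1
    have h2 := isEigenvalueNumbering_of_zeroIndex entryIntegrable_zero V hg0 e₁
    simpa only [he₁] using h2
  · refine ⟨fun n => (e (e₀ n)).1,
      isEigenvalueNumbering_of_zeroIndex hQ.integrable U hf0 (e₀.trans e),
      fun n => (e (e₀ n)).apply_eq_zero, δ, hδ, hsep, ?_⟩
    filter_upwards [hev, eventually_le_norm_freeEigenvalue κ₀ κ₁ ρ] with n h1 h2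
    exact ⟨he _ n (he₀ n) h2, h1⟩

/-- The smallest root of the equation for the radius. -/
theorem exists_isLeast_radius (hQ : EntryIntegrable Q) {ν : ℝ≥0∞} (hν : 1 ≤ ν) {z₀ : ℂ}
    {ε c M t : ℝ} {m : ℕ} (hm : m ≠ 0) (ht : 0 ≤ t) (htε : t ≤ ε) (hc : 0 < c) (hM : 0 < M)
    (hs : discMax Q ν z₀ ε < c * t ^ m / M) :
    ∃ r, IsLeast {r : ℝ | 0 ≤ r ∧ r ≤ ε ∧ discMax Q ν z₀ r = c * r ^ m / M} r ∧ r < t := by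
  have hε : 0 ≤ ε := ht.trans htε
  have hcd : ContinuousOn (discMax Q ν z₀) (Set.Icc 0 ε) :=
    (continuousOn_discMax hQ hν z₀).mono fun x hx => hx.1
  have hcr : ContinuousOn (fun r : ℝ => c * r ^ m / M) (Set.Icc 0 ε) := by fun_prop
  set S : Set ℝ := {r : ℝ | 0 ≤ r ∧ r ≤ ε ∧ discMax Q ν z₀ r = c * r ^ m / M} with hS
  -- Intermediate value theorem: at 0 the right-hand side is 0 and does not exceed s(0), while at ε
  -- it exceeds s(ε).
  have hne : S.Nonempty := by
    have hg : ContinuousOn (fun r => c * r ^ m / M - discMax Q ν z₀ r) (Set.Icc 0 ε) :=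
      hcr.sub hcd
    have h0 : (0 : ℝ) ∈ Set.Icc (c * 0 ^ m / M - discMax Q ν z₀ 0)
        (c * ε ^ m / M - discMax Q ν z₀ ε) := by
      constructor
      · rw [zero_pow hm, mul_zero, zero_div, zero_sub, neg_nonpos]
        exact discMax_nonneg hQ hν z₀ le_rfl
      · have : c * t ^ m / M ≤ c * ε ^ m / M := by gcongr
        linarith
    obtain ⟨r, hr, hr0⟩ := intermediate_value_Icc hε hg h0
    exact ⟨r, hr.1, hr.2, (sub_eq_zero.1 hr0).symm⟩
  have hcompact : IsCompact S := by
    have hcl : IsClosed (Set.Icc 0 ε ∩ (fun r => discMax Q ν z₀ r - c * r ^ m / M) ⁻¹' {0}) :=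
      (hcd.sub hcr).preimage_isClosed_of_isClosed isClosed_Icc isClosed_singleton
    have heq : S = Set.Icc 0 ε ∩ (fun r => discMax Q ν z₀ r - c * r ^ m / M) ⁻¹' {0} := by
      ext r
      rw [Set.mem_inter_iff, Set.mem_preimage, Set.mem_singleton_iff, sub_eq_zero, Set.mem_Icc,
        and_assoc]
      rfl
    rw [heq]
    exact isCompact_Icc.of_isClosed_subset hcl Set.inter_subset_left
  obtain ⟨r, hr⟩ := hcompact.exists_isLeast hne
  refine ⟨r, hr, ?_⟩
  obtain ⟨h0, h1, h2⟩ := hr.1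
  -- At the root, c r^m / M = s(r) ≤ s(ε) < c t^m / M by monotonicity of s.
  have h3 : c * r ^ m / M < c * t ^ m / M :=
    h2.symm.trans_le (discMax_mono hQ hν z₀ h0 h1) |>.trans_lt hs
  rw [div_lt_div_iff_of_pos_right hM] at h3
  exact lt_of_pow_lt_pow_left₀ m ht (lt_of_mul_lt_mul_left h3 hc.le)

/-- Localization of the eigenvalues of large number. -/
theorem Admissible.exists_radius (hp : p⁻¹ + p'⁻¹ = 1) (hν : 1 ≤ p') (hQ : Admissible p R Q)
    (hU : Regular U) (h : IsFreeExponents (assocBC Q U) κ₀ κ₁) {ev : ℤ → ℂ}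
    (hev : ∀ n, charDet hQ.integrable U (ev n) = 0) {δ : ℝ} (hδ : 0 < δ)
    (hsep : ∀ m n : ℤ, freeEigenvalue κ₀ κ₁ m ≠ freeEigenvalue κ₀ κ₁ n →
        2 * δ ≤ ‖freeEigenvalue κ₀ κ₁ m - freeEigenvalue κ₀ κ₁ n‖)
    (hnear : ∀ᶠ n in cofinite, ‖ev n - freeEigenvalue κ₀ κ₁ n‖ < δ ∧
        ∀ z ∈ sphere (freeEigenvalue κ₀ κ₁ n) δ,
          ‖charDet hQ.integrable U z - freeDet (assocBC Q U) z‖ < ‖freeDet (assocBC Q U) z‖)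
    {α ε c M : ℝ} {m : ℕ} (hm : m ≠ 0) (hε : 0 < ε) (hc : 0 < c) (hM : 0 < M)
    (hMα : remainderConst U R α ≤ M)
    (hα : ∀ n : ℤ, ∀ z ∈ closedBall (freeEigenvalue κ₀ κ₁ n) ε, |z.im| < α)
    (hlow : DetLowerBound (assocBC Q U) (freeEigenvalue κ₀ κ₁) ε m c) :
    ∃ N : ℕ, ∀ n : ℤ, (N : ℤ) ≤ |n| → ∃ r : ℝ,
      IsLeast {r : ℝ | 0 ≤ r ∧ r ≤ ε ∧
        discMax Q p' (freeEigenvalue κ₀ κ₁ n) r = c * r ^ m / M} r ∧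
      ‖ev n - freeEigenvalue κ₀ κ₁ n‖ ≤ r ∧ r ≤ 1 ∧
      r ^ m ≤ M / c * discMax Q p' (freeEigenvalue κ₀ κ₁ n) ε := by
  have ha := hU.coefPlus_ne_zero Q
  refine exists_nat_of_eventually_cofinite ?_
  -- A root below t is smaller than ε, as the lower bound for Δ⁰ demands, at most δ, as the
  -- comparison of two concentric discs demands, and at most 1, which yields r² ≤ r in the double
  -- case.
  set t := min ε (min δ 1) with ht
  have ht0 : 0 < t := lt_min hε (lt_min hδ one_pos)
  have htε : t ≤ ε := min_le_left _ _
  have htδ : t ≤ δ := (min_le_right _ _).trans (min_le_left _ _)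
  have ht1 : t ≤ 1 := (min_le_right _ _).trans (min_le_right _ _)
  have hsmall := (tendsto_discMax hQ.integrable p' hε hν hα).eventually_lt_const
    (show 0 < c * t ^ m / M by positivity)
  filter_upwards [hnear, hsmall] with n ⟨hn, hsph⟩ hs
  obtain ⟨r, hr, hrt⟩ := exists_isLeast_radius hQ.integrable hν hm ht0.le htε hc hM hs
  obtain ⟨hr0, hrε, hreq⟩ := hr.1
  refine ⟨r, hr, ?_, (hrt.trans_le ht1).le, ?_⟩
  · have honly : ∀ z ∈ ball (freeEigenvalue κ₀ κ₁ n) δ, freeDet (assocBC Q U) z = 0 →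
        z = freeEigenvalue κ₀ κ₁ n := by
      intro z hz hz0
      obtain ⟨k, hk⟩ := (freeDet_eq_zero_iff h ha).1 hz0
      rw [← hk]
      exact eq_of_separated hsep (z := z) (by rw [hk, sub_self, norm_zero]; exact hδ.le)
        (mem_ball_iff_norm.1 hz)
    have hball : ev n ∈ ball (freeEigenvalue κ₀ κ₁ n) δ := mem_ball_iff_norm.2 hn
    rcases hr0.eq_or_lt with h0 | hpos
    -- If r = 0, then s(0) = 0, so the remainder vanishes at the center and the determinants
    -- coincide. The eigenvalue is then a zero of Δ⁰ within δ of λ⁰ₙ, hence λ⁰ₙ itself.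
    · rw [← h0, zero_pow hm, mul_zero, zero_div] at hreq
      have h1 : upsilonTotal Q p' (freeEigenvalue κ₀ κ₁ n) = 0 := by
        refine le_antisymm ?_ (upsilonTotal_nonneg _ _ _)
        rw [← hreq]
        exact upsilonTotal_le_discMax hQ.integrable hν (mem_closedBall_self le_rfl)
      have h2 := charDet_eq_freeDet_of_upsilonTotal hQ.integrable hQ.trace_zero U hν h1 (ev n)
      rw [hev n] at h2
      rw [honly _ hball h2.symm, sub_self, norm_zero]
      exact hr0
    · have hd : Differentiable ℂ (charDet hQ.integrable U) :=
        fun z => (analyticAt_charDet hQ.integrable U z).differentiableAt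
      refine (mem_ball_iff_norm.1 (mem_ball_of_rouche hd (differentiable_freeDet _) hpos
        (hrt.le.trans htδ) (fun z hz => ?_) hsph honly hball (hev n))).le
      have hzr : ‖z - freeEigenvalue κ₀ κ₁ n‖ = r := mem_sphere_iff_norm.1 hz
      have hzε : z ∈ closedBall (freeEigenvalue κ₀ κ₁ n) ε :=
        mem_closedBall_iff_norm.2 (hzr.trans_le hrε)
      have h1 := hlow n z (by rw [hzr]; exact hpos) (by rw [hzr]; exact hrt.trans_le htε)
      rw [hzr] at h1
      -- The equation for r is designed for this chain: on the circle |Δ - Δ⁰| ≤ M s(r) = c r^m <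
      -- |Δ⁰|.
      calc _ ≤ remainderConst U R α * upsilonTotal Q p' z :=
            hQ.norm_charDet_sub_le hp U (hα n z hzε).le
        _ ≤ M * discMax Q p' (freeEigenvalue κ₀ κ₁ n) r :=
            mul_le_mul hMα (upsilonTotal_le_discMax hQ.integrable hν (sphere_subset_closedBall hz))
              (upsilonTotal_nonneg _ _ _) hM.le
        _ = c * r ^ m := by rw [hreq, mul_div_cancel₀ _ hM.ne']
        _ < _ := h1
  · have h1 := discMax_mono hQ.integrable hν (freeEigenvalue κ₀ κ₁ n) hr0 hrε
    rw [hreq, div_le_iff₀ hM] at h1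
    rw [div_mul_eq_mul_div, le_div_iff₀ hc]
    linarith

end Localization

end SummableDirac

theorem theorem4p3 (U : Matrix (Fin 2) (Fin 4) ℂ) (hU : Regular U)
    (R α : ℝ) (hR : 0 < R) (hα : 0 < α) :
    ∃ M : ℝ, 0 < M ∧
      ∀ (p p' : ℝ≥0∞), 1 ≤ p → p ≠ ⊤ → p⁻¹ + p'⁻¹ = 1 →
      ∀ Q : ℝ → Matrix (Fin 2) (Fin 2) ℂ, Admissible p R Q →
      ∀ κ₀ κ₁ : ℂ, IsFreeExponents (assocBC Q U) κ₀ κ₁ →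
        IsEigenvalueNumbering (diracOperator 0 (assocBC Q U)) (freeEigenvalue κ₀ κ₁) ∧
        ∃ ev : ℤ → ℂ, IsEigenvalueNumbering (diracOperator Q U) ev ∧
          ∀ ε : ℝ, 0 < ε →
            (∀ m n : ℤ, freeEigenvalue κ₀ κ₁ m ≠ freeEigenvalue κ₀ κ₁ n →
              Disjoint (Metric.closedBall (freeEigenvalue κ₀ κ₁ m) ε)
                (Metric.closedBall (freeEigenvalue κ₀ κ₁ n) ε)) →
            (∀ n : ℤ, ∀ z ∈ Metric.closedBall (freeEigenvalue κ₀ κ₁ n) ε, |z.im| < α) →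
            Tendsto (fun n : ℤ => discMax Q p' (freeEigenvalue κ₀ κ₁ n) ε) cofinite (𝓝 0) ∧
            (StronglyRegular Q U →
              (∃ c₁ : ℝ, 0 < c₁ ∧
                DetLowerBound (assocBC Q U) (freeEigenvalue κ₀ κ₁) ε 1 c₁) ∧
              ∀ c₁ : ℝ, 0 < c₁ →
                DetLowerBound (assocBC Q U) (freeEigenvalue κ₀ κ₁) ε 1 c₁ →
                ∃ N : ℕ, ∀ n : ℤ, (N : ℤ) ≤ |n| → ∃ r : ℝ,
                  IsLeast {r : ℝ | 0 ≤ r ∧ r ≤ ε ∧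
                    discMax Q p' (freeEigenvalue κ₀ κ₁ n) r = c₁ * r / M} r ∧
                  ‖ev n - freeEigenvalue κ₀ κ₁ n‖ ≤ r ∧
                  r ≤ M / c₁ * discMax Q p' (freeEigenvalue κ₀ κ₁ n) ε) ∧
            (¬ StronglyRegular Q U →
              (∃ c₂ : ℝ, 0 < c₂ ∧
                DetLowerBound (assocBC Q U) (freeEigenvalue κ₀ κ₁) ε 2 c₂) ∧
              ∀ c₂ : ℝ, 0 < c₂ →
                DetLowerBound (assocBC Q U) (freeEigenvalue κ₀ κ₁) ε 2 c₂ →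
                ∃ N : ℕ, ∀ n : ℤ, (N : ℤ) ≤ |n| → ∃ r : ℝ,
                  IsLeast {r : ℝ | 0 ≤ r ∧ r ≤ ε ∧
                    discMax Q p' (freeEigenvalue κ₀ κ₁ n) r = c₂ * r ^ 2 / M} r ∧
                  ‖ev n - freeEigenvalue κ₀ κ₁ n‖ ≤ r ∧
                  ‖ev n - freeEigenvalue κ₀ κ₁ n‖ ^ 2 ≤ r ∧
                  r ≤ Real.sqrt (M / c₂ * discMax Q p' (freeEigenvalue κ₀ κ₁ n) ε)) := by
  -- Adding 1 makes M positive also when the remainder constant is zero. M is fixed before p, Q and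
  -- ε.
  set M : ℝ := remainderConst U R α + 1 with hMdef
  have hM : 0 < M := add_pos_of_nonneg_of_pos (remainderConst_nonneg U hR.le α) one_pos
  refine ⟨M, hM, fun p p' _ _ hp Q hQ κ₀ κ₁ h => ?_⟩
  have hν : 1 ≤ p' := by
    rw [← ENNReal.inv_le_one, ← hp]
    exact le_add_self
  have ha := hU.coefPlus_ne_zero Q
  obtain ⟨hfree, ev, hnum, hzero, δ, hδ, hsep, hnear⟩ := hQ.exists_numbering hp hU h
  refine ⟨hfree, ev, hnum, fun ε hε hdis hα' => ⟨tendsto_discMax hQ.integrable p' hε hν hα', ?_, ?_⟩⟩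
  · intro hs
    refine ⟨?_, fun c hc hlow => ?_⟩
    · simpa only [if_neg hs.2] using exists_detLowerBound h ha hε hdis
    · obtain ⟨N, hN⟩ := hQ.exists_radius hp hν hU h hzero hδ hsep hnear one_ne_zero hε hc hM
        (le_add_of_nonneg_right zero_le_one) hα' hlow
      refine ⟨N, fun n hn => ?_⟩
      obtain ⟨r, hr, h1, -, h2⟩ := hN n hn
      simp only [pow_one] at hr h2
      exact ⟨r, hr, h1, h2⟩
  · intro hs
    -- Regularity holds, so strong regularity can fail only through a vanishing discriminant, and
    -- then every free eigenvalue is double.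
    have hdisc : freeDiscr (assocBC Q U) = 0 := not_not.1 fun h0 => hs ⟨hU, h0⟩
    refine ⟨?_, fun c hc hlow => ?_⟩
    · simpa only [if_pos hdisc] using exists_detLowerBound h ha hε hdis
    · obtain ⟨N, hN⟩ := hQ.exists_radius hp hν hU h hzero hδ hsep hnear two_ne_zero hε hc hM
        (le_add_of_nonneg_right zero_le_one) hα' hlow
      refine ⟨N, fun n hn => ?_⟩
      obtain ⟨r, hr, h1, hr1, h2⟩ := hN n hn
      have hr0 := hr.1.1
      refine ⟨r, hr, h1, ?_, Real.le_sqrt_of_sq_le h2⟩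
      -- The bound r ≤ 1 gives r² ≤ r.
      calc _ ≤ r ^ 2 := by gcongr
        _ ≤ r := by nlinarith
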